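/- Let $\mathcal C$ be a category with finite limits. *Spans.* $\mathrm{Spn}\,\mathcal C$ is the bicategory whose objects are those of $\mathcal C$, whose morphisms $X\to Y$ are spans $X\leftarrow S\to Y$ (composed by pullback), and whose 2-cells are morphisms of spans. *Notions in a bicategory $\mathcal M$.* A functor $F:\mathcal E\to\mathcal B$ is a *groupoid fibration* if for every $e\in\mathcal E$ and $\beta:b\to Fe$ there are $\chi:e'\to e$ and an isomorphism $i:b\cong Fe'$ with $F\chi\circ i=\beta$, and every morphism of $\mathcal E$ is $F$-cartesian. A morphism $p:E\to B$ of $\mathcal M$ is a *groupoid fibration* if $\mathcal M(K,p):\mathcal M(K,E)\to\mathcal M(K,B)$ is one for all $K\in\mathcal M$. A morphism $n:Y\to Z$ is a *right lifter* if every $u:K\to Z$ has a right lifting through $n$. A *calibration* of $\mathcal M$ is a class of morphisms, called neat, such that: (P0) equivalences are neat, and a morphism isomorphic to a neat one is neat; (P1) for $p$ neat, $p\circ q$ is neat if and only if $q$ is neat; (P2) neat morphisms are groupoid fibrations; (P3) every cospan $S\xrightarrow{p}Y\xleftarrow{n}T$ with $p$ neat and $n$ a right lifter has a bipullback $S\xleftarrow{\tilde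 n}P\xrightarrow{\tilde p}T$ with $\tilde p$ neat. $\mathcal M$ is *polynomic* if the class of all groupoid fibrations is a calibration. *Polynomials in a calibrated bicategory $\mathcal M$.* $\mathrm{Poly}\,\mathcal M$ is the bicategory with the objects of $\mathcal M$, with morphisms $X\to Y$ the spans $X\xleftarrow{m}S\xrightarrow{p}Y$ with $m$ a right lifter and $p$ neat (*polynomials*), and with 2-cells $(m,S,p)\to(m',S',p')$ the classes $[\lambda,h,\rho]$ of triples (*polynomial morphisms*) consisting of a morphism $h:S\to S'$, a 2-cell $\lambda:m'h\Rightarrow m$ and an invertible 2-cell $\rho:p\Rightarrow p'h$, where two triples are identified when they are connected by 2-cells $\sigma:h\Rightarrow k$ compatible with $\lambda$ and $\rho$. Polynomials are composed by the bipullbacks of (P3). The horizontal composite of $[\lambda_h,h,\rho_h]:(m,S,p)\to(m',S',p')$ and $[\lambda_k,k,\rho_k]:(n,T,q)\to(n',T',q')$ is the class of the triple $\bigl((\lambda_h\tilde n)(m'\sigma),\ \ell,\ (q'\tau)(\rho_k\tilde p)\bigr)$, where $\ell:P\to P'$ is a morphism between the vertices of the chosen bipullbacks, with 2-cells $\sigma:\tilde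 n'\ell\Rightarrow h\tilde n$ and invertible $\tau:k\tilde p\Rightarrow\tilde p'\ell$ which paste onto the bipullback square of $(p',n')$ to give $n'k\tilde p\xrightarrow{\lambda_k\tilde p}n\tilde p\cong p\tilde n\xrightarrow{\rho_h\tilde n}p'h\tilde n$ ($\sigma$ being invertible if this 2-cell is). $\mathrm{Poly}_{\mathrm s}\mathcal M$ is the sub-bicategory with all objects and morphisms and with the 2-cells $[\lambda,h,\rho]$ for which $\lambda$ is invertible (*strong* ones). *Polynomials in $\mathcal C$ (Gambino–Kock, Weber, Walker).* $\mathrm{Poly}(\mathcal C)$ is the bicategory with the objects of $\mathcal C$, with morphisms $X\to Y$ the diagrams $X\xleftarrow{s}E\xrightarrow{f}B\xrightarrow{t}Y$ in $\mathcal C$ with $f$ powerful (exponentiable, i.e. the functor $f^*:\mathcal C/B\to\mathcal C/E$ has a right adjoint), composed by means of pullbacks and dependent products, and with 2-cells $(s,f,t)\to(s',f',t')$ the pairs consisting of $\varphi:B\to B'$ with $t'\varphi=t$ and $\varepsilon: B\times_{B'}E'\to E$ over $B$ such that $s\varepsilon$ is the projection to $E'$ followed by $s'$. $\mathrm{Poly}_{\mathrm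 c}(\mathcal C)$ is its sub-bicategory with the same objects and morphisms, and with the cartesian 2-cells, those for which $\varepsilon$ is invertible. **Statement.** The bicategory $\mathrm{Spn}\,\mathcal C$ is polynomic. For the resulting calibration (all groupoid fibrations are neat), the bicategory $\mathrm{Poly}\,\mathrm{Spn}\,\mathcal C$ is biequivalent to $\mathrm{Poly}(\mathcal C)$, and the bicategory $\mathrm{Poly}_{\mathrm s}\mathrm{Spn}\,\mathcal C$ is biequivalent to $\mathrm{Poly}_{\mathrm c}(\mathcal C)$. -/

import Mathlib

open CategoryTheory Limits Bicategory

universe w v u uk va ua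

noncomputable section

/-- The objects of the bicategory of spans in `C` are those of `C`. -/
structure Spn (C : Type u) where
  obj : C

namespace Spn
variable {C : Type u} [Category.{v} C] [HasPullbacks C]

instance : CategoryStruct.{max u v} (Spn C) where
  Hom X Y := Span (C := C) ⊤ ⊤ X.obj Y.obj
  id X := Span.id X.obj
  comp P Q := Span.comp P Q

instance (X Y : Spn C) : Category.{v} (X ⟶ Y) :=
  inferInstanceAs (Category.{v} (Span (C := C) ⊤ ⊤ X.obj Y.obj))

/-- The map of apices underlying a 2-cell of spans. -/
def ap {X Y : Spn C} {P Q : X ⟶ Y} (α : P ⟶ Q) : P.apex ⟶ Q.apex := Span.Hom.hom α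

@[ext]
lemma hom₂_ext {X Y : Spn C} {P Q : X ⟶ Y} {α β : P ⟶ Q} (h : ap α = ap β) : α = β :=
  Span.hom_ext h

/-- A 2-cell of spans: a map of apices commuting with both legs. -/
def mk₂ {X Y : Spn C} {P Q : X ⟶ Y} (h : P.apex ⟶ Q.apex) (hl : h ≫ Q.l = P.l)
    (hr : h ≫ Q.r = P.r) : P ⟶ Q := Span.Hom.mk h hl hr

section
variable {X Y : Spn C} {P Q R : X ⟶ Y}
@[simp] lemma ap_mk₂ (h : P.apex ⟶ Q.apex) (hl : h ≫ Q.l = P.l) (hr : h ≫ Q.r = P.r) :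
    ap (mk₂ h hl hr) = h := rfl
@[simp] lemma ap_id : ap (𝟙 P) = 𝟙 P.apex := rfl
@[simp] lemma ap_comp (α : P ⟶ Q) (β : Q ⟶ R) : ap (α ≫ β) = ap α ≫ ap β := rfl
@[simp] lemma ap_l (α : P ⟶ Q) : ap α ≫ Q.l = P.l := α.hom_l
@[simp] lemma ap_r (α : P ⟶ Q) : ap α ≫ Q.r = P.r := α.hom_r
@[simp] lemma ap_l_assoc (α : P ⟶ Q) {Z : C} (f : X.obj ⟶ Z) : ap α ≫ Q.l ≫ f = P.l ≫ f := by
  rw [← Category.assoc, ap_l]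
@[simp] lemma ap_r_assoc (α : P ⟶ Q) {Z : C} (f : Y.obj ⟶ Z) : ap α ≫ Q.r ≫ f = P.r ≫ f := by
  rw [← Category.assoc, ap_r]
end

/-- The apex of a composite span is the pullback; these are its projections. -/
def π₁ {X Y Z : Spn C} (P : X ⟶ Y) (Q : Y ⟶ Z) : (P ≫ Q).apex ⟶ P.apex := pullback.fst P.r Q.l
def π₂ {X Y Z : Spn C} (P : X ⟶ Y) (Q : Y ⟶ Z) : (P ≫ Q).apex ⟶ Q.apex := pullback.snd P.r Q.l
def lift {X Y Z : Spn C} {P : X ⟶ Y} {Q : Y ⟶ Z} {U : C} (a : U ⟶ P.apex) (b : U ⟶ Q.apex)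
    (h : a ≫ P.r = b ≫ Q.l) : U ⟶ (P ≫ Q).apex := pullback.lift a b h

section
variable {X Y Z : Spn C} {P : X ⟶ Y} {Q : Y ⟶ Z} {U : C}
lemma condition : π₁ P Q ≫ P.r = π₂ P Q ≫ Q.l := pullback.condition
lemma condition_assoc {V : C} (f : Y.obj ⟶ V) : π₁ P Q ≫ P.r ≫ f = π₂ P Q ≫ Q.l ≫ f := by
  rw [← Category.assoc, condition, Category.assoc]
@[simp] lemma lift_π₁ (a : U ⟶ P.apex) (b : U ⟶ Q.apex) (h : a ≫ P.r = b ≫ Q.l) :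
    lift a b h ≫ π₁ P Q = a := pullback.lift_fst _ _ _
@[simp] lemma lift_π₂ (a : U ⟶ P.apex) (b : U ⟶ Q.apex) (h : a ≫ P.r = b ≫ Q.l) :
    lift a b h ≫ π₂ P Q = b := pullback.lift_snd _ _ _
@[simp] lemma lift_π₁_assoc (a : U ⟶ P.apex) (b : U ⟶ Q.apex) (h : a ≫ P.r = b ≫ Q.l)
    {V : C} (f : P.apex ⟶ V) : lift a b h ≫ π₁ P Q ≫ f = a ≫ f := by
  rw [← Category.assoc, lift_π₁]
@[simp] lemma lift_π₂_assoc (a : U ⟶ P.apex) (b : U ⟶ Q.apex) (h : a ≫ P.r = b ≫ Q.l)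
    {V : C} (f : Q.apex ⟶ V) : lift a b h ≫ π₂ P Q ≫ f = b ≫ f := by
  rw [← Category.assoc, lift_π₂]
@[ext] lemma apex_ext {f g : U ⟶ (P ≫ Q).apex} (h₁ : f ≫ π₁ P Q = g ≫ π₁ P Q)
    (h₂ : f ≫ π₂ P Q = g ≫ π₂ P Q) : f = g := pullback.hom_ext h₁ h₂
@[simp] lemma comp_l : (P ≫ Q).l = π₁ P Q ≫ P.l := (rfl)
@[simp] lemma comp_r : (P ≫ Q).r = π₂ P Q ≫ Q.r := (rfl)
end
section
variable {X Y : Spn C} (P : X ⟶ Y)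

/-- The apices of `𝟙 X ≫ P` and `P ≫ 𝟙 Y` are identified with that of `P` by the projections. -/
def unitL : P.apex ⟶ (𝟙 X ≫ P).apex :=
  pullback.lift (f := 𝟙 X.obj) (g := P.l) P.l (𝟙 P.apex) (by simp)
def unitR : P.apex ⟶ (P ≫ 𝟙 Y).apex :=
  pullback.lift (f := P.r) (g := 𝟙 Y.obj) (𝟙 P.apex) P.r (by simp)
@[simp] lemma unitL_π₂ : unitL P ≫ π₂ (𝟙 X) P = 𝟙 _ := pullback.lift_snd _ _ _
@[simp] lemma unitR_π₁ : unitR P ≫ π₁ P (𝟙 Y) = 𝟙 _ := pullback.lift_fst _ _ _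
@[simp] lemma unitL_π₂_assoc {Z : C} (f : P.apex ⟶ Z) : unitL P ≫ π₂ (𝟙 X) P ≫ f = f := by
  rw [← Category.assoc, unitL_π₂, Category.id_comp]
@[simp] lemma unitR_π₁_assoc {Z : C} (f : P.apex ⟶ Z) : unitR P ≫ π₁ P (𝟙 Y) ≫ f = f := by
  rw [← Category.assoc, unitR_π₁, Category.id_comp]
lemma id_comp_ext {U : C} {f g : U ⟶ (𝟙 X ≫ P).apex} (h : f ≫ π₂ (𝟙 X) P = g ≫ π₂ (𝟙 X) P) :
    f = g := (cancel_mono (pullback.snd (𝟙 X.obj) P.l)).1 h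
lemma comp_id_ext {U : C} {f g : U ⟶ (P ≫ 𝟙 Y).apex} (h : f ≫ π₁ P (𝟙 Y) = g ≫ π₁ P (𝟙 Y)) :
    f = g := (cancel_mono (pullback.fst P.r (𝟙 Y.obj))).1 h
lemma id_comp_l : (𝟙 X ≫ P).l = π₂ (𝟙 X) P ≫ P.l := by
  have c : pullback.fst (𝟙 X.obj) P.l ≫ 𝟙 _ = pullback.snd (𝟙 X.obj) P.l ≫ P.l := pullback.condition
  exact c
lemma comp_id_r : (P ≫ 𝟙 Y).r = π₁ P (𝟙 Y) ≫ P.r := by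
  have c : pullback.fst P.r (𝟙 Y.obj) ≫ P.r = pullback.snd P.r (𝟙 Y.obj) ≫ 𝟙 _ := pullback.condition
  exact c.symm
end

section
variable {W X Y Z : Spn C}

def wl (P : X ⟶ Y) {Q Q' : Y ⟶ Z} (β : Q ⟶ Q') : P ≫ Q ⟶ P ≫ Q' :=
  mk₂ (lift (π₁ P Q) (π₂ P Q ≫ ap β) (by simp [condition])) (by simp) (by simp)

def wr {P P' : X ⟶ Y} (α : P ⟶ P') (Q : Y ⟶ Z) : P ≫ Q ⟶ P' ≫ Q :=
  mk₂ (lift (π₁ P Q ≫ ap α) (π₂ P Q) (by simp [condition])) (by simp) (by simp)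

def assoc' (P : W ⟶ X) (Q : X ⟶ Y) (R : Y ⟶ Z) : (P ≫ Q) ≫ R ≅ P ≫ Q ≫ R where
  hom := mk₂ (lift (π₁ _ _ ≫ π₁ _ _) (lift (π₁ _ _ ≫ π₂ _ _) (π₂ _ _)
    (by simpa using condition (P := P ≫ Q) (Q := R))) (by simp [condition])) (by simp) (by simp)
  inv := mk₂ (lift (lift (π₁ _ _) (π₂ _ _ ≫ π₁ _ _)
    (by simpa using condition (P := P) (Q := Q ≫ R))) (π₂ _ _ ≫ π₂ _ _) (by simp [condition]))
    (by simp) (by simp)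
  hom_inv_id := by ext <;> simp
  inv_hom_id := by ext <;> simp

def left' (P : X ⟶ Y) : 𝟙 X ≫ P ≅ P where
  hom := mk₂ (π₂ (𝟙 X) P) (id_comp_l P).symm (comp_r).symm
  inv := mk₂ (unitL P) (by simp [id_comp_l, -comp_l]) (by simp)
  hom_inv_id := by ext1; apply id_comp_ext; simp
  inv_hom_id := by ext; simp

def right' (P : X ⟶ Y) : P ≫ 𝟙 Y ≅ P where
  hom := mk₂ (π₁ P (𝟙 Y)) (comp_l).symm (comp_id_r P).symm
  inv := mk₂ (unitR P) (by simp) (by simp [comp_id_r, -comp_r])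
  hom_inv_id := by ext1; apply comp_id_ext; simp
  inv_hom_id := by ext; simp
end

attribute [local simp] wl wr assoc' left' right' in
/-- The bicategory of spans: 1-cells `X ⟶ Y` are spans `X ← S → Y`, composed by pullback. -/
instance : Bicategory.{v, max u v} (Spn C) where
  whiskerLeft P _ _ β := wl P β
  whiskerRight α Q := wr α Q
  associator := assoc'
  leftUnitor := left'
  rightUnitor := right'
  whiskerLeft_id _ _ := by ext <;> simp
  whiskerLeft_comp _ _ _ _ _ _ := by ext <;> simp
  id_whiskerLeft _ := by ext1; apply id_comp_ext; simp
  comp_whiskerLeft _ _ _ _ _ := by ext <;> simp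
  id_whiskerRight _ _ := by ext <;> simp
  comp_whiskerRight _ _ _ := by ext <;> simp
  whiskerRight_id _ := by ext1; apply comp_id_ext; simp
  whiskerRight_comp _ _ _ := by ext <;> simp
  whisker_assoc _ _ _ _ _ := by ext <;> simp
  whisker_exchange _ _ := by ext <;> simp
  pentagon _ _ _ _ := by ext <;> simp
  triangle _ _ := by ext <;> simp

end Spn

end

noncomputable section

/-- An action of bicategory data (1-cells, 2-cells, composites) on families of categories. -/
structure BicatAction (B : Type u) [CategoryStruct.{v} B] [∀ X Y : B, Category.{w} (X ⟶ Y)] where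
  κ : Type uk
  A : κ → B → Type ua
  [cat : ∀ k X, Category.{va} (A k X)]
  F : ∀ (k : κ) {X Y : B}, (X ⟶ Y) → (A k X ⥤ A k Y)
  map : ∀ (k : κ) {X Y : B} {P Q : X ⟶ Y}, (P ⟶ Q) → (F k P ⟶ F k Q)
  map_id : ∀ (k : κ) {X Y : B} (P : X ⟶ Y), map k (𝟙 P) = 𝟙 _
  map_comp : ∀ (k : κ) {X Y : B} {P Q R : X ⟶ Y} (f : P ⟶ Q) (g : Q ⟶ R),
    map k (f ≫ g) = map k f ≫ map k g
  faithful : ∀ {X Y : B} {P Q : X ⟶ Y} (f g : P ⟶ Q), (∀ k, map k f = map k g) → f = g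
  φ : ∀ (k : κ) {X Y Z : B} (P : X ⟶ Y) (Q : Y ⟶ Z), F k (P ≫ Q) ≅ F k P ⋙ F k Q
  υ : ∀ (k : κ) (X : B), F k (𝟙 X) ≅ 𝟭 _

attribute [instance] BicatAction.cat

/-- Structure cells compatible with an action. -/
structure BicatAction.Cells {B : Type u} [CategoryStruct.{v} B]
    [∀ X Y : B, Category.{w} (X ⟶ Y)] (a : BicatAction.{w, v, u, uk, va, ua} B) where
  wl : ∀ {X Y Z : B} (P : X ⟶ Y) {Q Q' : Y ⟶ Z}, (Q ⟶ Q') → (P ≫ Q ⟶ P ≫ Q')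
  wr : ∀ {X Y Z : B} {P P' : X ⟶ Y}, (P ⟶ P') → ∀ Q : Y ⟶ Z, (P ≫ Q ⟶ P' ≫ Q)
  assoc : ∀ {W X Y Z : B} (P : W ⟶ X) (Q : X ⟶ Y) (R : Y ⟶ Z), (P ≫ Q) ≫ R ≅ P ≫ Q ≫ R
  left : ∀ {X Y : B} (P : X ⟶ Y), 𝟙 X ≫ P ≅ P
  right : ∀ {X Y : B} (P : X ⟶ Y), P ≫ 𝟙 Y ≅ P
  wl_spec : ∀ k {X Y Z : B} (P : X ⟶ Y) {Q Q' : Y ⟶ Z} (β : Q ⟶ Q') (V : a.A k X),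
    (a.map k (wl P β)).app V ≫ (a.φ k P Q').hom.app V =
      (a.φ k P Q).hom.app V ≫ (a.map k β).app ((a.F k P).obj V)
  wr_spec : ∀ k {X Y Z : B} {P P' : X ⟶ Y} (α : P ⟶ P') (Q : Y ⟶ Z) (V : a.A k X),
    (a.map k (wr α Q)).app V ≫ (a.φ k P' Q).hom.app V =
      (a.φ k P Q).hom.app V ≫ (a.F k Q).map ((a.map k α).app V)
  assoc_spec : ∀ k {W X Y Z : B} (P : W ⟶ X) (Q : X ⟶ Y) (R : Y ⟶ Z) (V : a.A k W),
    (a.map k (assoc P Q R).hom).app V ≫ (a.φ k P (Q ≫ R)).hom.app V ≫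
      (a.φ k Q R).hom.app ((a.F k P).obj V) =
    (a.φ k (P ≫ Q) R).hom.app V ≫ (a.F k R).map ((a.φ k P Q).hom.app V)
  left_spec : ∀ k {X Y : B} (P : X ⟶ Y) (V : a.A k X), (a.map k (left P).hom).app V =
    (a.φ k (𝟙 X) P).hom.app V ≫ (a.F k P).map ((a.υ k X).hom.app V)
  right_spec : ∀ k {X Y : B} (P : X ⟶ Y) (V : a.A k X), (a.map k (right P).hom).app V =
    (a.φ k P (𝟙 Y)).hom.app V ≫ (a.υ k Y).hom.app ((a.F k P).obj V)

namespace BicatAction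
variable {B : Type u} [CategoryStruct.{v} B] [∀ X Y : B, Category.{w} (X ⟶ Y)]
  {a : BicatAction.{w, v, u, uk, va, ua} B}

lemma ext_app {X Y : B} {P Q : X ⟶ Y} {f g : P ⟶ Q}
    (h : ∀ k V, (a.map k f).app V = (a.map k g).app V) : f = g :=
  a.faithful _ _ fun k => NatTrans.ext (funext (h k))

lemma ext_comp {X Y Z : B} {R : X ⟶ Z} {P : X ⟶ Y} {Q : Y ⟶ Z} {f g : R ⟶ P ≫ Q}
    (h : ∀ k V, (a.map k f).app V ≫ (a.φ k P Q).hom.app V =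
      (a.map k g).app V ≫ (a.φ k P Q).hom.app V) : f = g :=
  ext_app fun k V => (cancel_mono ((a.φ k P Q).hom.app V)).1 (h k V)

lemma comp_app (k : a.κ) {X Y : B} {P Q R : X ⟶ Y} (f : P ⟶ Q) (g : Q ⟶ R) (V : a.A k X) :
    (a.map k (f ≫ g)).app V = (a.map k f).app V ≫ (a.map k g).app V := by
  rw [a.map_comp]; rfl

lemma id_app (k : a.κ) {X Y : B} (P : X ⟶ Y) (V : a.A k X) :
    (a.map k (𝟙 P)).app V = 𝟙 _ := by
  rw [a.map_id]; rfl

lemma φ_nat (k) {X Y Z : B} (P : X ⟶ Y) (Q : Y ⟶ Z) {V V' : a.A k X} (g : V ⟶ V') :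
    (a.F k (P ≫ Q)).map g ≫ (a.φ k P Q).hom.app V' =
    (a.φ k P Q).hom.app V ≫ (a.F k Q).map ((a.F k P).map g) := (a.φ k P Q).hom.naturality g
lemma φ_nat' (k) {X Y Z : B} (P : X ⟶ Y) (Q : Y ⟶ Z) {V V' : a.A k X} (g : V ⟶ V') {U} (f : _ ⟶ U) :
    (a.F k (P ≫ Q)).map g ≫ (a.φ k P Q).hom.app V' ≫ f =
    (a.φ k P Q).hom.app V ≫ (a.F k Q).map ((a.F k P).map g) ≫ f := by
  rw [← Category.assoc, φ_nat, Category.assoc]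

namespace Cells
variable (c : a.Cells)
attribute [local simp] comp_app id_app wl_spec wr_spec left_spec right_spec

lemma wl_spec' (k) {X Y Z : B} (P : X ⟶ Y) {Q Q' : Y ⟶ Z} (β : Q ⟶ Q') (V : a.A k X) {U} (f : _ ⟶ U):
    (a.map k (c.wl P β)).app V ≫ (a.φ k P Q').hom.app V ≫ f =
      (a.φ k P Q).hom.app V ≫ (a.map k β).app ((a.F k P).obj V) ≫ f := by
  rw [← Category.assoc, wl_spec, Category.assoc]
lemma wr_spec' (k) {X Y Z : B} {P P' : X ⟶ Y} (α : P ⟶ P') (Q : Y ⟶ Z) (V : a.A k X) {U} (f : _ ⟶ U) :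
    (a.map k (c.wr α Q)).app V ≫ (a.φ k P' Q).hom.app V ≫ f =
      (a.φ k P Q).hom.app V ≫ (a.F k Q).map ((a.map k α).app V) ≫ f := by
  rw [← Category.assoc, wr_spec, Category.assoc]
lemma assoc_spec' (k) {W X Y Z : B} (P : W ⟶ X) (Q : X ⟶ Y) (R : Y ⟶ Z) (V : a.A k W) {U} (f : _ ⟶ U) :
    (a.map k (c.assoc P Q R).hom).app V ≫ (a.φ k P (Q ≫ R)).hom.app V ≫
      (a.φ k Q R).hom.app ((a.F k P).obj V) ≫ f =
    (a.φ k (P ≫ Q) R).hom.app V ≫ (a.F k R).map ((a.φ k P Q).hom.app V) ≫ f := by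
  have := congrArg (· ≫ f) (c.assoc_spec k P Q R V)
  simpa using this
@[reducible] def toBicategory : Bicategory.{w, v} B where
  whiskerLeft P _ _ β := c.wl P β
  whiskerRight α Q := c.wr α Q
  associator := c.assoc
  leftUnitor := c.left
  rightUnitor := c.right
  whiskerLeft_id P Q := by
    refine ext_comp (a := a) fun k V => ?_
    simp
  whiskerLeft_comp P _ _ _ f g := by
    refine ext_comp (a := a) fun k V => ?_
    simp [wl_spec']
  id_whiskerLeft {X Y P Q} f := by
    rw [← Category.assoc, Iso.eq_comp_inv]
    exact ext_app (a := a) fun k V => by simp [wl_spec']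
  comp_whiskerLeft P Q _ _ f := by
    rw [← Category.assoc, Iso.eq_comp_inv]
    refine ext_comp (a := a) fun k V => ?_
    rw [← cancel_mono ((a.φ k Q _).hom.app _)]
    simp [wl_spec', assoc_spec', assoc_spec]
  id_whiskerRight P Q := by
    refine ext_comp (a := a) fun k V => ?_
    simp
  comp_whiskerRight f g Q := by
    refine ext_comp (a := a) fun k V => ?_
    simp [wr_spec']
  whiskerRight_id f := by
    rw [← Category.assoc, Iso.eq_comp_inv]
    exact ext_app (a := a) fun k V => by simp [wr_spec']
  whiskerRight_comp f Q R := by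
    rw [Iso.eq_inv_comp]
    refine ext_comp (a := a) fun k V => ?_
    rw [← cancel_mono ((a.φ k Q _).hom.app _)]
    simp [wr_spec', assoc_spec', assoc_spec]
    simp only [← Functor.map_comp, wr_spec]
  whisker_assoc P _ _ f R := by
    rw [← Category.assoc, Iso.eq_comp_inv]
    refine ext_comp (a := a) fun k V => ?_
    rw [← cancel_mono ((a.φ k _ R).hom.app _)]
    simp [wr_spec', assoc_spec', assoc_spec]
    simp only [← Functor.map_comp, wl_spec]
  whisker_exchange f g := by
    refine ext_comp (a := a) fun k V => ?_
    simp [wr_spec', wl_spec']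
  pentagon P Q R S := by
    refine ext_comp (a := a) fun k V => ?_
    rw [← cancel_mono ((a.φ k Q _).hom.app _), ← cancel_mono ((a.φ k R S).hom.app _)]
    have h := congrArg (a.F k S).map (c.assoc_spec k P Q R V)
    simp only [Functor.map_comp] at h
    simp [wr_spec', wl_spec', assoc_spec', assoc_spec, φ_nat', φ_nat]
    simp [h]
  triangle P Q := by
    refine ext_comp (a := a) fun k V => ?_
    simp [assoc_spec']

end Cells
end BicatAction

namespace CategoryTheory.Bicategory

/-- A functor is a groupoid fibration when every `b ⟶ F e` lifts up to isomorphism and every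
morphism of the domain is cartesian. -/
structure IsGroupoidFibration {E : Type*} {D : Type*} [Category E] [Category D] (F : E ⥤ D) :
    Prop where
  lift : ∀ (e : E) {b : D} (β : b ⟶ F.obj e),
    ∃ (e' : E) (χ : e' ⟶ e) (i : b ≅ F.obj e'), i.hom ≫ F.map χ = β
  cartesian : ∀ {e' e : E} (χ : e' ⟶ e) {k : E} (g : k ⟶ e) (b : F.obj k ⟶ F.obj e'),
    b ≫ F.map χ = F.map g → ∃! f : k ⟶ e', f ≫ χ = g ∧ F.map f = b

variable {M : Type u} [Bicategory.{w, v} M]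

/-- A 1-cell is a groupoid fibration when it is so representably. -/
def GF {E D : M} (p : E ⟶ D) : Prop := ∀ K : M, IsGroupoidFibration (postcomp K p)

/-- A right lifter: all right liftings through `n` exist. -/
def IsRightLifter {Y Z : M} (n : Y ⟶ Z) : Prop :=
  ∀ (K : M) (x : K ⟶ Z), ∃ t : RightLift n x, Nonempty t.IsKan

lemma square_nat {K P A B C : M} {n : A ⟶ C} {p : B ⟶ C} {d : P ⟶ A} {c : P ⟶ B}
    (θ : d ≫ n ⟶ c ≫ p) {x y : K ⟶ P} (σ : x ⟶ y) :
    σ ▷ d ▷ n ≫ (α_ y d n).hom ≫ y ◁ θ ≫ (α_ y c p).inv =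
      (α_ x d n).hom ≫ x ◁ θ ≫ (α_ x c p).inv ≫ σ ▷ c ▷ p := by
  rw [associator_naturality_left_assoc, ← whisker_exchange_assoc, associator_inv_naturality_left]

/-- The functor comparing 1-cells into the vertex of a square with the pseudopullback
of hom-categories. -/
def toPseudopullback {P A B C : M} {n : A ⟶ C} {p : B ⟶ C} {d : P ⟶ A} {c : P ⟶ B}
    (θ : d ≫ n ≅ c ≫ p) (K : M) : (K ⟶ P) ⥤ CategoricalPullback (postcomp K n) (postcomp K p) where
  obj x := ⟨x ≫ d, x ≫ c, (α_ x d n ≪≫ whiskerLeftIso x θ ≪≫ (α_ x c p).symm :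
    (x ≫ d) ≫ n ≅ (x ≫ c) ≫ p)⟩
  map {x y} σ := ⟨σ ▷ d, σ ▷ c, by
    change (σ ▷ d) ▷ n ≫ (α_ y d n).hom ≫ y ◁ θ.hom ≫ (α_ y c p).inv =
      ((α_ x d n).hom ≫ x ◁ θ.hom ≫ (α_ x c p).inv) ≫ (σ ▷ c) ▷ p
    simp [square_nat]⟩

/-- A square commuting up to the isomorphism `θ` is a bipullback. -/
def IsBipullback {P A B C : M} {n : A ⟶ C} {p : B ⟶ C} {d : P ⟶ A} {c : P ⟶ B}
    (θ : d ≫ n ≅ c ≫ p) : Prop := ∀ K : M, (toPseudopullback θ K).IsEquivalence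

/-- A calibration: a class of "neat" 1-cells subject to the following axioms. -/
structure IsCalibration (neat : ∀ {X Y : M}, (X ⟶ Y) → Prop) : Prop where
  equivalence : ∀ {X Y : M} (e : X ≌ Y), neat e.hom
  iso : ∀ {X Y : M} {p q : X ⟶ Y}, neat p → (p ≅ q) → neat q
  comp_iff : ∀ {X Y Z : M} (q : X ⟶ Y) (p : Y ⟶ Z), neat p → (neat (q ≫ p) ↔ neat q)
  gf : ∀ {X Y : M} (p : X ⟶ Y), neat p → GF p
  bipullback : ∀ {S T Y : M} (p : S ⟶ Y) (n : T ⟶ Y), neat p → IsRightLifter n →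
    ∃ (B : M) (d : B ⟶ T) (c : B ⟶ S) (θ : d ≫ n ≅ c ≫ p), IsBipullback θ ∧ neat d

variable (M) in
/-- A bicategory is polynomic when its groupoid fibrations form a calibration. -/
abbrev IsPolynomic : Prop := IsCalibration (M := M) GF

section lemmas

namespace GF
variable {E D : M} {p : E ⟶ D} {K : M}

lemma lift (hp : GF p) (e : K ⟶ E) {b : K ⟶ D} (β : b ⟶ e ≫ p) :
    ∃ (e' : K ⟶ E) (χ : e' ⟶ e) (i : b ≅ e' ≫ p), i.hom ≫ χ ▷ p = β := (hp K).lift e β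

lemma fill (hp : GF p) {e' e : K ⟶ E} (χ : e' ⟶ e) {k : K ⟶ E} (g : k ⟶ e) (b : k ≫ p ⟶ e' ≫ p)
    (h : b ≫ χ ▷ p = g ▷ p) : ∃ f : k ⟶ e', f ≫ χ = g ∧ f ▷ p = b :=
  ((hp K).cartesian χ g b h).exists

lemma fill_unique (hp : GF p) {e' e : K ⟶ E} (χ : e' ⟶ e) {k : K ⟶ E} {f f' : k ⟶ e'}
    (h : f ≫ χ = f' ≫ χ) (h' : f ▷ p = f' ▷ p) : f = f' :=
  ((hp K).cartesian χ (f' ≫ χ) (f' ▷ p) (by simp [postcomp])).unique ⟨h, h'⟩ ⟨rfl, rfl⟩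

lemma isIso (hp : GF p) {e' e : K ⟶ E} (χ : e' ⟶ e) [IsIso (χ ▷ p)] : IsIso χ := by
  obtain ⟨f, h1, h2⟩ := hp.fill χ (𝟙 e) (inv (χ ▷ p)) (by simp)
  exact ⟨f, hp.fill_unique χ (by simp [h1]) (by simp [h2]), h1⟩
end GF

lemma isRightLifter_iff {Y Z : M} (n : Y ⟶ Z) : IsRightLifter n ↔
    ∀ {K : M} (x : K ⟶ Z), ∃ (l : K ⟶ Y) (e₀ : l ≫ n ⟶ x), ∀ (k : K ⟶ Y) (μ : k ≫ n ⟶ x),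
      ∃! f : k ⟶ l, f ▷ n ≫ e₀ = μ := by
  refine ⟨fun h K x => ?_, fun h K x => ?_⟩
  · obtain ⟨t, ⟨ht⟩⟩ := h K x
    exact ⟨t.lift, t.counit, fun k μ => ⟨ht.desc (.mk k μ), ht.fac (.mk k μ), fun f hf =>
      ht.hom_ext (hf.trans (ht.fac (.mk k μ)).symm)⟩⟩
  · obtain ⟨l, e₀, hl⟩ := h x
    choose f hf hu using fun (s : RightLift n x) => hl s.lift s.counit
    exact ⟨.mk l e₀, ⟨.mk (fun s => RightLift.homMk (f s) (hf s))
      (fun s τ => CostructuredArrow.hom_ext _ _ (hu s τ.left (RightLift.w τ)))⟩⟩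

namespace IsBipullback
variable {P A B C : M} {n : A ⟶ C} {p : B ⟶ C} {d : P ⟶ A} {c : P ⟶ B}
  {θ : d ≫ n ≅ c ≫ p} {K : M}

lemma exists_lift (h : IsBipullback θ) (a : K ⟶ A) (b : K ⟶ B) (γ : a ≫ n ≅ b ≫ p) :
    ∃ (x : K ⟶ P) (τ : x ≫ d ≅ a) (σ : x ≫ c ≅ b),
      (α_ x d n).hom ≫ x ◁ θ.hom ≫ (α_ x c p).inv ≫ σ.hom ▷ p = τ.hom ▷ n ≫ γ.hom := by
  have := h K
  let y : CategoricalPullback (postcomp K n) (postcomp K p) := ⟨a, b, γ⟩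
  obtain ⟨x, ⟨i⟩⟩ : ∃ x, Nonempty ((toPseudopullback θ K).obj x ≅ y) :=
    ⟨_, ⟨(toPseudopullback θ K).objObjPreimageIso y⟩⟩
  let τ : x ≫ d ≅ a := (CategoricalPullback.π₁ _ _).mapIso i
  let σ : x ≫ c ≅ b := (CategoricalPullback.π₂ _ _).mapIso i
  have w : τ.hom ▷ n ≫ γ.hom =
    ((α_ x d n).hom ≫ x ◁ θ.hom ≫ (α_ x c p).inv) ≫ σ.hom ▷ p := i.hom.w
  exact ⟨x, τ, σ, by simpa using w.symm⟩

lemma exists_hom (h : IsBipullback θ) {x x' : K ⟶ P} (τ : x ≫ d ⟶ x' ≫ d) (σ : x ≫ c ⟶ x' ≫ c)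
    (w : (α_ x d n).hom ≫ x ◁ θ.hom ≫ (α_ x c p).inv ≫ σ ▷ p =
      τ ▷ n ≫ (α_ x' d n).hom ≫ x' ◁ θ.hom ≫ (α_ x' c p).inv) :
    ∃ ω : x ⟶ x', ω ▷ d = τ ∧ ω ▷ c = σ := by
  have := h K
  let g : (toPseudopullback θ K).obj x ⟶ (toPseudopullback θ K).obj x' :=
    ⟨τ, σ, by
      change τ ▷ n ≫ (α_ x' d n).hom ≫ x' ◁ θ.hom ≫ (α_ x' c p).inv =
        ((α_ x d n).hom ≫ x ◁ θ.hom ≫ (α_ x c p).inv) ≫ σ ▷ p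
      simpa using w.symm⟩
  refine ⟨(toPseudopullback θ K).preimage g, ?_, ?_⟩
  · exact congrArg CategoricalPullback.Hom.fst ((toPseudopullback θ K).map_preimage g)
  · exact congrArg CategoricalPullback.Hom.snd ((toPseudopullback θ K).map_preimage g)

lemma hom_ext (h : IsBipullback θ) {x x' : K ⟶ P} {ω ω' : x ⟶ x'} (h₁ : ω ▷ d = ω' ▷ d) (h₂ : ω ▷ c = ω' ▷ c) :
    ω = ω' := by
  have := h K
  apply (toPseudopullback θ K).map_injective
  exact CategoricalPullback.hom_ext h₁ h₂

/-- Lifting of squares filled by a possibly non-invertible 2-cell. -/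
lemma exists_lax_lift (h : IsBipullback θ) (hp : GF p) (a : K ⟶ A) (b : K ⟶ B) (ψ : a ≫ n ⟶ b ≫ p) :
    ∃ (x : K ⟶ P) (τ : a ≅ x ≫ d) (σ : x ≫ c ⟶ b),
      τ.hom ▷ n ≫ (α_ x d n).hom ≫ x ◁ θ.hom ≫ (α_ x c p).inv ≫ σ ▷ p = ψ ∧
      (IsIso ψ → IsIso σ) := by
  obtain ⟨b', χ, i, hi⟩ := hp.lift b ψ
  obtain ⟨x, τ, σ, e⟩ := h.exists_lift a b' i
  refine ⟨x, τ.symm, σ.hom ≫ χ, ?_, ?_⟩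
  · have e' := congrArg (fun z => τ.inv ▷ n ≫ z ≫ χ ▷ p) e
    simp only [Category.assoc, inv_hom_whiskerRight_assoc, hi] at e'
    simpa using e'
  · intro hψ
    have : IsIso (χ ▷ p) := by
      rw [← hi] at hψ
      exact IsIso.of_isIso_comp_left i.hom _
    have := hp.isIso χ
    infer_instance

/-- The pullback of a right lifter along a groupoid fibration is a right lifter. -/
lemma isRightLifter (h : IsBipullback θ) (hp : GF p) (hn : IsRightLifter n) : IsRightLifter c := by
  rw [isRightLifter_iff] at hn ⊢
  intro K b
  obtain ⟨l, e₀, hl⟩ := hn (b ≫ p)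
  obtain ⟨x, τ, σ, e, -⟩ := h.exists_lax_lift hp l b e₀
  have nat : ∀ {k k' : K ⟶ P} (f : k ⟶ k'), _ := fun f => square_nat θ.hom f
  refine ⟨x, σ, fun k μ => ?_⟩
  obtain ⟨f₀, hf₀, hu⟩ := hl (k ≫ d) ((α_ k d n).hom ≫ k ◁ θ.hom ≫ (α_ k c p).inv ≫ μ ▷ p)
  simp only at hf₀ hu
  obtain ⟨f₂, h1, h2⟩ := hp.fill σ μ ((α_ k c p).hom ≫ k ◁ θ.inv ≫ (α_ k d n).inv ≫
    (f₀ ≫ τ.hom) ▷ n ≫ (α_ x d n).hom ≫ x ◁ θ.hom ≫ (α_ x c p).inv) (by simp [e, hf₀])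
  obtain ⟨ω, hω, hω'⟩ := h.exists_hom (f₀ ≫ τ.hom) f₂ (by simp [h2])
  refine ⟨ω, by simp [hω', h1], fun ω' hω'' => ?_⟩
  have key : ω' ▷ d ≫ τ.inv = f₀ := hu _ (by
    have := nat ω'
    rw [← hω'', ← e, comp_whiskerRight, comp_whiskerRight, Category.assoc,
      inv_hom_whiskerRight_assoc]
    have e2 := congrArg (· ≫ σ ▷ p) this
    simpa using e2)
  have hd : ω' ▷ d = ω ▷ d := by rw [hω, ← key]; simp
  refine h.hom_ext hd (hp.fill_unique σ (by rw [hω'', hω', h1]) ?_)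
  have e1 := nat ω'
  rw [hd, nat ω] at e1
  simpa only [cancel_epi] using e1.symm
end IsBipullback

lemma IsRightLifter.id (X : M) : IsRightLifter (𝟙 X) := by
  rw [isRightLifter_iff]
  intro K x
  refine ⟨x, (ρ_ x).hom, fun k μ => ⟨(ρ_ k).inv ≫ μ, by simp, fun f hf => ?_⟩⟩
  simp [← hf]

lemma IsRightLifter.comp {X Y Z : M} {m : X ⟶ Y} {n : Y ⟶ Z} (hm : IsRightLifter m)
    (hn : IsRightLifter n) : IsRightLifter (m ≫ n) := by
  rw [isRightLifter_iff] at hm hn ⊢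
  intro K x
  obtain ⟨l, e₀, hl⟩ := hn x
  obtain ⟨l', e₁, hl'⟩ := hm l
  refine ⟨l', (α_ _ _ _).inv ≫ e₁ ▷ n ≫ e₀, fun k μ => ?_⟩
  obtain ⟨f, hf, hfu⟩ := hl (k ≫ m) ((α_ _ _ _).hom ≫ μ)
  obtain ⟨f', hf', hfu'⟩ := hl' k f
  simp only at hf hfu hf' hfu'
  refine ⟨f', by simp [← comp_whiskerRight_assoc, hf', hf], fun g hg => hfu' _ (hfu _ ?_)⟩
  rw [← hg]
  simp

end lemmas
end CategoryTheory.Bicategory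

end

noncomputable section

namespace CategoryTheory.Bicategory
variable {M : Type u} [Bicategory.{w, v} M]

namespace IsRightLifter
variable {Y Z : M} {n : Y ⟶ Z} (hn : IsRightLifter n) {K : M} (x : K ⟶ Z)

/-- A chosen right lifting through a right lifter. -/
def rif : K ⟶ Y := (hn K x).choose.lift
def ev : hn.rif x ≫ n ⟶ x := (hn K x).choose.counit
variable {x}
def desc {k : K ⟶ Y} (μ : k ≫ n ⟶ x) : k ⟶ hn.rif x :=
  (hn K x).choose_spec.some.desc (.mk k μ)
@[simp] lemma desc_ev {k : K ⟶ Y} (μ : k ≫ n ⟶ x) : hn.desc μ ▷ n ≫ hn.ev x = μ :=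
  (hn K x).choose_spec.some.fac (.mk k μ)
@[simp] lemma desc_ev_assoc {k : K ⟶ Y} (μ : k ≫ n ⟶ x) {z : K ⟶ Z} (g : x ⟶ z) :
    hn.desc μ ▷ n ≫ hn.ev x ≫ g = μ ≫ g := by rw [← Category.assoc, desc_ev]
lemma hom_ext {k : K ⟶ Y} {f g : k ⟶ hn.rif x} (h : f ▷ n ≫ hn.ev x = g ▷ n ≫ hn.ev x) : f = g :=
  (hn K x).choose_spec.some.hom_ext h
lemma comp_desc {k k' : K ⟶ Y} (f : k ⟶ k') (μ : k' ≫ n ⟶ x) :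
    f ≫ hn.desc μ = hn.desc (f ▷ n ≫ μ) := hn.hom_ext (by simp)
lemma desc_ev' : hn.desc (hn.ev x) = 𝟙 _ := hn.hom_ext (by simp)
end IsRightLifter

section
variable {neat : ∀ {X Y : M}, (X ⟶ Y) → Prop}

/-- The objects of the bicategory of polynomials in a calibrated bicategory `M` are those of `M`. -/
structure Poly (_h : IsCalibration neat) where
  obj : M

/-- A polynomial: a span whose left leg is a right lifter and whose right leg is neat. -/
structure PolySpan (neat : ∀ {X Y : M}, (X ⟶ Y) → Prop) (X Y : M) where
  apex : M
  l : apex ⟶ X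
  r : apex ⟶ Y
  lifter : IsRightLifter l
  neat_r : neat r

namespace PolySpan
variable {X Y Z : M}

/-- A polynomial morphism: a 1-cell between the apices with a 2-cell on the left and an
invertible 2-cell on the right. -/
structure Mor (P Q : PolySpan neat X Y) where
  h : P.apex ⟶ Q.apex
  lam : h ≫ Q.l ⟶ P.l
  rho : P.r ≅ h ≫ Q.r

/-- Two polynomial morphisms are connected by a 2-cell. -/
def Mor.Rel {P Q : PolySpan neat X Y} (f g : Mor P Q) : Prop :=
  ∃ σ : f.h ⟶ g.h, σ ▷ Q.l ≫ g.lam = f.lam ∧ f.rho.hom ≫ σ ▷ Q.r = g.rho.hom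

def Mor.id (P : PolySpan neat X Y) : Mor P P := ⟨𝟙 _, (λ_ _).hom, (λ_ _).symm⟩

def Mor.comp {P Q R : PolySpan neat X Y} (f : Mor P Q) (g : Mor Q R) : Mor P R :=
  ⟨f.h ≫ g.h, (α_ _ _ _).hom ≫ f.h ◁ g.lam ≫ f.lam,
    f.rho ≪≫ whiskerLeftIso f.h g.rho ≪≫ (α_ _ _ _).symm⟩

/-- The category of polynomials from `X` to `Y`: its morphisms are the connected components
of the categories of polynomial morphisms. -/
instance : Category (PolySpan neat X Y) where
  Hom P Q := Quot (Mor.Rel (P := P) (Q := Q))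
  id P := Quot.mk _ (Mor.id P)
  comp := Quot.map₂ Mor.comp
    (fun f g g' ⟨σ, h₁, h₂⟩ => ⟨f.h ◁ σ, by
      simp [Mor.comp, ← h₁], by simp [Mor.comp, ← h₂]⟩)
    (fun f f' g ⟨σ, h₁, h₂⟩ => ⟨σ ▷ g.h, by
      simp only [Mor.comp, ← h₁]; simp [whisker_exchange_assoc], by
      simp only [Mor.comp, Iso.trans_hom, whiskerLeftIso_hom, ← h₂]
      simp [← whisker_exchange_assoc]⟩)
  id_comp := by
    rintro P Q ⟨f⟩
    exact Quot.sound ⟨(λ_ _).hom, by simp [Mor.comp, Mor.id], by simp [Mor.comp, Mor.id]⟩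
  comp_id := by
    rintro P Q ⟨f⟩
    exact Quot.sound ⟨(ρ_ _).hom, by simp [Mor.comp, Mor.id], by simp [Mor.comp, Mor.id]⟩
  assoc := by
    rintro P Q R S ⟨f⟩ ⟨g⟩ ⟨k⟩
    exact Quot.sound ⟨(α_ _ _ _).hom, by simp [Mor.comp], by simp [Mor.comp]⟩

/-- The class of a polynomial morphism. -/
def Mor.cls {P Q : PolySpan neat X Y} (f : Mor P Q) : P ⟶ Q := Quot.mk _ f

lemma ind {P Q : PolySpan neat X Y} {p : (P ⟶ Q) → Prop} (h : ∀ f : Mor P Q, p f.cls)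
    (f : P ⟶ Q) : p f := Quot.ind h f

lemma Mor.cls_comp {P Q R : PolySpan neat X Y} (f : Mor P Q) (g : Mor Q R) :
    f.cls ≫ g.cls = (f.comp g).cls := rfl
lemma Mor.id_cls (P : PolySpan neat X Y) : 𝟙 P = (Mor.id P).cls := rfl

/-- The identity span as a polynomial. -/
def one (h : IsCalibration neat) (X : M) : PolySpan neat X X :=
  ⟨X, 𝟙 X, 𝟙 X, IsRightLifter.id X, h.equivalence (Equivalence.id X)⟩

lemma gf (h : IsCalibration neat) (P : PolySpan neat X Y) : GF P.r := h.gf _ P.neat_r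

section
variable (h : IsCalibration neat) (P : PolySpan neat X Y) (Q : PolySpan neat Y Z)

/-- The vertex, the projections and the 2-cell of a chosen bipullback of the right leg of `P` and
the left leg of `Q`. -/
def vtx : M := (h.bipullback P.r Q.l P.neat_r Q.lifter).choose
def pd : vtx h P Q ⟶ Q.apex := (h.bipullback P.r Q.l P.neat_r Q.lifter).choose_spec.choose
def pc : vtx h P Q ⟶ P.apex :=
  (h.bipullback P.r Q.l P.neat_r Q.lifter).choose_spec.choose_spec.choose
def θ : pd h P Q ≫ Q.l ≅ pc h P Q ≫ P.r :=
  (h.bipullback P.r Q.l P.neat_r Q.lifter).choose_spec.choose_spec.choose_spec.choose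
lemma isBipullback : IsBipullback (θ h P Q) :=
  (h.bipullback P.r Q.l P.neat_r Q.lifter).choose_spec.choose_spec.choose_spec.choose_spec.1
lemma neat_pd : neat (pd h P Q) :=
  (h.bipullback P.r Q.l P.neat_r Q.lifter).choose_spec.choose_spec.choose_spec.choose_spec.2
lemma lifter_pc : IsRightLifter (pc h P Q) :=
  (isBipullback h P Q).isRightLifter (gf h P) Q.lifter

/-- The composite of two polynomials. -/
def comp : PolySpan neat X Z :=
  ⟨vtx h P Q, pc h P Q ≫ P.l, pd h P Q ≫ Q.r, IsRightLifter.comp (lifter_pc h P Q) P.lifter,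
    (h.comp_iff _ _ Q.neat_r).2 (neat_pd h P Q)⟩
end

end PolySpan

namespace Poly
variable {h : IsCalibration neat}
open PolySpan

instance : CategoryStruct (Poly h) where
  Hom X Y := PolySpan neat X.obj Y.obj
  id X := one h X.obj
  comp P Q := PolySpan.comp h P Q

instance (X Y : Poly h) : Category (X ⟶ Y) :=
  inferInstanceAs (Category (PolySpan neat X.obj Y.obj))

end Poly
end
end CategoryTheory.Bicategory

end

noncomputable section

namespace CategoryTheory.Bicategory
variable {M : Type u} [Bicategory.{w, v} M]
variable {neat : ∀ {X Y : M}, (X ⟶ Y) → Prop}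
namespace PolySpan
section elements
variable {X Y Z : M} (P : PolySpan neat X Y) {Q R : PolySpan neat X Y} {K : M}

/-- The effect of a polynomial on 1-cells: right lifting through the left leg, followed by
composition with the right leg. -/
def ext (x : K ⟶ X) : K ⟶ Y := P.lifter.rif x ≫ P.r

/-- The definitional unfolding of `P.ext x`. -/
def extIso (x : K ⟶ X) : P.lifter.rif x ≫ P.r ≅ P.ext x := Iso.refl _

variable {x x' : K ⟶ X} {y y' : K ⟶ Y}

/-- A 2-cell into `P.ext x` from a factorization up to 2-cells. -/
def el (s : K ⟶ P.apex) (i : y ⟶ s ≫ P.r) (m : s ≫ P.l ⟶ x) : y ⟶ P.ext x :=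
  i ≫ P.lifter.desc m ▷ P.r ≫ (P.extIso x).hom

lemma el_extIso_inv (s : K ⟶ P.apex) (i : y ⟶ s ≫ P.r) (m : s ≫ P.l ⟶ x) :
    P.el s i m ≫ (P.extIso x).inv = i ≫ P.lifter.desc m ▷ P.r := by simp [el]

@[simp] lemma comp_el (g : y' ⟶ y) (s : K ⟶ P.apex) (i : y ⟶ s ≫ P.r) (m : s ≫ P.l ⟶ x) :
    g ≫ P.el s i m = P.el s (g ≫ i) m := by simp [el]

variable {P} in
lemma el_eq {s s' : K ⟶ P.apex} {i : y ⟶ s ≫ P.r} {m : s ≫ P.l ⟶ x} {i' : y ⟶ s' ≫ P.r}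
    {m' : s' ≫ P.l ⟶ x} (σ : s ⟶ s') (hi : i ≫ σ ▷ P.r = i') (hm : σ ▷ P.l ≫ m' = m) :
    P.el s i m = P.el s' i' m' := by
  subst hi hm
  simp [el, ← IsRightLifter.comp_desc]

lemma el_univ (x : K ⟶ X) : P.el (P.lifter.rif x) (P.extIso x).inv (P.lifter.ev x) = 𝟙 (P.ext x) := by
  simp [el, IsRightLifter.desc_ev']

variable {P} in
lemma hom_ext' {f g : P.ext x ⟶ y} (h : ∀ {y' : K ⟶ Y} (s : K ⟶ P.apex) (i : y' ⟶ s ≫ P.r)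
    (m : s ≫ P.l ⟶ x), P.el s i m ≫ f = P.el s i m ≫ g) : f = g := by
  have := h (P.lifter.rif x) (P.extIso x).inv (P.lifter.ev x)
  simpa [el_univ] using this

variable {P} in
lemma exists_of_el_eq (hp : GF P.r) {s s' : K ⟶ P.apex} {i : y ⟶ s ≫ P.r} [IsIso i]
    {m : s ≫ P.l ⟶ x} {i' : y ⟶ s' ≫ P.r}
    {m' : s' ≫ P.l ⟶ x} (h : P.el s i m = P.el s' i' m') :
    ∃ σ : s ⟶ s', i ≫ σ ▷ P.r = i' ∧ σ ▷ P.l ≫ m' = m := by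
  obtain ⟨σ, h1, h2⟩ := hp.fill (P.lifter.desc m') (P.lifter.desc m) (inv i ≫ i')
    (by
      rw [Category.assoc, IsIso.inv_comp_eq, ← cancel_mono (P.extIso x).hom]
      simpa [el] using h.symm)
  refine ⟨σ, by simp [h2], ?_⟩
  rw [← IsRightLifter.desc_ev P.lifter m, ← h1]
  simp

lemma exists_el (hp : GF P.r) (g : y ⟶ P.ext x) :
    ∃ (s : K ⟶ P.apex) (i : y ≅ s ≫ P.r) (m : s ≫ P.l ⟶ x), P.el s i.hom m = g := by
  obtain ⟨s, χ, i, h⟩ := hp.lift _ (g ≫ (P.extIso x).inv)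
  refine ⟨s, i, χ ▷ P.l ≫ P.lifter.ev x, ?_⟩
  rw [← cancel_mono (P.extIso x).inv, ← h, el, ← IsRightLifter.comp_desc,
    IsRightLifter.desc_ev', Category.comp_id]
  simp

/-- The effect of a polynomial on 2-cells. -/
def extMap (f : x ⟶ x') : P.ext x ⟶ P.ext x' :=
  P.el (P.lifter.rif x) (P.extIso x).inv (P.lifter.ev x ≫ f)

@[simp] lemma el_extMap (s : K ⟶ P.apex) (i : y ⟶ s ≫ P.r) (m : s ≫ P.l ⟶ x) (f : x ⟶ x') :
    P.el s i m ≫ P.extMap f = P.el s i (m ≫ f) := by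
  rw [extMap, comp_el]
  exact (el_eq (P.lifter.desc m) (by simp [el]) (by simp)).symm

/-- A polynomial induces functors between hom-categories. -/
@[simps] def extFunctor (K : M) : (K ⟶ X) ⥤ (K ⟶ Y) where
  obj x := P.ext x
  map f := P.extMap f
  map_id x := hom_ext' fun s i m => by simp
  map_comp f g := hom_ext' fun s i m => by simp [← Category.assoc]

variable {P}

/-- The effect of a polynomial morphism. -/
def Mor.ext (f : Mor P Q) (x : K ⟶ X) : P.ext x ⟶ Q.ext x :=
  Q.el (P.lifter.rif x ≫ f.h) ((P.extIso x).inv ≫ P.lifter.rif x ◁ f.rho.hom ≫ (α_ _ _ _).inv)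
    ((α_ _ _ _).hom ≫ P.lifter.rif x ◁ f.lam ≫ P.lifter.ev x)

@[simp] lemma Mor.el_ext (f : Mor P Q) (s : K ⟶ P.apex) (i : y ⟶ s ≫ P.r) (m : s ≫ P.l ⟶ x) :
    P.el s i m ≫ f.ext x = Q.el (s ≫ f.h) (i ≫ s ◁ f.rho.hom ≫ (α_ _ _ _).inv)
      ((α_ _ _ _).hom ≫ s ◁ f.lam ≫ m) := by
  rw [Mor.ext, comp_el]
  refine (el_eq (P.lifter.desc m ▷ f.h) ?_ ?_).symm
  · simp [el, ← whisker_exchange_assoc]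
  · rw [associator_naturality_left_assoc, ← whisker_exchange_assoc]; simp

lemma Mor.Rel.ext {f g : Mor P Q} (h : f.Rel g) (x : K ⟶ X) : f.ext x = g.ext x := by
  obtain ⟨σ, h1, h2⟩ := h
  refine hom_ext' fun s i m => ?_
  rw [Mor.el_ext, Mor.el_ext]
  refine el_eq (s ◁ σ) ?_ ?_
  · simp [← h2]
  · simp [← h1]

/-- The effect of a class of polynomial morphisms. -/
def cext (f : P ⟶ Q) (x : K ⟶ X) : P.ext x ⟶ Q.ext x :=
  Quot.lift (fun f : Mor P Q => f.ext x) (fun _ _ h => h.ext x) f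

@[simp] lemma Mor.cext_cls (f : Mor P Q) (x : K ⟶ X) : cext f.cls x = f.ext x := rfl

@[simp] lemma cext_id (x : K ⟶ X) : cext (𝟙 P) x = 𝟙 _ := by
  refine hom_ext' fun s i m => ?_
  rw [Mor.id_cls, Mor.cext_cls, Mor.el_ext, Category.comp_id]
  exact (el_eq (ρ_ s).inv (by simp [Mor.id]) (by simp [Mor.id])).symm

@[simp] lemma cext_comp (f : P ⟶ Q) (g : Q ⟶ R) (x : K ⟶ X) :
    cext (f ≫ g) x = cext f x ≫ cext g x := by
  induction f using ind with | h f => ?_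
  induction g using ind with | h g => ?_
  rw [Mor.cls_comp]
  refine hom_ext' fun s i m => ?_
  simp only [Mor.cext_cls, ← Category.assoc, Mor.el_ext]
  exact (el_eq (α_ s f.h g.h).hom (by simp [Mor.comp]) (by simp [Mor.comp])).symm

lemma cext_naturality (f : P ⟶ Q) (g : x ⟶ x') :
    P.extMap g ≫ cext f x' = cext f x ≫ Q.extMap g := by
  induction f using ind with | h f => ?_
  refine hom_ext' fun s i m => ?_
  simp [← Category.assoc]

variable (P) in
/-- The generic element. -/
def gen : P.r ⟶ P.ext P.l := P.el (𝟙 _) (λ_ _).inv (λ_ _).hom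

lemma gen_ext (f : Mor P Q) : P.gen ≫ f.ext P.l = Q.el f.h f.rho.hom f.lam := by
  rw [gen, Mor.el_ext]
  exact el_eq (λ_ _).hom (by simp) (by simp)

lemma cext_injective (hq : GF Q.r) {f g : P ⟶ Q} (h : cext f P.l = cext g P.l) : f = g := by
  induction f using ind with | h f => ?_
  induction g using ind with | h g => ?_
  have := congrArg (P.gen ≫ ·) h
  simp only [Mor.cext_cls, gen_ext] at this
  obtain ⟨σ, h1, h2⟩ := exists_of_el_eq hq this
  exact Quot.sound ⟨σ, h2, h1⟩

variable (P) in
/-- Reindexing along a 1-cell. -/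
def reindex {L : M} (k : L ⟶ K) (x : K ⟶ X) : k ≫ P.ext x ⟶ P.ext (k ≫ x) :=
  P.el (k ≫ P.lifter.rif x) (k ◁ (P.extIso x).inv ≫ (α_ _ _ _).inv) ((α_ _ _ _).hom ≫ k ◁ P.lifter.ev x)

@[simp] lemma whiskerLeft_el_reindex {L : M} (k : L ⟶ K) (s : K ⟶ P.apex) (i : y ⟶ s ≫ P.r)
    (m : s ≫ P.l ⟶ x) : k ◁ P.el s i m ≫ P.reindex k x =
      P.el (k ≫ s) (k ◁ i ≫ (α_ _ _ _).inv) ((α_ _ _ _).hom ≫ k ◁ m) := by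
  rw [reindex, comp_el]
  exact (el_eq (k ◁ P.lifter.desc m) (by simp [el]) (by simp [← whiskerLeft_comp])).symm

lemma reindex_ext {L : M} {k : L ⟶ K} {z : L ⟶ Y} {f g : k ≫ P.ext x ⟶ z}
    (h : ∀ {y' : K ⟶ Y} (s : K ⟶ P.apex) (i : y' ⟶ s ≫ P.r)
    (m : s ≫ P.l ⟶ x), k ◁ P.el s i m ≫ f = k ◁ P.el s i m ≫ g) : f = g := by
  have := h (P.lifter.rif x) (P.extIso x).inv (P.lifter.ev x)
  simpa [el_univ] using this

lemma reindex_naturality {L : M} (k : L ⟶ K) (g : x ⟶ x') :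
    k ◁ P.extMap g ≫ P.reindex k x' = P.reindex k x ≫ P.extMap (k ◁ g) := by
  refine reindex_ext fun s i m => ?_
  rw [← whiskerLeft_comp_assoc, ← Category.assoc]
  simp

/-- Every family of 2-cells natural in all variables comes from a polynomial morphism. -/
lemma exists_cext_eq (hq : GF Q.r) (n : ∀ {K : M} (x : K ⟶ X), P.ext x ⟶ Q.ext x)
    (nat : ∀ {K : M} {x x' : K ⟶ X} (g : x ⟶ x'), P.extMap g ≫ n x' = n x ≫ Q.extMap g)
    (re : ∀ {K L : M} (k : L ⟶ K) (x : K ⟶ X),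
      k ◁ n x ≫ Q.reindex k x = P.reindex k x ≫ n (k ≫ x)) :
    ∃ f : P ⟶ Q, ∀ {K : M} (x : K ⟶ X), cext f x = n x := by
  obtain ⟨h, rho, lam, e⟩ := Q.exists_el hq (P.gen ≫ n P.l)
  refine ⟨Mor.cls ⟨h, lam, rho⟩, fun {K} x => hom_ext' fun s i m => ?_⟩
  have e1 : P.el s i m = (i ≫ s ◁ P.gen) ≫ P.reindex s P.l ≫ P.extMap m := by
    rw [gen, Category.assoc, ← Category.assoc (s ◁ _), whiskerLeft_el_reindex, el_extMap, comp_el]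
    exact el_eq (ρ_ _).inv (by simp) (by simp)
  have e2 : P.reindex s P.l ≫ P.extMap m ≫ n x =
      s ◁ n P.l ≫ Q.reindex s P.l ≫ Q.extMap m := by
    rw [nat, ← Category.assoc, ← re, Category.assoc]
  rw [Mor.cext_cls, Mor.el_ext, e1]
  simp only [Category.assoc, e2]
  rw [← whiskerLeft_comp_assoc, ← e, ← Category.assoc (_ ◁ _), whiskerLeft_el_reindex]
  simp
end elements
end PolySpan
end CategoryTheory.Bicategory

end

noncomputable section

namespace CategoryTheory.Bicategory
variable {M : Type u} [Bicategory.{w, v} M]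
variable {neat : ∀ {X Y : M}, (X ⟶ Y) → Prop}
namespace PolySpan
section composites
variable {X Y Z : M} (h : IsCalibration neat) (P P' : PolySpan neat X Y) (Q Q' : PolySpan neat Y Z)
  {K : M}  {x x' : K ⟶ X} {y y' : K ⟶ Z}

/-- Elements of a composite. -/
def elc (s : K ⟶ vtx h P Q) (i : y ⟶ s ≫ pd h P Q ≫ Q.r) (m : s ≫ pc h P Q ≫ P.l ⟶ x) :
    y ⟶ (comp h P Q).ext x := (comp h P Q).el s i m

@[simp] lemma comp_elc (g : y' ⟶ y) (s : K ⟶ vtx h P Q) (i : y ⟶ s ≫ pd h P Q ≫ Q.r)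
    (m : s ≫ pc h P Q ≫ P.l ⟶ x) : g ≫ elc h P Q s i m = elc h P Q s (g ≫ i) m := comp_el _ _ _ _ _

variable {h P Q} in
lemma elc_eq {s s' : K ⟶ vtx h P Q} {i : y ⟶ s ≫ pd h P Q ≫ Q.r} {m : s ≫ pc h P Q ≫ P.l ⟶ x}
    {i' : y ⟶ s' ≫ pd h P Q ≫ Q.r} {m' : s' ≫ pc h P Q ≫ P.l ⟶ x} (σ : s ⟶ s')
    (hi : i ≫ σ ▷ (pd h P Q ≫ Q.r) = i') (hm : σ ▷ (pc h P Q ≫ P.l) ≫ m' = m) :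
    elc h P Q s i m = elc h P Q s' i' m' := el_eq (P := comp h P Q) σ hi hm

lemma exists_elc (g : y ⟶ (comp h P Q).ext x) :
    ∃ (s : K ⟶ vtx h P Q) (i : y ≅ s ≫ pd h P Q ≫ Q.r) (m : s ≫ pc h P Q ≫ P.l ⟶ x),
      elc h P Q s i.hom m = g := exists_el _ (gf h _) g

@[simp] lemma elc_extMap (s : K ⟶ vtx h P Q) (i : y ⟶ s ≫ pd h P Q ≫ Q.r)
    (m : s ≫ pc h P Q ≫ P.l ⟶ x) (f : x ⟶ x') :
    elc h P Q s i m ≫ (comp h P Q).extMap f = elc h P Q s i (m ≫ f) := el_extMap _ _ _ _ _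

@[simp] lemma whiskerLeft_elc_reindex {L : M} (k : L ⟶ K) (s : K ⟶ vtx h P Q)
    (i : y ⟶ s ≫ pd h P Q ≫ Q.r) (m : s ≫ pc h P Q ≫ P.l ⟶ x) :
    k ◁ elc h P Q s i m ≫ (comp h P Q).reindex k x =
      elc h P Q (k ≫ s) (k ◁ i ≫ (α_ _ _ _).inv) ((α_ _ _ _).hom ≫ k ◁ m) :=
  whiskerLeft_el_reindex _ _ _ _

variable {h P Q} in
lemma hom_extc {f g : (comp h P Q).ext x ⟶ y} (H : ∀ {y' : K ⟶ Z} (s : K ⟶ vtx h P Q)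
    (i : y' ⟶ s ≫ pd h P Q ≫ Q.r) (m : s ≫ pc h P Q ≫ P.l ⟶ x),
    elc h P Q s i m ≫ f = elc h P Q s i m ≫ g) : f = g := hom_ext' H

variable {h P Q} in
lemma reindex_extc {L : M} {k : L ⟶ K} {z : L ⟶ Z} {f g : k ≫ (comp h P Q).ext x ⟶ z}
    (H : ∀ {y' : K ⟶ Z} (s : K ⟶ vtx h P Q) (i : y' ⟶ s ≫ pd h P Q ≫ Q.r)
    (m : s ≫ pc h P Q ≫ P.l ⟶ x), k ◁ elc h P Q s i m ≫ f = k ◁ elc h P Q s i m ≫ g) : f = g :=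
  reindex_ext H

/-- An element of an element, from an element of the composite. -/
def el₂ (s : K ⟶ vtx h P Q) (i : y ⟶ s ≫ pd h P Q ≫ Q.r) (m : s ≫ pc h P Q ≫ P.l ⟶ x) :
    y ⟶ Q.ext (P.ext x) :=
  Q.el (s ≫ pd h P Q) (i ≫ (α_ _ _ _).inv)
    (P.el (s ≫ pc h P Q) ((α_ _ _ _).hom ≫ s ◁ (θ h P Q).hom ≫ (α_ _ _ _).inv) ((α_ _ _ _).hom ≫ m))

lemma comp_el₂ (g : y' ⟶ y) (s : K ⟶ vtx h P Q) (i : y ⟶ s ≫ pd h P Q ≫ Q.r)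
    (m : s ≫ pc h P Q ≫ P.l ⟶ x) : g ≫ el₂ h P Q s i m = el₂ h P Q s (g ≫ i) m := by simp [el₂]

variable {h P Q} in
lemma el₂_eq {s t : K ⟶ vtx h P Q} {i : y ⟶ s ≫ pd h P Q ≫ Q.r} {m : t ≫ pc h P Q ≫ P.l ⟶ x}
    (σ : s ⟶ t) :
    el₂ h P Q s i (σ ▷ (pc h P Q ≫ P.l) ≫ m) = el₂ h P Q t (i ≫ σ ▷ (pd h P Q ≫ Q.r)) m := by
  refine el_eq (σ ▷ pd h P Q) (by simp) ?_
  rw [comp_el]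
  refine (el_eq (σ ▷ pc h P Q) ?_ (by simp)).symm
  rw [square_nat (θ h P Q).hom σ]
  simp

def rifc (x : K ⟶ X) : K ⟶ vtx h P Q := (comp h P Q).lifter.rif x
def evc (x : K ⟶ X) : rifc h P Q x ≫ pc h P Q ≫ P.l ⟶ x := (comp h P Q).lifter.ev x
def isoc (x : K ⟶ X) : rifc h P Q x ≫ pd h P Q ≫ Q.r ≅ (comp h P Q).ext x :=
  (comp h P Q).extIso x
lemma exists_descc (s : K ⟶ vtx h P Q) (m : s ≫ pc h P Q ≫ P.l ⟶ x) :
    ∃ t : s ⟶ rifc h P Q x, t ▷ (pc h P Q ≫ P.l) ≫ evc h P Q x = m ∧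
      ∀ {y : K ⟶ Z} (i : y ⟶ s ≫ pd h P Q ≫ Q.r),
        elc h P Q s i m ≫ (isoc h P Q x).inv = i ≫ t ▷ (pd h P Q ≫ Q.r) :=
  ⟨(comp h P Q).lifter.desc m, IsRightLifter.desc_ev _ _,
    fun _ => el_extIso_inv _ _ _ _⟩

/-- The comparison between the effect of a composite and the composite of effects. -/
def φ (x : K ⟶ X) : (comp h P Q).ext x ⟶ Q.ext (P.ext x) :=
  el₂ h P Q (rifc h P Q x) (isoc h P Q x).inv (evc h P Q x)

@[simp] lemma elc_φ (s : K ⟶ vtx h P Q) (i : y ⟶ s ≫ pd h P Q ≫ Q.r)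
    (m : s ≫ pc h P Q ≫ P.l ⟶ x) : elc h P Q s i m ≫ φ h P Q x = el₂ h P Q s i m := by
  obtain ⟨t, rfl, hi⟩ := exists_descc h P Q s m
  rw [φ, comp_el₂, hi, el₂_eq]

lemma mono_φ (x : K ⟶ X) : Mono (φ h P Q x) := by
  constructor
  intro y g g' e
  obtain ⟨s, i, m, rfl⟩ := exists_elc h P Q g
  obtain ⟨s', i', m', rfl⟩ := exists_elc h P Q g'
  rw [elc_φ, elc_φ] at e
  obtain ⟨τ, h1, h2⟩ := exists_of_el_eq (gf h Q) e
  rw [comp_el] at h2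
  obtain ⟨σ, h3, h4⟩ := exists_of_el_eq (gf h P) h2.symm
  obtain ⟨ω, rfl, rfl⟩ := (isBipullback h P Q).exists_hom τ σ (by simpa using h3)
  refine elc_eq ω ?_ ?_
  · rw [← cancel_mono (α_ _ _ _).inv, ← h1]
    simp
  · rw [← cancel_epi (α_ _ _ _).hom, ← h4]
    simp

lemma exists_section_φ (x : K ⟶ X) : ∃ g, g ≫ φ h P Q x = 𝟙 _ := by
  obtain ⟨z, τ, σ, e, -⟩ := (isBipullback h P Q).exists_lax_lift (gf h P)
    (Q.lifter.rif (P.ext x)) (P.lifter.rif x) (Q.lifter.ev _ ≫ (P.extIso x).inv)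
  refine ⟨elc h P Q z ((Q.extIso _).inv ≫ τ.hom ▷ _ ≫ (α_ _ _ _).hom)
    ((α_ _ _ _).inv ≫ σ ▷ P.l ≫ P.lifter.ev x), ?_⟩
  rw [elc_φ, el₂, ← el_univ]
  refine (el_eq τ.hom (by simp) ?_).symm
  rw [comp_el]
  have e1 : Q.lifter.ev (P.ext x) = P.el (P.lifter.rif x) (Q.lifter.ev _ ≫ (P.extIso x).inv)
      (P.lifter.ev x) := by rw [← comp_el, el_univ, Category.comp_id]
  rw [e1, ← e]
  exact el_eq σ (by simp) (by simp)

instance isIso_φ (x : K ⟶ X) : IsIso (φ h P Q x) := by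
  have := mono_φ h P Q x
  obtain ⟨g, hg⟩ := exists_section_φ h P Q x
  exact ⟨g, by rw [← cancel_mono (φ h P Q x)]; simp [hg], hg⟩

lemma φ_naturality (f : x ⟶ x') :
    (comp h P Q).extMap f ≫ φ h P Q x' = φ h P Q x ≫ Q.extMap (P.extMap f) := by
  refine hom_extc fun s i m => ?_
  rw [← Category.assoc, ← Category.assoc]
  simp [el₂]

lemma φ_reindex {L : M} (k : L ⟶ K) (x : K ⟶ X) :
    k ◁ φ h P Q x ≫ Q.reindex k _ ≫ Q.extMap (P.reindex k x) =
      (comp h P Q).reindex k x ≫ φ h P Q (k ≫ x) := by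
  refine reindex_extc fun s i m => ?_
  rw [← whiskerLeft_comp_assoc, ← Category.assoc, ← Category.assoc]
  rw [elc_φ, el₂, whiskerLeft_el_reindex, el_extMap, whiskerLeft_elc_reindex, elc_φ, el₂]
  refine el_eq (α_ _ _ _).inv (by simp) ?_
  rw [Category.assoc, whiskerLeft_el_reindex, comp_el, comp_el]
  exact (el_eq (α_ _ _ _).inv (by simp) (by simp)).symm

/-- Elements of the identity polynomial. -/
def el₁ {x y : K ⟶ X} (s : K ⟶ X) (i : y ⟶ s ≫ 𝟙 X) (m : s ≫ 𝟙 X ⟶ x) : y ⟶ (one h X).ext x :=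
  (one h X).el s i m

lemma el₁_eq {x y s : K ⟶ X} (i : y ⟶ s ≫ 𝟙 X) (m : s ≫ 𝟙 X ⟶ x) :
    el₁ h s i m = (i ≫ m) ≫ el₁ h x (ρ_ x).inv (ρ_ x).hom :=
  (el_eq (P := one h X) (s' := x) ((ρ_ s).inv ≫ m) (by
    change i ≫ ((ρ_ s).inv ≫ m) ▷ 𝟙 X = (i ≫ m) ≫ (ρ_ x).inv
    simp) (by
    change ((ρ_ s).inv ≫ m) ▷ 𝟙 X ≫ (ρ_ x).hom = m
    simp)).trans (comp_el _ _ _ _ _).symm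

/-- The effect of the identity polynomial. -/
def υ (x : K ⟶ X) : (one h X).ext x ⟶ x :=
  ((one h X).extIso x).inv ≫ (one h X).lifter.ev x

lemma el₁_υ {x y : K ⟶ X} (s : K ⟶ X) (i : y ⟶ s ≫ 𝟙 X) (m : s ≫ 𝟙 X ⟶ x) :
    el₁ h s i m ≫ υ h x = i ≫ m := by
  have := IsRightLifter.desc_ev (one h X).lifter m
  have e : ((one h X).el s i m ≫ ((one h X).extIso x).inv) = i ≫ (one h X).lifter.desc m ▷ 𝟙 X :=
    el_extIso_inv _ _ _ _
  have e' : el₁ h s i m ≫ υ h x = ((one h X).el s i m ≫ ((one h X).extIso x).inv) ≫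
    (one h X).lifter.ev x := (Category.assoc _ _ _).symm
  rw [e', e]
  exact (Category.assoc _ _ _).trans (congrArg (i ≫ ·) this)

lemma hom_ext₁ {x y : K ⟶ X} {f g : (one h X).ext x ⟶ y}
    (H : ∀ {y' : K ⟶ X} (s : K ⟶ X) (i : y' ⟶ s ≫ 𝟙 X) (m : s ≫ 𝟙 X ⟶ x),
    el₁ h s i m ≫ f = el₁ h s i m ≫ g) : f = g := hom_ext' H

lemma reindex_ext₁ {L : M} {k : L ⟶ K} {x : K ⟶ X} {z : L ⟶ X} {f g : k ≫ (one h X).ext x ⟶ z}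
    (H : ∀ {y' : K ⟶ X} (s : K ⟶ X) (i : y' ⟶ s ≫ 𝟙 X)
    (m : s ≫ 𝟙 X ⟶ x), k ◁ el₁ h s i m ≫ f = k ◁ el₁ h s i m ≫ g) : f = g :=
  reindex_ext H

instance isIso_υ (x : K ⟶ X) : IsIso (υ h x) := by
  refine ⟨el₁ h x (ρ_ x).inv (ρ_ x).hom, ?_, ?_⟩
  · refine hom_ext₁ h fun s i m => ?_
    rw [← Category.assoc, el₁_υ, ← el₁_eq, Category.comp_id]
  · rw [el₁_υ]
    simp

lemma υ_naturality (f : x ⟶ x') : (one h X).extMap f ≫ υ h x' = υ h x ≫ f := by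
  refine hom_ext₁ h fun s i m => ?_
  have : el₁ h s i m ≫ (one h X).extMap f = el₁ h s i (m ≫ f) := el_extMap _ _ _ _ _
  rw [← Category.assoc, ← Category.assoc, this, el₁_υ, el₁_υ, Category.assoc]

lemma υ_reindex {L : M} (k : L ⟶ K) (x : K ⟶ X) :
    k ◁ υ h x = (one h X).reindex k x ≫ υ h (k ≫ x) := by
  have (y) (s : K ⟶ X) (i : y ⟶ s ≫ 𝟙 X) (m : s ≫ 𝟙 X ⟶ x) :
    k ◁ el₁ h s i m ≫ (one h X).reindex k x =
      el₁ h (k ≫ s) (k ◁ i ≫ (α_ _ _ _).inv) ((α_ _ _ _).hom ≫ k ◁ m) :=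
    whiskerLeft_el_reindex _ _ _ _
  refine reindex_ext₁ h fun s i m => ?_
  rw [← whiskerLeft_comp, ← Category.assoc, this, el₁_υ, el₁_υ]
  simp only [Category.assoc, Iso.inv_hom_id_assoc]
  exact whiskerLeft_comp _ _ _
end composites
end PolySpan
end CategoryTheory.Bicategory

end

noncomputable section

namespace CategoryTheory.Bicategory
variable {M : Type u} [Bicategory.{w, v} M]
variable {neat : ∀ {X Y : M}, (X ⟶ Y) → Prop}
namespace PolySpan
section cells
variable {W X Y Z K : M} (h : IsCalibration neat) {P P' : PolySpan neat X Y} {Q Q' : PolySpan neat Y Z}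

/-- The 2-cell from which the horizontal composite of polynomial morphisms is constructed. -/
def Mor.psi (f : Mor P P') (g : Mor Q Q') :
    (pd h P Q ≫ g.h) ≫ Q'.l ⟶ (pc h P Q ≫ f.h) ≫ P'.r :=
  (α_ _ _ _).hom ≫ pd h P Q ◁ g.lam ≫ (θ h P Q).hom ≫ pc h P Q ◁ f.rho.hom ≫ (α_ _ _ _).inv

lemma exists_hcomp (f : Mor P P') (g : Mor Q Q') :
    ∃ (x : vtx h P Q ⟶ vtx h P' Q') (τ : pd h P Q ≫ g.h ≅ x ≫ pd h P' Q')
      (σ : x ≫ pc h P' Q' ⟶ pc h P Q ≫ f.h),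
      τ.hom ▷ Q'.l ≫ (α_ _ _ _).hom ≫ x ◁ (θ h P' Q').hom ≫ (α_ _ _ _).inv ≫ σ ▷ P'.r =
        Mor.psi h f g ∧ (IsIso (Mor.psi h f g) → IsIso σ) :=
  (isBipullback h P' Q').exists_lax_lift (gf h P') _ _ (Mor.psi h f g)

/-- The polynomial morphism obtained by pasting the components of a map of bipullbacks. -/
@[simps] def Mor.paste (f : Mor P P') (g : Mor Q Q') (x : vtx h P Q ⟶ vtx h P' Q')
    (τ : pd h P Q ≫ g.h ≅ x ≫ pd h P' Q') (σ : x ≫ pc h P' Q' ⟶ pc h P Q ≫ f.h) :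
    Mor (PolySpan.comp h P Q) (PolySpan.comp h P' Q') where
  h := x
  lam := (α_ x (pc h P' Q') P'.l).inv ≫ σ ▷ P'.l ≫ (α_ _ f.h P'.l).hom ≫ pc h P Q ◁ f.lam
  rho := whiskerLeftIso (pd h P Q) g.rho ≪≫ (α_ _ g.h Q'.r).symm ≪≫ whiskerRightIso τ Q'.r ≪≫
    α_ x (pd h P' Q') Q'.r

/-- The horizontal composite of polynomial morphisms. -/
def Mor.hcomp (f : Mor P P') (g : Mor Q Q') : Mor (PolySpan.comp h P Q) (PolySpan.comp h P' Q') :=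
  Mor.paste h f g (exists_hcomp h f g).choose (exists_hcomp h f g).choose_spec.choose
    (exists_hcomp h f g).choose_spec.choose_spec.choose

lemma Mor.hcomp_eq (f : Mor P P') (g : Mor Q Q') :
    ∃ (x : vtx h P Q ⟶ vtx h P' Q') (τ : pd h P Q ≫ g.h ≅ x ≫ pd h P' Q')
      (σ : x ≫ pc h P' Q' ⟶ pc h P Q ≫ f.h), Mor.hcomp h f g = Mor.paste h f g x τ σ ∧
      τ.hom ▷ Q'.l ≫ (α_ _ _ _).hom ≫ x ◁ (θ h P' Q').hom ≫ (α_ _ _ _).inv ≫ σ ▷ P'.r =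
        Mor.psi h f g ∧ (IsIso (Mor.psi h f g) → IsIso σ) :=
  ⟨_, _, _, rfl, (exists_hcomp h f g).choose_spec.choose_spec.choose_spec⟩

lemma Mor.hcomp_spec (f : Mor P P') (g : Mor Q Q') {K : M} (x : K ⟶ X) :
    (Mor.hcomp h f g).ext x ≫ φ h P' Q' x = φ h P Q x ≫ g.ext _ ≫ Q'.extMap (f.ext x) := by
  obtain ⟨ℓ, τ, σ, H, e, -⟩ := Mor.hcomp_eq h f g
  refine hom_extc fun s i m => ?_
  have e1 : elc h P Q s i m ≫ (Mor.hcomp h f g).ext x = elc h P' Q' (s ≫ ℓ)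
      (i ≫ s ◁ (pd h P Q ◁ g.rho.hom ≫ (α_ _ g.h Q'.r).inv ≫ τ.hom ▷ Q'.r ≫ (α_ ℓ _ _).hom) ≫
        (α_ _ _ _).inv)
      ((α_ _ _ _).hom ≫ s ◁ ((α_ ℓ _ _).inv ≫ σ ▷ P'.l ≫ (α_ _ f.h P'.l).hom ≫
        pc h P Q ◁ f.lam) ≫ m) := by
    rw [H]
    exact Mor.el_ext (Mor.paste h f g ℓ τ σ) (s : K ⟶ (PolySpan.comp h P Q).apex) i m
  rw [← Category.assoc, e1, elc_φ, ← Category.assoc (elc _ _ _ _ _ _), elc_φ, el₂, el₂,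
    ← Category.assoc (Q.el _ _ _), Mor.el_ext, el_extMap]
  symm
  refine el_eq ((α_ _ _ _).hom ≫ s ◁ τ.hom ≫ (α_ _ _ _).inv) (by simp) ?_
  simp only [comp_el, Category.assoc, Mor.el_ext]
  refine el_eq ((α_ _ _ _).hom ≫ s ◁ σ ≫ (α_ _ _ _).inv) ?_ (by simp)
  have e2 := congrArg (fun z => (α_ s _ Q'.l).hom ≫ s ◁ z ≫
    (α_ s _ P'.r).inv ≫ (α_ s (pc h P Q) f.h).inv ▷ P'.r) e
  simp [psi] at e2
  simp [e2]

lemma Mor.hcomp_cls {f f' : Mor P P'} {g g' : Mor Q Q'} (hf : f.cls = f'.cls)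
    (hg : g.cls = g'.cls) : (Mor.hcomp h f g).cls = (Mor.hcomp h f' g').cls := by
  refine cext_injective (gf h _) ?_
  rw [← cancel_mono (φ h P' Q' _), Mor.cext_cls, Mor.cext_cls, hcomp_spec, hcomp_spec,
    ← Mor.cext_cls f, ← Mor.cext_cls g, hf, hg]
  rfl

/-- Horizontal composition on classes. -/
def hcomp (f : P ⟶ P') (g : Q ⟶ Q') : PolySpan.comp h P Q ⟶ PolySpan.comp h P' Q' :=
  Quot.lift (fun f : Mor P P' => Quot.lift (fun g : Mor Q Q' => (Mor.hcomp h f g).cls)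
    (fun _ _ H => Mor.hcomp_cls h rfl (Quot.sound H)) g)
    (fun _ _ H => by
      induction g using ind with | h g => exact Mor.hcomp_cls h (Quot.sound H) rfl) f

lemma hcomp_spec (f : P ⟶ P') (g : Q ⟶ Q') {K : M} (x : K ⟶ X) :
    cext (hcomp h f g) x ≫ φ h P' Q' x = φ h P Q x ≫ cext g _ ≫ Q'.extMap (cext f x) := by
  induction f using ind with | h f => ?_
  induction g using ind with | h g => ?_
  exact Mor.hcomp_spec h f g x

/-- Invertible families of 2-cells, natural in all variables, come from isomorphisms. -/
lemma exists_iso (h : IsCalibration neat) {P Q : PolySpan neat X Y}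
    (n : ∀ (K : M) (x : K ⟶ X), P.ext x ⟶ Q.ext x) [∀ (K : M) (x : K ⟶ X), IsIso (n K x)]
    (nat : ∀ (K : M) {x x' : K ⟶ X} (g : x ⟶ x'), P.extMap g ≫ n K x' = n K x ≫ Q.extMap g)
    (re : ∀ (K L : M) (k : L ⟶ K) (x : K ⟶ X),
      k ◁ n K x ≫ Q.reindex k x = P.reindex k x ≫ n L (k ≫ x)) :
    ∃ f : P ≅ Q, ∀ (K : M) (x : K ⟶ X), cext f.hom x = n K x := by
  obtain ⟨f, hf⟩ := exists_cext_eq (gf h Q) (n _) (nat _) (re _ _)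
  obtain ⟨g, hg⟩ := exists_cext_eq (P := Q) (gf h P) (fun x => inv (n _ x))
    (fun g => by rw [IsIso.eq_inv_comp, ← Category.assoc, ← nat, Category.assoc, IsIso.hom_inv_id,
      Category.comp_id])
    (fun k x => by rw [IsIso.eq_comp_inv, Category.assoc, ← re, ← whiskerLeft_comp_assoc]; simp)
  exact ⟨⟨f, g, cext_injective (gf h P) (by simp [hf, hg]),
    cext_injective (gf h Q) (by simp [hf, hg])⟩, fun _ => hf⟩

instance {x x' : K ⟶ X} (f : x ⟶ x') [IsIso f] : IsIso (P.extMap f) :=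
  inferInstanceAs (IsIso ((P.extFunctor K).map f))

lemma extMap_comp {x x' x'' : K ⟶ X} (f : x ⟶ x') (g : x' ⟶ x'') :
    P.extMap (f ≫ g) = P.extMap f ≫ P.extMap g := (P.extFunctor K).map_comp f g

lemma φ_naturality_assoc {x x' : K ⟶ X} (f : x ⟶ x') {z} (g : Q.ext (P.ext x') ⟶ z) :
    (comp h P Q).extMap f ≫ φ h P Q x' ≫ g = φ h P Q x ≫ Q.extMap (P.extMap f) ≫ g := by
  rw [← Category.assoc, φ_naturality, Category.assoc]

lemma reindex_naturality_assoc {L : M} (k : L ⟶ K) {x x' : K ⟶ X} (f : x ⟶ x') {z}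
    (g : P.ext (k ≫ x') ⟶ z) :
    k ◁ P.extMap f ≫ P.reindex k x' ≫ g = P.reindex k x ≫ P.extMap (k ◁ f) ≫ g := by
  rw [← Category.assoc, reindex_naturality, Category.assoc]

lemma φ_reindex_assoc {L : M} (k : L ⟶ K) (x : K ⟶ X) {z} (g : Q.ext (P.ext (k ≫ x)) ⟶ z) :
    (comp h P Q).reindex k x ≫ φ h P Q (k ≫ x) ≫ g =
      k ◁ φ h P Q x ≫ Q.reindex k _ ≫ Q.extMap (P.reindex k x) ≫ g := by
  rw [← Category.assoc, ← φ_reindex, Category.assoc, Category.assoc]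

lemma exists_assoc (P : PolySpan neat W X) (Q : PolySpan neat X Y) (R : PolySpan neat Y Z) :
    ∃ f : PolySpan.comp h (PolySpan.comp h P Q) R ≅ PolySpan.comp h P (PolySpan.comp h Q R),
      ∀ (K : M) (x : K ⟶ W), cext f.hom x ≫ φ h _ _ x ≫ φ h _ _ _ =
        φ h _ _ x ≫ R.extMap (φ h _ _ x) := by
  obtain ⟨f, hf⟩ := exists_iso h (P := PolySpan.comp h (PolySpan.comp h P Q) R)
    (Q := PolySpan.comp h P (PolySpan.comp h Q R))
    (fun _ x => φ h _ _ x ≫ R.extMap (φ h _ _ x) ≫ inv (φ h _ _ _) ≫ inv (φ h _ _ _))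
    (fun K x x' g => by
      rw [← cancel_mono (φ h _ _ _), ← cancel_mono (φ h _ _ _)]
      simp only [Category.assoc, IsIso.inv_hom_id, IsIso.inv_hom_id_assoc, Category.comp_id,
        φ_naturality_assoc, φ_naturality, ← extMap_comp])
    (fun K L k x => by
      rw [← cancel_mono (φ h _ _ _), ← cancel_mono (φ h _ _ _)]
      simp only [Category.assoc, IsIso.inv_hom_id, IsIso.inv_hom_id_assoc, Category.comp_id,
        φ_reindex_assoc, φ_naturality, ← extMap_comp, ← φ_reindex]
      rw [← whiskerLeft_comp_assoc, ← whiskerLeft_comp_assoc]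
      simp only [Category.assoc, IsIso.inv_hom_id, IsIso.inv_hom_id_assoc, Category.comp_id]
      simp only [whiskerLeft_comp, Category.assoc, reindex_naturality_assoc, extMap_comp])
  exact ⟨f, fun _ x => by simp [hf]⟩

lemma exists_left (P : PolySpan neat X Y) : ∃ f : PolySpan.comp h (one h X) P ≅ P,
    ∀ (K : M) (x : K ⟶ X), cext f.hom x = φ h _ _ x ≫ P.extMap (υ h x) :=
  exists_iso h (fun _ x => φ h _ _ x ≫ P.extMap (υ h x)) (fun _ _ _ g => by
      rw [← Category.assoc, φ_naturality, Category.assoc, Category.assoc, ← extMap_comp,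
        υ_naturality, extMap_comp])
    (fun K L k x => by
      simp only [whiskerLeft_comp, Category.assoc, φ_reindex_assoc, reindex_naturality, υ_reindex,
        extMap_comp])

lemma exists_right (P : PolySpan neat X Y) : ∃ f : PolySpan.comp h P (one h Y) ≅ P,
    ∀ (K : M) (x : K ⟶ X), cext f.hom x = φ h _ _ x ≫ υ h (P.ext x) :=
  exists_iso h (fun _ x => φ h _ _ x ≫ υ h (P.ext x)) (fun _ _ _ g => by
      rw [← Category.assoc, φ_naturality, Category.assoc, Category.assoc, υ_naturality])
    (fun K L k x => by
      simp only [whiskerLeft_comp, Category.assoc, φ_reindex_assoc, υ_naturality, υ_reindex])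

end cells
end PolySpan
end CategoryTheory.Bicategory

end

noncomputable section

namespace CategoryTheory.Bicategory
variable {M : Type u} [Bicategory.{w, v} M]
variable {neat : ∀ {X Y : M}, (X ⟶ Y) → Prop}
namespace PolySpan
variable (h : IsCalibration neat) {X Y Z K : M}
lemma hcomp_id_left_spec (P : PolySpan neat X Y) {Q Q' : PolySpan neat Y Z} (β : Q ⟶ Q')
    (x : K ⟶ X) : cext (hcomp h (𝟙 P) β) x ≫ φ h P Q' x = φ h P Q x ≫ cext β _ := by
  have : Q'.extMap (𝟙 (P.ext x)) = 𝟙 _ := (Q'.extFunctor K).map_id _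
  rw [hcomp_spec, cext_id, this, Category.comp_id]

lemma hcomp_id_right_spec {P P' : PolySpan neat X Y} (α : P ⟶ P') (Q : PolySpan neat Y Z)
    (x : K ⟶ X) : cext (hcomp h α (𝟙 Q)) x ≫ φ h P' Q x = φ h P Q x ≫ Q.extMap (cext α x) := by
  rw [hcomp_spec, cext_id, Category.id_comp]
end PolySpan

namespace Poly
open PolySpan
variable (h : IsCalibration neat)

/-- Polynomials act on hom-categories. -/
def action : BicatAction (Poly h) where
  κ := M
  A K X := K ⟶ X.obj
  F K _ _ P := P.extFunctor K
  map K {_ _ P Q} f :=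
    { app := fun x => PolySpan.cext (P := P) (Q := Q) f x
      naturality := fun _ _ g => PolySpan.cext_naturality (P := P) (Q := Q) f g }
  map_id K _ _ P := by
    ext x
    exact PolySpan.cext_id (P := P) x
  map_comp K _ _ P Q R f g := by
    ext x
    exact PolySpan.cext_comp (P := P) (Q := Q) (R := R) f g x
  faithful {_ _ P Q} f g H :=
    PolySpan.cext_injective (P := P) (Q := Q) (PolySpan.gf h Q)
      (congrArg (fun t => NatTrans.app t P.l) (H P.apex))
  φ K _ _ _ P Q := NatIso.ofComponents (fun x => @asIso _ _ _ _ (PolySpan.φ h P Q x) (PolySpan.isIso_φ h P Q x))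
    (fun f => PolySpan.φ_naturality h P Q f)
  υ K X := NatIso.ofComponents (fun x => @asIso _ _ _ _ (PolySpan.υ h x) (PolySpan.isIso_υ h x))
    (fun f => PolySpan.υ_naturality h f)

/-- Whiskerings are horizontal composites with identities; the associator and the unitors are the
isomorphisms compatible with the action on hom-categories. -/
def cells : (action h).Cells where
  wl {_ _ _} P _ _ β := PolySpan.hcomp h (𝟙 P) β
  wr {_ _ _ _ _} α Q := PolySpan.hcomp h α (𝟙 Q)
  assoc P Q R := (PolySpan.exists_assoc h P Q R).choose
  left P := (PolySpan.exists_left h P).choose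
  right P := (PolySpan.exists_right h P).choose
  wl_spec K _ _ _ P Q Q' β V := PolySpan.hcomp_id_left_spec h P β V
  wr_spec K _ _ _ P P' α Q V := PolySpan.hcomp_id_right_spec h α Q V
  assoc_spec K _ _ _ _ P Q R V := (PolySpan.exists_assoc h P Q R).choose_spec K V
  left_spec K _ _ P V := (PolySpan.exists_left h P).choose_spec K V
  right_spec K _ _ P V := (PolySpan.exists_right h P).choose_spec K V

/-- The bicategory of polynomials in a calibrated bicategory. -/
instance : Bicategory.{max v w, max u v} (Poly h) := (cells h).toBicategory

end Poly

namespace PolySpan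
variable {X Y Z : M} {P Q R : PolySpan neat X Y}

/-- A morphism of polynomials is strong if it is represented by a polynomial morphism whose left
2-cell is invertible. -/
def Strong (f : P ⟶ Q) : Prop := ∃ g : Mor P Q, g.cls = f ∧ IsIso g.lam

lemma Mor.isIso_of_rho (hq : GF Q.r) {f g : Mor P Q} (σ : f.h ⟶ g.h)
    (h2 : f.rho.hom ≫ σ ▷ Q.r = g.rho.hom) : IsIso σ := by
  have : IsIso (σ ▷ Q.r) := by
    rw [← Iso.eq_inv_comp] at h2
    rw [h2]
    infer_instance
  exact hq.isIso σ

lemma Mor.Rel.isIso_iff (hq : GF Q.r) {f g : Mor P Q} (H : f.Rel g) :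
    IsIso f.lam ↔ IsIso g.lam := by
  obtain ⟨σ, h1, h2⟩ := H
  have := Mor.isIso_of_rho hq σ h2
  rw [← h1]
  constructor
  · intro
    exact IsIso.of_isIso_comp_left (σ ▷ Q.l) _
  · intro
    infer_instance

lemma Mor.rel_of_cls_eq (hq : GF Q.r) {f g : Mor P Q} (e : f.cls = g.cls) : f.Rel g := by
  have := congrArg (fun t => P.gen ≫ cext t P.l) e
  simp only [Mor.cext_cls, gen_ext] at this
  obtain ⟨σ, h1, h2⟩ := exists_of_el_eq hq this
  exact ⟨σ, h2, h1⟩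

lemma strong_cls_iff (hq : GF Q.r) (f : Mor P Q) : Strong f.cls ↔ IsIso f.lam :=
  ⟨fun ⟨_, e, hg⟩ => ((Mor.rel_of_cls_eq hq e).isIso_iff hq).1 hg, fun H => ⟨f, rfl, H⟩⟩

lemma Strong.id (P : PolySpan neat X Y) : Strong (𝟙 P) :=
  ⟨Mor.id P, rfl, by dsimp [Mor.id]; infer_instance⟩

lemma Strong.comp {f : P ⟶ Q} {g : Q ⟶ R} : Strong f → Strong g → Strong (f ≫ g) := by
  rintro ⟨f, rfl, hf⟩ ⟨g, rfl, hg⟩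
  exact ⟨f.comp g, rfl, by dsimp [Mor.comp]; infer_instance⟩

lemma Strong.hcomp (h : IsCalibration neat) {P P' : PolySpan neat X Y} {Q Q' : PolySpan neat Y Z}
    {f : P ⟶ P'} {g : Q ⟶ Q'} : Strong f → Strong g → Strong (PolySpan.hcomp h f g) := by
  rintro ⟨f, rfl, hf⟩ ⟨g, rfl, hg⟩
  refine ⟨Mor.hcomp h f g, rfl, ?_⟩
  obtain ⟨x, τ, σ, e, -, H⟩ := Mor.hcomp_eq h f g
  have := H (by unfold Mor.psi; infer_instance)
  rw [e]
  change @IsIso (vtx h P Q ⟶ X) _ (x ≫ pc h P' Q' ≫ P'.l) (pc h P Q ≫ P.l) _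
  dsimp [Mor.paste]
  exact inferInstanceAs (IsIso ((α_ x (pc h P' Q') P'.l).inv ≫ σ ▷ P'.l ≫
    (α_ (pc h P Q) f.h P'.l).hom ≫ pc h P Q ◁ f.lam))

lemma Strong.of_iso (h : IsCalibration neat) (e : P ≅ Q) : Strong e.hom := by
  obtain ⟨f, hf⟩ := Quot.exists_rep e.hom
  obtain ⟨g, hg⟩ := Quot.exists_rep e.inv
  refine ⟨f, hf, ?_⟩
  have e1 : (f.comp g).cls = (Mor.id P).cls := by
    rw [← Mor.id_cls, ← e.hom_inv_id, ← hf, ← hg]; rfl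
  have e2 : (g.comp f).cls = (Mor.id Q).cls := by
    rw [← Mor.id_cls, ← e.inv_hom_id, ← hf, ← hg]; rfl
  obtain ⟨σ, s1, s2⟩ := Mor.rel_of_cls_eq (gf h P) e1
  have h1 := (Mor.Rel.isIso_iff (gf h P) ⟨σ, s1, s2⟩).2
    (by dsimp [Mor.id]; infer_instance)
  have h2 := ((Mor.rel_of_cls_eq (gf h Q) e2).isIso_iff (gf h Q)).2
    (by dsimp [Mor.id]; infer_instance)
  have := Mor.isIso_of_rho (gf h P) σ s2
  dsimp [Mor.comp, Mor.id] at h1 h2 s2 σ this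
  have h1' : IsIso (f.h ◁ g.lam ≫ f.lam) := IsIso.of_isIso_comp_left (α_ f.h g.h P.l).hom _
  have h2' : IsIso (g.h ◁ f.lam ≫ g.lam) := IsIso.of_isIso_comp_left (α_ g.h f.h Q.l).hom _
  have : Mono f.lam := by
    constructor
    intro z u v huv
    have k1 : g.h ◁ u = g.h ◁ v := by
      have k : (g.h ◁ u) ≫ (g.h ◁ f.lam ≫ g.lam) = g.h ◁ v ≫ (g.h ◁ f.lam ≫ g.lam) := by
        rw [← whiskerLeft_comp_assoc, huv, whiskerLeft_comp_assoc]
      exact (cancel_mono _).1 k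
    have k2 : (f.h ≫ g.h) ◁ u = (f.h ≫ g.h) ◁ v := by simp [k1]
    have k3 : 𝟙 _ ◁ u = 𝟙 _ ◁ v := by
      rw [← cancel_epi (σ ▷ z), ← whisker_exchange, ← whisker_exchange, k2]
    simpa using k3
  have : IsSplitEpi f.lam :=
    ⟨⟨inv (f.h ◁ g.lam ≫ f.lam) ≫ f.h ◁ g.lam, by simp⟩⟩
  exact isIso_of_mono_of_isSplitEpi f.lam
end PolySpan
end CategoryTheory.Bicategory

end

noncomputable section

namespace CategoryTheory.Bicategory

/-- A class of 2-cells of a bicategory which contains the invertible ones and is closed under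
composition and whiskering. -/
structure CellClass (B : Type u) [Bicategory.{w, v} B] where
  prop : ∀ {X Y : B} {f g : X ⟶ Y}, (f ⟶ g) → Prop
  comp : ∀ {X Y : B} {f g k : X ⟶ Y} {α : f ⟶ g} {β : g ⟶ k}, prop α → prop β → prop (α ≫ β)
  iso : ∀ {X Y : B} {f g : X ⟶ Y} (e : f ≅ g), prop e.hom
  wl : ∀ {X Y Z : B} (f : X ⟶ Y) {g k : Y ⟶ Z} {β : g ⟶ k}, prop β → prop (f ◁ β)
  wr : ∀ {X Y Z : B} {f g : X ⟶ Y} {α : f ⟶ g} (k : Y ⟶ Z), prop α → prop (α ▷ k)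

/-- The sub-bicategory with all objects, all 1-cells, and the 2-cells in the given class. -/
structure CellClass.Sub {B : Type u} [Bicategory.{w, v} B] (p : CellClass B) where
  obj : B

namespace CellClass.Sub
variable {B : Type u} [Bicategory.{w, v} B] {p : CellClass B}

/-- The 1-cells of the sub-bicategory. -/
@[ext] structure Hom (X Y : p.Sub) where
  cell : X.obj ⟶ Y.obj

instance : CategoryStruct p.Sub where
  Hom := Hom
  id X := ⟨𝟙 X.obj⟩
  comp f g := ⟨f.cell ≫ g.cell⟩

instance (X Y : p.Sub) : Category (X ⟶ Y) where
  Hom f g := { α : f.cell ⟶ g.cell // p.prop α }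
  id f := ⟨𝟙 f.cell, p.iso (Iso.refl _)⟩
  comp α β := ⟨α.1 ≫ β.1, p.comp α.2 β.2⟩
  id_comp _ := Subtype.ext (Category.id_comp _)
  comp_id _ := Subtype.ext (Category.comp_id _)
  assoc _ _ _ := Subtype.ext (Category.assoc _ _ _)

/-- The 2-cells of the sub-bicategory. -/
def mk₂ {X Y : p.Sub} {f g : X ⟶ Y} (α : f.cell ⟶ g.cell) (hα : p.prop α) : f ⟶ g := ⟨α, hα⟩

def val {X Y : p.Sub} {f g : X ⟶ Y} (α : f ⟶ g) : f.cell ⟶ g.cell := Subtype.val α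
lemma prop_val {X Y : p.Sub} {f g : X ⟶ Y} (α : f ⟶ g) : p.prop (val α) := Subtype.property α

/-- Invertible 2-cells belong to the sub-bicategory. -/
def mkIso {X Y : p.Sub} {f g : X ⟶ Y} (e : f.cell ≅ g.cell) : f ≅ g where
  hom := ⟨e.hom, p.iso e⟩
  inv := ⟨e.inv, p.iso e.symm⟩
  hom_inv_id := Subtype.ext e.hom_inv_id
  inv_hom_id := Subtype.ext e.inv_hom_id

instance : Bicategory p.Sub where
  whiskerLeft f _ _ β := mk₂ (f.cell ◁ val β) (p.wl f.cell (prop_val β))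
  whiskerRight α g := mk₂ (val α ▷ g.cell) (p.wr g.cell (prop_val α))
  associator f g k := mkIso (α_ f.cell g.cell k.cell)
  leftUnitor f := mkIso (λ_ f.cell)
  rightUnitor f := mkIso (ρ_ f.cell)
  whiskerLeft_id _ _ := Subtype.ext (whiskerLeft_id _ _)
  whiskerLeft_comp _ _ _ _ _ _ := Subtype.ext (whiskerLeft_comp _ _ _)
  id_whiskerLeft _ := Subtype.ext (id_whiskerLeft _)
  comp_whiskerLeft _ _ _ _ _ := Subtype.ext (comp_whiskerLeft _ _ _)
  id_whiskerRight _ _ := Subtype.ext (id_whiskerRight _ _)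
  comp_whiskerRight _ _ _ := Subtype.ext (comp_whiskerRight _ _ _)
  whiskerRight_id _ := Subtype.ext (whiskerRight_id _)
  whiskerRight_comp _ _ _ := Subtype.ext (whiskerRight_comp _ _ _)
  whisker_assoc _ _ _ _ _ := Subtype.ext (whisker_assoc _ _ _)
  whisker_exchange _ _ := Subtype.ext (whisker_exchange _ _)
  pentagon _ _ _ _ := Subtype.ext (pentagon _ _ _ _)
  triangle _ _ := Subtype.ext (triangle _ _)
end CellClass.Sub

variable {M : Type u} [Bicategory.{w, v} M] {neat : ∀ {X Y : M}, (X ⟶ Y) → Prop}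

/-- The strong morphisms of polynomials. -/
def Poly.strong (h : IsCalibration neat) : CellClass (Poly h) where
  prop {_ _ P Q} f := PolySpan.Strong (P := P) (Q := Q) f
  comp {_ _ P Q R _ _} hα hβ := PolySpan.Strong.comp (P := P) (Q := Q) (R := R) hα hβ
  iso {_ _ P Q} e := PolySpan.Strong.of_iso (P := P) (Q := Q) h ⟨e.hom, e.inv, e.hom_inv_id, e.inv_hom_id⟩
  wl P Q _ _ hβ := PolySpan.Strong.hcomp h (PolySpan.Strong.id _) hβ
  wr Q hα := PolySpan.Strong.hcomp h hα (PolySpan.Strong.id _)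

/-- The sub-bicategory of strong polynomial morphisms. -/
abbrev PolyStrong (h : IsCalibration neat) := (Poly.strong h).Sub

/-- A biequivalence of bicategories: a pseudofunctor which is an equivalence on hom-categories and
surjective on objects up to equivalence. -/
def Biequivalent (B : Type*) (B' : Type*) [Bicategory B] [Bicategory B'] : Prop :=
  ∃ F : Pseudofunctor B B', (∀ X Y : B, (F.mapFunctor X Y).IsEquivalence) ∧
    ∀ Y : B', ∃ X : B, Nonempty (F.obj X ≌ Y)
end CategoryTheory.Bicategory

end

noncomputable section

namespace CategoryTheory
variable {C : Type u} [Category.{v} C] [HasPullbacks C]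

attribute [local simp] pullback.lift_fst pullback.lift_snd pullback.lift_fst_assoc
  pullback.lift_snd_assoc

/-- A morphism is powerful (exponentiable) when pulling back along it has a right adjoint. -/
def Powerful {E S : C} (f : E ⟶ S) : Prop := (Over.pullback f).IsLeftAdjoint

section
variable {S E U B : C} {u : U ⟶ S} {f : E ⟶ S}

/-- The value of a map out of a pullback on a generalized element. -/
def pt (g : pullback u f ⟶ B) {V : C} (x : V ⟶ U) (e : V ⟶ E) (h : x ≫ u = e ≫ f) : V ⟶ B :=
  pullback.lift x e h ≫ g

lemma pt_congr (g : pullback u f ⟶ B) {V : C} {x x' : V ⟶ U} {e e' : V ⟶ E} (h : x ≫ u = e ≫ f)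
    (hx : x = x') (he : e = e') : pt g x e h = pt g x' e' (by rw [← hx, ← he, h]) := by
  subst hx he
  rfl

lemma comp_pt (g : pullback u f ⟶ B) {V V' : C} (x : V ⟶ U) (e : V ⟶ E) (h : x ≫ u = e ≫ f)
    (k : V' ⟶ V) : k ≫ pt g x e h = pt g (k ≫ x) (k ≫ e) (by simp [h]) := by
  rw [pt, pt, ← Category.assoc]
  congr 1
  apply pullback.hom_ext <;> simp

lemma pt_comp (g : pullback u f ⟶ B) {V B' : C} (x : V ⟶ U) (e : V ⟶ E) (h : x ≫ u = e ≫ f)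
    (k : B ⟶ B') : pt g x e h ≫ k = pt (g ≫ k) x e h := by simp [pt]

lemma pt_ext {g g' : pullback u f ⟶ B} (H : ∀ {V : C} (x : V ⟶ U) (e : V ⟶ E)
    (h : x ≫ u = e ≫ f), pt g x e h = pt g' x e h) : g = g' := by
  have := H (pullback.fst u f) (pullback.snd u f) pullback.condition
  simpa [pt] using this

lemma pt_fst {V : C} (x : V ⟶ U) (e : V ⟶ E) (h : x ≫ u = e ≫ f) :
    pt (pullback.fst u f) x e h = x := by simp [pt]

lemma pt_snd {V : C} (x : V ⟶ U) (e : V ⟶ E) (h : x ≫ u = e ≫ f) :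
    pt (pullback.snd u f) x e h = e := by simp [pt]
end

/-- The universal property of the dependent product of `b : B ⟶ E` along `f : E ⟶ S`. -/
structure IsPi {E S B W : C} (f : E ⟶ S) (b : B ⟶ E) (r : W ⟶ S) (ev : pullback r f ⟶ B) :
    Prop where
  w : ev ≫ b = pullback.snd r f
  lift : ∀ {U : C} (u : U ⟶ S) (g : pullback u f ⟶ B), g ≫ b = pullback.snd u f →
    ∃ (w : U ⟶ W) (hw : w ≫ r = u), ∀ {V : C} (k : V ⟶ U) (e : V ⟶ E) (h : k ≫ u = e ≫ f),
      pt ev (k ≫ w) e (by rw [Category.assoc, hw, h]) = pt g k e h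
  ext : ∀ {U : C} (w w' : U ⟶ W), w ≫ r = w' ≫ r →
    (∀ {V : C} (k : V ⟶ U) (e : V ⟶ E) (h : (k ≫ w) ≫ r = e ≫ f) (h' : (k ≫ w') ≫ r = e ≫ f),
      pt ev (k ≫ w) e h = pt ev (k ≫ w') e h') → w = w'

lemma lift_lift {E S U V W : C} {f : E ⟶ S} {u : U ⟶ S} {r : W ⟶ S} (w : U ⟶ W) (k : V ⟶ U)
    (e : V ⟶ E) (h : k ≫ u = e ≫ f) (hw : w ≫ r = u) :
    pullback.lift k e h ≫ pullback.lift (f := r) (g := f) (pullback.fst u f ≫ w) (pullback.snd u f)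
      (by rw [Category.assoc, hw, pullback.condition]) =
      pullback.lift (k ≫ w) e (by rw [Category.assoc, hw, h]) := by
  apply pullback.hom_ext <;> simp

lemma lift_pullback_map {E S V : C} {f : E ⟶ S} {A A' : Over S} (w : A ⟶ A') (k : V ⟶ A.left)
    (e : V ⟶ E) (h : k ≫ A.hom = e ≫ f) :
    pullback.lift k e h ≫ ((Over.pullback f).map w).left =
      pullback.lift (f := A'.hom) (k ≫ w.left) e (by rw [Category.assoc, Over.w w, h]) :=
  lift_lift w.left k e h (Over.w w)

lemma powerful_iff {E S : C} (f : E ⟶ S) : Powerful f ↔ ∀ {B : C} (b : B ⟶ E),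
    ∃ (W : C) (r : W ⟶ S) (ev : pullback r f ⟶ B), IsPi f b r ev := by
  constructor
  · intro hf B b
    have : (Over.pullback f).IsLeftAdjoint := hf
    let R := (Over.pullback f).rightAdjoint
    let adj : Over.pullback f ⊣ R := Adjunction.ofIsLeftAdjoint _
    let c := adj.counit.app (Over.mk b)
    refine ⟨(R.obj (Over.mk b)).left, (R.obj (Over.mk b)).hom, c.left, Over.w c, ?_, ?_⟩
    · intro U u g hg
      let g' : (Over.pullback f).obj (Over.mk u) ⟶ Over.mk b := Over.homMk g hg
      let w := adj.homEquiv _ _ g'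
      have hw : (Over.pullback f).map w ≫ c = g' := by
        simp [c, w, Adjunction.homEquiv_unit]
      refine ⟨w.left, Over.w w, fun {V} k e h => ?_⟩
      have := congrArg (fun z => pullback.lift k e h ≫ z.left) hw
      refine Eq.trans ?_ this
      change _ = pullback.lift k e h ≫ ((Over.pullback f).map w).left ≫ c.left
      rw [← Category.assoc (pullback.lift k e h)]
      exact congrArg (· ≫ c.left) (lift_pullback_map w k e h).symm
    · intro U w w' hw H
      let a : Over.mk (w ≫ (R.obj (Over.mk b)).hom) ⟶ R.obj (Over.mk b) := Over.homMk w rfl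
      let a' : Over.mk (w ≫ (R.obj (Over.mk b)).hom) ⟶ R.obj (Over.mk b) := Over.homMk w' hw.symm
      suffices a = a' from congrArg CommaMorphism.left this
      apply (adj.homEquiv _ _).symm.injective
      rw [Adjunction.homEquiv_counit, Adjunction.homEquiv_counit]
      ext
      have e := pullback.condition (f := w ≫ (R.obj (Over.mk b)).hom) (g := f)
      have := H (pullback.fst (w ≫ (R.obj (Over.mk b)).hom) f) (pullback.snd _ f) (by simpa using e)
        (by rw [Category.assoc, ← hw]; exact e)
      exact this
  · intro H
    have := fun A : Over E => (H A.hom)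
    refine isLeftAdjoint_iff_hasTerminal_costructuredArrow.2 fun A => ?_
    obtain ⟨W, r, ev, h⟩ := H A.hom
    let T : CostructuredArrow (Over.pullback f) A :=
      CostructuredArrow.mk (Y := Over.mk r) (Over.homMk ev h.w : (Over.pullback f).obj (Over.mk r) ⟶ A)
    have key : ∀ X : CostructuredArrow (Over.pullback f) A, Nonempty (Unique (X ⟶ T)) := by
      intro X
      obtain ⟨w, hw, hk⟩ := h.lift X.left.hom X.hom.left (Over.w X.hom)
      refine ⟨⟨⟨CostructuredArrow.homMk (Over.homMk w hw) ?_⟩, ?_⟩⟩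
      · ext
        have := hk (pullback.fst X.left.hom f) (pullback.snd _ _) pullback.condition
        have e : pullback.lift (pullback.fst X.left.hom f) (pullback.snd _ _) pullback.condition =
          𝟙 _ := by ext <;> simp
        rw [pt, pt, e] at this
        exact this.trans (Category.id_comp _)
      · intro m
        ext
        refine h.ext _ _ ((Over.w m.left).trans hw.symm) fun {V} k e h1 h2 => ?_
        have h3 : k ≫ X.left.hom = e ≫ f := by
          rw [← hw, ← Category.assoc]
          exact h2
        refine Eq.trans ?_ (hk k e h3).symm
        have := congrArg (fun z => pullback.lift k e h3 ≫ z.left) (CostructuredArrow.w m)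
        refine Eq.trans ?_ this
        change _ = pullback.lift k e h3 ≫ ((Over.pullback f).map m.left).left ≫ ev
        rw [← Category.assoc (pullback.lift k e h3)]
        exact congrArg (· ≫ ev) (lift_pullback_map m.left k e h3).symm
    have : ∀ X, Unique (X ⟶ T) := fun X => (key X).some
    exact IsTerminal.hasTerminal (X := T) (IsTerminal.ofUnique T)

/-- Powerful maps are stable under pullback. -/
lemma Powerful.pullback_fst {E S S' : C} {f : E ⟶ S} (hf : Powerful f) (p : S' ⟶ S) :
    Powerful (pullback.fst p f) := by
  rw [powerful_iff] at hf ⊢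
  intro B b
  obtain ⟨W₁, r₁, ev₁, h₁⟩ := hf (b ≫ pullback.snd p f)
  obtain ⟨W₂, r₂, ev₂, h₂⟩ := hf (pullback.snd p f)
  obtain ⟨m, hm, Hm⟩ := h₂.lift r₁ (ev₁ ≫ b) (by simpa using h₁.w)
  obtain ⟨n, hn, Hn⟩ := h₂.lift p (𝟙 _) (by simp)
  have hf₁ : ∀ {V : C} (w : V ⟶ pullback m n) (e : V ⟶ pullback p f)
      (_ : w ≫ pullback.snd m n = e ≫ pullback.fst p f),
      (w ≫ pullback.fst m n) ≫ r₁ = (e ≫ pullback.snd p f) ≫ f := by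
    intro V w e h
    rw [Category.assoc, Category.assoc, ← pullback.condition, ← hm, pullback.condition_assoc, hn,
      ← Category.assoc, h, Category.assoc]
  let ev : pullback (pullback.snd m n) (pullback.fst p f) ⟶ B :=
    pt ev₁ (pullback.fst _ _ ≫ pullback.fst m n) (pullback.snd _ _ ≫ pullback.snd p f)
      (hf₁ _ _ pullback.condition)
  have hev : ∀ {V : C} (w : V ⟶ pullback m n) (e : V ⟶ pullback p f) (h),
      pt ev w e h = pt ev₁ (w ≫ pullback.fst m n) (e ≫ pullback.snd p f) (hf₁ w e h) := by
    intro V w e h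
    dsimp only [ev]
    rw [pt, comp_pt]
    exact pt_congr _ _ (by simp) (by simp)
  have hn' : ∀ {V : C} (k : V ⟶ S') (e : V ⟶ E) (h : k ≫ p = e ≫ f),
      pt ev₂ (k ≫ n) e (by rw [Category.assoc, hn, h]) = pullback.lift k e h := by
    intro V k e h
    rw [Hn k e h, pt, Category.comp_id]
  have hm' : ∀ {V : C} (w : V ⟶ pullback m n) (e : V ⟶ pullback p f) (h),
      pt ev₁ (w ≫ pullback.fst m n) (e ≫ pullback.snd p f) (hf₁ w e h) ≫ b = e := by
    intro V w e h
    rw [pt_comp, ← Hm]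
    refine (pt_congr _ _ (x' := (e ≫ pullback.fst p f) ≫ n) ?_ rfl).trans
      ((hn' _ _ (by simp [pullback.condition])).trans ?_)
    · rw [Category.assoc, pullback.condition, ← Category.assoc, h]
    · apply pullback.hom_ext <;> simp
  refine ⟨pullback m n, pullback.snd m n, ev, ?_, ?_, ?_⟩
  · refine pt_ext fun w e h => ?_
    rw [← pt_comp, hev, hm', pt_snd]
    exact h
  · intro U u g hg
    have hu : ∀ {V : C} (k : V ⟶ U) (e : V ⟶ E) (h : k ≫ u ≫ p = e ≫ f),
      k ≫ u = pullback.lift (k ≫ u) e (by rw [Category.assoc, h]) ≫ pullback.fst p f := by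
        intro V k e h
        simp
    let g₁ : pullback (u ≫ p) f ⟶ B := pt g (pullback.fst _ _) _ (hu _ (pullback.snd _ _)
      pullback.condition)
    have hg₁ : ∀ {V : C} (k : V ⟶ U) (e : V ⟶ E) (h : k ≫ u ≫ p = e ≫ f),
      pt g₁ k e h = pt g k _ (hu k e h) := by
      intro V k e h
      dsimp only [g₁]
      rw [pt, comp_pt]
      refine pt_congr _ _ (by simp) ?_
      apply pullback.hom_ext <;> simp
    have hgb : ∀ {V : C} (k : V ⟶ U) (e : V ⟶ E) (h : k ≫ u ≫ p = e ≫ f),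
      pt g₁ k e h ≫ b = pullback.lift (k ≫ u) e (by rw [Category.assoc, h]) := by
      intro V k e h
      rw [hg₁, pt_comp, hg, pt_snd]
    obtain ⟨w, hw, Hw⟩ := h₁.lift (u ≫ p) g₁ (pt_ext fun k e h => by
      rw [← pt_comp, ← Category.assoc, pt_comp, ← pt_comp, hgb, pt_snd]
      simp)
    have hc : w ≫ m = u ≫ n := by
      refine h₂.ext _ _ (by simp [hm, hn, hw]) fun k e h h' => ?_
      have h3 : k ≫ u ≫ p = e ≫ f := by simpa [hn] using h'
      have h4 : (k ≫ w) ≫ r₁ = e ≫ f := by rw [Category.assoc, hw, h3]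
      refine (pt_congr _ _ (Category.assoc _ _ _).symm rfl).trans ?_
      rw [Hm (k ≫ w) e h4, ← pt_comp, Hw k e h3, hgb]
      refine ((pt_congr _ _ (Category.assoc _ _ _).symm rfl).trans ?_).symm
      exact hn' _ _ _
    refine ⟨pullback.lift w u hc, by simp, fun {V} k e h => ?_⟩
    rw [hev]
    have h3 : k ≫ u ≫ p = (e ≫ pullback.snd p f) ≫ f := by
      rw [← Category.assoc, h, Category.assoc, pullback.condition, Category.assoc]
    refine (pt_congr _ _ (x' := k ≫ w) (by simp) rfl).trans ?_
    rw [Hw k _ h3, hg₁]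
    refine pt_congr _ _ rfl ?_
    apply pullback.hom_ext <;> simp [h]
  · intro U w w' hw H
    apply pullback.hom_ext _ hw
    refine h₁.ext _ _ ?_ fun k e h h' => ?_
    · rw [Category.assoc, Category.assoc, ← hm, pullback.condition_assoc, hn, ← Category.assoc, hw,
        Category.assoc]
    · have h3 : ((k ≫ w) ≫ pullback.snd m n) ≫ p = e ≫ f := by
        rw [← h, ← hm, Category.assoc, Category.assoc, Category.assoc, Category.assoc,
          pullback.condition_assoc, hn]
      have := H k (pullback.lift ((k ≫ w) ≫ pullback.snd m n) e h3) (by simp) (by simp [hw])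
      rw [hev, hev] at this
      refine (pt_congr _ _ (Category.assoc _ _ _).symm (by simp)).trans (this.trans ?_)
      exact pt_congr _ _ (Category.assoc _ _ _) (by simp)

lemma Powerful.id (S : C) : Powerful (𝟙 S) :=
  Functor.isLeftAdjoint_of_iso (Over.pullbackId (X := S)).symm

lemma Powerful.comp {E S T : C} {f : E ⟶ S} {g : S ⟶ T} (hf : Powerful f) (hg : Powerful g) :
    Powerful (f ≫ g) := by
  have : (Over.pullback f).IsLeftAdjoint := hf
  have : (Over.pullback g).IsLeftAdjoint := hg
  exact Functor.isLeftAdjoint_of_iso (Over.pullbackComp f g).symm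

end CategoryTheory

end

noncomputable section

namespace CategoryTheory

/-- The objects of the bicategory of polynomials in a category `C` are those of `C`. -/
structure CPoly (C : Type u) where
  obj : C

variable {C : Type u} [Category.{v} C] [HasPullbacks C]

/-- A polynomial in `C`: a diagram `X ← E → B → Y` with powerful middle map. -/
structure Diag (X Y : C) where
  E : C
  B : C
  s : E ⟶ X
  f : E ⟶ B
  t : B ⟶ Y
  powerful : Powerful f

namespace Diag

/-- A 2-cell of polynomials `P ⟶ Q`: a map of bases `φ`, and a map from the pullback along `φ` of
`Q.E` to `P.E`, compatible with the structure maps. -/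
structure Hom {X Y : C} (P Q : Diag X Y) where
  base : P.B ⟶ Q.B
  fib : pullback base Q.f ⟶ P.E
  base_t : base ≫ Q.t = P.t
  fib_f : fib ≫ P.f = pullback.fst base Q.f
  fib_s : fib ≫ P.s = pullback.snd base Q.f ≫ Q.s

namespace Hom
section
variable {X Y : C} {P Q : Diag X Y} (α : Hom P Q) {U V : C}

/-- The action of a 2-cell on generalized elements of the bases. -/
def bs (x : U ⟶ P.B) : U ⟶ Q.B := x ≫ α.base

/-- The action of a 2-cell on generalized elements of the fibres. -/
def at' (x : U ⟶ P.B) (e : U ⟶ Q.E) (h : e ≫ Q.f = α.bs x) : U ⟶ P.E :=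
  pt α.fib x e (show x ≫ α.base = e ≫ Q.f from h.symm)

@[simp] lemma bs_t (x : U ⟶ P.B) : α.bs x ≫ Q.t = x ≫ P.t := by simp [bs, α.base_t]
@[simp] lemma at_f (x : U ⟶ P.B) (e : U ⟶ Q.E) (h : e ≫ Q.f = α.bs x) :
    α.at' x e h ≫ P.f = x := by rw [at', pt_comp, α.fib_f, pt_fst]
@[simp] lemma at_s (x : U ⟶ P.B) (e : U ⟶ Q.E) (h : e ≫ Q.f = α.bs x) :
    α.at' x e h ≫ P.s = e ≫ Q.s := by rw [at', pt_comp, α.fib_s, ← pt_comp, pt_snd]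
@[simp] lemma comp_bs (k : V ⟶ U) (x : U ⟶ P.B) : k ≫ α.bs x = α.bs (k ≫ x) := by simp [bs]
@[simp] lemma comp_at (k : V ⟶ U) (x : U ⟶ P.B) (e : U ⟶ Q.E) (h : e ≫ Q.f = α.bs x) :
    k ≫ α.at' x e h = α.at' (k ≫ x) (k ≫ e) (by simp [h]) := by rw [at', comp_pt, at']

variable {α} in
lemma ext' {β : Hom P Q} (hb : ∀ {U : C} (x : U ⟶ P.B), α.bs x = β.bs x)
    (ha : ∀ {U : C} (x : U ⟶ P.B) (e : U ⟶ Q.E) (h : e ≫ Q.f = α.bs x) (h' : e ≫ Q.f = β.bs x),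
      α.at' x e h = β.at' x e h') : α = β := by
  obtain ⟨b, a, h1, h2, h3⟩ := α
  obtain ⟨b', a', h1', h2', h3'⟩ := β
  obtain rfl : b = b' := by simpa [bs] using hb (𝟙 _)
  obtain rfl : a = a' := pt_ext fun x e h => ha x e h.symm h.symm
  rfl

end
end Hom

/-- A natural action on generalized elements, of the sort that determines a 2-cell. -/
structure Fam {X Y : C} (P Q : Diag X Y) where
  b : ∀ {U : C}, (U ⟶ P.B) → (U ⟶ Q.B)
  comp_b : ∀ {U V : C} (k : V ⟶ U) (x : U ⟶ P.B), k ≫ b x = b (k ≫ x)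
  b_t : ∀ {U : C} (x : U ⟶ P.B), b x ≫ Q.t = x ≫ P.t
  a : ∀ {U : C} (x : U ⟶ P.B) (e : U ⟶ Q.E), e ≫ Q.f = b x → (U ⟶ P.E)
  comp_a : ∀ {U V : C} (k : V ⟶ U) (x : U ⟶ P.B) (e : U ⟶ Q.E) (h : e ≫ Q.f = b x),
    k ≫ a x e h = a (k ≫ x) (k ≫ e) (by rw [Category.assoc, h, comp_b])
  a_f : ∀ {U : C} (x : U ⟶ P.B) (e : U ⟶ Q.E) (h : e ≫ Q.f = b x), a x e h ≫ P.f = x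
  a_s : ∀ {U : C} (x : U ⟶ P.B) (e : U ⟶ Q.E) (h : e ≫ Q.f = b x), a x e h ≫ P.s = e ≫ Q.s

namespace Fam
variable {X Y : C} {P Q : Diag X Y} (F : Fam P Q)

/-- The 2-cell with a given action on generalized elements. -/
def toHom : Hom P Q where
  base := F.b (𝟙 _)
  fib := F.a (pullback.fst _ _) (pullback.snd _ _)
    (by rw [← pullback.condition, F.comp_b, Category.comp_id])
  base_t := by simp [F.b_t]
  fib_f := F.a_f _ _ _
  fib_s := F.a_s _ _ _

lemma toHom_bs {U : C} (x : U ⟶ P.B) : F.toHom.bs x = F.b x := by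
  simp [Hom.bs, toHom, F.comp_b]
lemma a_congr {U : C} {x x' : U ⟶ P.B} {e e' : U ⟶ Q.E} (h : e ≫ Q.f = F.b x) (hx : x = x')
    (he : e = e') : F.a x e h = F.a x' e' (by rw [← hx, ← he, h]) := by
  subst hx he
  rfl
lemma toHom_at {U : C} (x : U ⟶ P.B) (e : U ⟶ Q.E) (h : e ≫ Q.f = F.toHom.bs x) :
    F.toHom.at' x e h = F.a x e (h.trans (F.toHom_bs x)) :=
  (F.comp_a (pullback.lift x e h.symm) _ _ _).trans
    (F.a_congr _ (pullback.lift_fst _ _ _) (pullback.lift_snd _ _ _))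

/-- The identity 2-cell. -/
def id (P : Diag X Y) : Fam P P where
  b x := x
  comp_b _ _ := rfl
  b_t _ := rfl
  a _ e _ := e
  comp_a _ _ _ _ := rfl
  a_f _ _ h := h
  a_s _ _ _ := rfl

/-- The composite of 2-cells. -/
def comp {R : Diag X Y} (α : Hom P Q) (β : Hom Q R) : Fam P R where
  b x := β.bs (α.bs x)
  comp_b _ _ := by simp
  b_t _ := by simp
  a x e h := α.at' x (β.at' (α.bs x) e h) (by simp)
  comp_a _ _ _ _ := by simp
  a_f _ _ _ := by simp
  a_s _ _ _ := by simp
end Fam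

instance {X Y : C} : CategoryStruct (Diag X Y) where
  Hom := Hom
  id P := (Fam.id P).toHom
  comp α β := (Fam.comp α β).toHom

section
variable {X Y : C} {P Q R : Diag X Y}

lemma comp_bs (α : P ⟶ Q) (β : Q ⟶ R) {U : C} (x : U ⟶ P.B) :
    Hom.bs (α ≫ β) x = Hom.bs β (Hom.bs α x) := Fam.toHom_bs (Fam.comp α β) x
lemma comp_at (α : P ⟶ Q) (β : Q ⟶ R) {U : C} (x : U ⟶ P.B) (e : U ⟶ R.E)
    (h : e ≫ R.f = Hom.bs (α ≫ β) x) :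
    Hom.at' (α ≫ β) x e h = Hom.at' α x (Hom.at' β (Hom.bs α x) e (by rw [h, comp_bs]))
      (Hom.at_f ..) := Fam.toHom_at (Fam.comp α β) x e h
lemma id_bs {U : C} (x : U ⟶ P.B) : Hom.bs (𝟙 P) x = x := Fam.toHom_bs (Fam.id P) x
lemma id_at {U : C} (x : U ⟶ P.B) (e : U ⟶ P.E) (h : e ≫ P.f = Hom.bs (𝟙 P) x) :
    Hom.at' (𝟙 P) x e h = e := Fam.toHom_at (Fam.id P) x e h
attribute [simp] comp_bs comp_at id_bs id_at

lemma hom_ext {α β : P ⟶ Q} (hb : ∀ {U : C} (x : U ⟶ P.B), Hom.bs α x = Hom.bs β x)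
    (ha : ∀ {U : C} (x : U ⟶ P.B) (e : U ⟶ Q.E) (h : e ≫ Q.f = Hom.bs α x)
      (h' : e ≫ Q.f = Hom.bs β x), Hom.at' α x e h = Hom.at' β x e h') : α = β :=
  Hom.ext' hb ha

end

instance {X Y : C} : Category (Diag X Y) where
  id_comp _ := hom_ext (by simp) (by simp)
  comp_id _ := hom_ext (by simp) (by simp)
  assoc _ _ _ := hom_ext (by simp) (by simp)
end Diag
end CategoryTheory

end

noncomputable section

namespace CategoryTheory.Diag
variable {C : Type u} [Category.{v} C] [HasPullbacks C]

section
variable {X Y Z : C} (P : Diag X Y) (Q : Diag Y Z)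

lemma exists_pi : ∃ (W : C) (r : W ⟶ Q.B) (ev : pullback r Q.f ⟶ pullback P.t Q.s),
    IsPi Q.f (pullback.snd P.t Q.s) r ev := (powerful_iff Q.f).1 Q.powerful _

/-- The dependent product along `Q.f` of the pullback of `P.t` along `Q.s`. -/
def W : C := (exists_pi P Q).choose

/-- The projection of the dependent product. -/
def r : W P Q ⟶ Q.B := (exists_pi P Q).choose_spec.choose

/-- The evaluation map of the dependent product. -/
def ev₀ : pullback (r P Q) Q.f ⟶ pullback P.t Q.s :=
  (exists_pi P Q).choose_spec.choose_spec.choose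

lemma isPi : IsPi Q.f (pullback.snd P.t Q.s) (r P Q) (ev₀ P Q) :=
  (exists_pi P Q).choose_spec.choose_spec.choose_spec

/-- The evaluation map of the dependent product, projected to `P.B`. -/
def ev₁ : pullback (r P Q) Q.f ⟶ P.B := ev₀ P Q ≫ pullback.fst _ _

lemma ev₁_t : ev₁ P Q ≫ P.t = pullback.snd _ _ ≫ Q.s := by
  rw [ev₁, Category.assoc, pullback.condition, ← Category.assoc, (isPi P Q).w]

/-- The composite of polynomials: its base is the dependent product `W P Q`, and its total object is
the pullback of `P.f` along the evaluation map. -/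
def comp : Diag X Z where
  E := pullback (ev₁ P Q) P.f
  B := W P Q
  s := pullback.snd _ _ ≫ P.s
  f := pullback.fst (ev₁ P Q) P.f ≫ pullback.fst (r P Q) Q.f
  t := r P Q ≫ Q.t
  powerful := (P.powerful.pullback_fst _).comp (Q.powerful.pullback_fst _)

/-- The projection and the evaluation map, and the projections of the total object. -/
def cr : (P.comp Q).B ⟶ Q.B := r P Q
def cev : pullback (cr P Q) Q.f ⟶ P.B := ev₁ P Q
def p₁ : (P.comp Q).E ⟶ pullback (cr P Q) Q.f := pullback.fst (ev₁ P Q) P.f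
def p₂ : (P.comp Q).E ⟶ P.E := pullback.snd (ev₁ P Q) P.f

lemma cr_t : cr P Q ≫ Q.t = (P.comp Q).t := rfl
lemma cev_t : cev P Q ≫ P.t = pullback.snd _ _ ≫ Q.s := ev₁_t P Q
lemma p_w : p₁ P Q ≫ cev P Q = p₂ P Q ≫ P.f := pullback.condition
lemma p₁_fst : p₁ P Q ≫ pullback.fst (cr P Q) Q.f = (P.comp Q).f := rfl
lemma p₂_s : p₂ P Q ≫ P.s = (P.comp Q).s := rfl
variable {P Q} in
lemma p_lift {U : C} (x : U ⟶ pullback (cr P Q) Q.f) (e : U ⟶ P.E) (h : x ≫ cev P Q = e ≫ P.f) :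
    ∃ y : U ⟶ (P.comp Q).E, y ≫ p₁ P Q = x ∧ y ≫ p₂ P Q = e :=
  ⟨pullback.lift x e h, pullback.lift_fst _ _ _, pullback.lift_snd _ _ _⟩
variable {P Q} in
lemma p_ext {U : C} {y y' : U ⟶ (P.comp Q).E} (h₁ : y ≫ p₁ P Q = y' ≫ p₁ P Q)
    (h₂ : y ≫ p₂ P Q = y' ≫ p₂ P Q) : y = y' := pullback.hom_ext h₁ h₂

/-- The identity polynomial. -/
def one (X : C) : Diag X X := ⟨X, X, 𝟙 X, 𝟙 X, 𝟙 X, Powerful.id X⟩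
end

section
variable {X Y Z : C} {P : Diag X Y} {Q : Diag Y Z} {U V : C}

/-- A generalized element of the base of a composite is an element `rr w` of the base of `Q` and,
for elements `d` of the fibre of `Q` over it, elements `ev w d` of the base of `P`. -/
def rr (w : U ⟶ (P.comp Q).B) : U ⟶ Q.B := w ≫ cr P Q
def ev (w : U ⟶ (P.comp Q).B) (d : U ⟶ Q.E) (h : d ≫ Q.f = rr w) : U ⟶ P.B :=
  pt (cev P Q) w d (show w ≫ cr P Q = d ≫ Q.f from h.symm)

@[simp] lemma comp_rr (k : V ⟶ U) (w : U ⟶ (P.comp Q).B) : k ≫ rr w = rr (k ≫ w) :=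
  (Category.assoc _ _ _).symm
@[simp] lemma comp_ev (k : V ⟶ U) (w : U ⟶ (P.comp Q).B) (d : U ⟶ Q.E) (h : d ≫ Q.f = rr w) :
    k ≫ ev w d h = ev (k ≫ w) (k ≫ d) (by simp [h]) := by rw [ev, comp_pt, ev]
@[simp] lemma ev_t (w : U ⟶ (P.comp Q).B) (d : U ⟶ Q.E) (h : d ≫ Q.f = rr w) :
    ev w d h ≫ P.t = d ≫ Q.s := by rw [ev, pt_comp, cev_t, ← pt_comp, pt_snd]
@[simp] lemma comp_t (w : U ⟶ (P.comp Q).B) : w ≫ (P.comp Q).t = rr w ≫ Q.t :=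
  (Category.assoc _ _ _).symm

lemma W_ext {w w' : U ⟶ (P.comp Q).B} (h₁ : rr w = rr w')
    (h₂ : ∀ {V : C} (k : V ⟶ U) (d : V ⟶ Q.E) (h : d ≫ Q.f = rr (k ≫ w))
      (h' : d ≫ Q.f = rr (k ≫ w')), ev (k ≫ w) d h = ev (k ≫ w') d h') : w = w' := by
  refine (isPi P Q).ext w w' h₁ fun k d h h' => ?_
  apply pullback.hom_ext
  · refine (pt_comp _ _ _ _ _).trans ((h₂ k d h.symm h'.symm).trans (pt_comp _ _ _ _ _).symm)
  · refine (pt_comp _ _ _ _ _).trans (Eq.trans ?_ (pt_comp _ _ _ _ _).symm)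
    simp only [(isPi P Q).w, pt_snd]

lemma ev_congr {w w' : U ⟶ (P.comp Q).B} {d d' : U ⟶ Q.E} (h : d ≫ Q.f = rr w) (hw : w = w')
    (hd : d = d') : ev w d h = ev w' d' (by rw [← hw, ← hd, h]) := by
  subst hw hd
  rfl

variable (P Q U) in
/-- The data that determine a generalized element of the base of a composite. -/
structure WFam where
  u : U ⟶ Q.B
  g : ∀ {V : C} (k : V ⟶ U) (d : V ⟶ Q.E), d ≫ Q.f = k ≫ u → (V ⟶ P.B)
  nat : ∀ {V V' : C} (j : V' ⟶ V) (k : V ⟶ U) (d : V ⟶ Q.E) (h : d ≫ Q.f = k ≫ u),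
    j ≫ g k d h = g (j ≫ k) (j ≫ d) (by rw [Category.assoc, h, Category.assoc])
  g_t : ∀ {V : C} (k : V ⟶ U) (d : V ⟶ Q.E) (h : d ≫ Q.f = k ≫ u), g k d h ≫ P.t = d ≫ Q.s

lemma WFam.g_congr (F : WFam P Q U) {k k' : V ⟶ U} {d d' : V ⟶ Q.E} (h : d ≫ Q.f = k ≫ F.u)
    (hk : k = k') (hd : d = d') : F.g k d h = F.g k' d' (by rw [← hk, ← hd, h]) := by
  subst hk hd
  rfl

lemma exists_mkW (F : WFam P Q U) : ∃ (w : U ⟶ (P.comp Q).B) (_ : rr w = F.u),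
    ∀ {V : C} (k : V ⟶ U) (d : V ⟶ Q.E) (h : d ≫ Q.f = rr (k ≫ w)),
      ev (k ≫ w) d h = F.g k d (by rw [h, ← comp_rr]; simp_all) := by
  let g : pullback F.u Q.f ⟶ pullback P.t Q.s :=
    pullback.lift (F.g (pullback.fst _ _) (pullback.snd _ _) pullback.condition.symm)
      (pullback.snd _ _) (F.g_t _ _ _)
  obtain ⟨w, hw, H⟩ := (isPi P Q).lift F.u g (pullback.lift_snd _ _ _)
  refine ⟨w, hw, fun {V} k d h => ?_⟩
  have h' : k ≫ F.u = d ≫ Q.f := by rw [h, ← hw]; exact (Category.assoc _ _ _).symm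
  have := (pt_comp _ _ _ _ _).symm.trans
    ((congrArg (· ≫ pullback.fst _ _) (H k d h')).trans (pt_comp _ _ _ _ _))
  refine this.trans ?_
  simp only [g, pullback.lift_fst]
  exact (F.nat (pullback.lift k d h') _ _ _).trans (F.g_congr _ (pullback.lift_fst _ _ _) (pullback.lift_snd _ _ _))

/-- The generalized element of the base of a composite determined by given data. -/
def mkW (F : WFam P Q U) : U ⟶ (P.comp Q).B := (exists_mkW F).choose
@[simp] lemma rr_mkW (F : WFam P Q U) : rr (mkW F) = F.u := (exists_mkW F).choose_spec.choose
@[simp] lemma rr_comp_mkW (F : WFam P Q U) (k : V ⟶ U) : rr (k ≫ mkW F) = k ≫ F.u := by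
  rw [← comp_rr, rr_mkW]
@[simp] lemma ev_comp_mkW (F : WFam P Q U) (k : V ⟶ U) (d : V ⟶ Q.E)
    (h : d ≫ Q.f = rr (k ≫ mkW F)) : ev (k ≫ mkW F) d h = F.g k d (by rw [h]; simp) :=
  (exists_mkW F).choose_spec.choose_spec k d h
@[simp] lemma rr_comp_comp_mkW {V' : C} (F : WFam P Q U) (j : V' ⟶ V) (k : V ⟶ U) :
    rr (j ≫ k ≫ mkW F) = j ≫ k ≫ F.u := by rw [← comp_rr, rr_comp_mkW]
@[simp] lemma ev_comp_comp_mkW {V' : C} (F : WFam P Q U) (j : V' ⟶ V) (k : V ⟶ U) (d : V' ⟶ Q.E)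
    (h : d ≫ Q.f = rr (j ≫ k ≫ mkW F)) :
    ev (j ≫ k ≫ mkW F) d h = F.g (j ≫ k) d (by rw [h]; simp) :=
  (ev_congr h (Category.assoc _ _ _).symm rfl).trans (ev_comp_mkW F (j ≫ k) d (by simp [h]))
@[simp] lemma ev_mkW (F : WFam P Q U) (d : U ⟶ Q.E) (h : d ≫ Q.f = rr (mkW F)) :
    ev (mkW F) d h = F.g (𝟙 U) d (by rw [h]; simp) :=
  (ev_congr h (Category.id_comp _).symm rfl).trans (ev_comp_mkW F (𝟙 U) d (by simp [h]))

/-- A generalized element of the total object of a composite is an element `w` of the base and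
elements `d` and `e` of the fibres of `Q` and `P` over `rr w` and `ev w d`. -/
def cd (y : U ⟶ (P.comp Q).E) : U ⟶ Q.E :=
  (y ≫ p₁ P Q) ≫ pullback.snd (cr P Q) Q.f
def ce (y : U ⟶ (P.comp Q).E) : U ⟶ P.E := y ≫ p₂ P Q

@[simp] lemma comp_cd (k : V ⟶ U) (y : U ⟶ (P.comp Q).E) : k ≫ cd y = cd (k ≫ y) := by
  simp only [cd, Category.assoc]
@[simp] lemma comp_ce (k : V ⟶ U) (y : U ⟶ (P.comp Q).E) : k ≫ ce y = ce (k ≫ y) := by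
  simp only [ce, Category.assoc]
@[simp] lemma cd_f (y : U ⟶ (P.comp Q).E) : cd y ≫ Q.f = rr (y ≫ (P.comp Q).f) := by
  simp only [cd, rr, ← p₁_fst, Category.assoc, pullback.condition]
@[simp] lemma ce_f (y : U ⟶ (P.comp Q).E) :
    ce y ≫ P.f = ev (y ≫ (P.comp Q).f) (cd y) (cd_f y) := by
  rw [ce, Category.assoc, ← p_w, ← Category.assoc, ev, pt]
  congr 1
  apply pullback.hom_ext
  · rw [pullback.lift_fst, ← p₁_fst, Category.assoc]
  · rw [pullback.lift_snd, cd]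
@[simp] lemma comp_s (y : U ⟶ (P.comp Q).E) : y ≫ (P.comp Q).s = ce y ≫ P.s :=
  (Category.assoc _ _ _).symm

lemma exists_tri (w : U ⟶ (P.comp Q).B) (d : U ⟶ Q.E) (e : U ⟶ P.E) (h : d ≫ Q.f = rr w)
    (h' : e ≫ P.f = ev w d h) :
    ∃ y : U ⟶ (P.comp Q).E, y ≫ (P.comp Q).f = w ∧ cd y = d ∧ ce y = e := by
  have h₀ : w ≫ cr P Q = d ≫ Q.f := h.symm
  obtain ⟨y, h₁, h₂⟩ := p_lift (pullback.lift (f := cr P Q) (g := Q.f) w d h₀) e h'.symm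
  refine ⟨y, ?_, ?_, h₂⟩
  · rw [← p₁_fst, ← Category.assoc, h₁, pullback.lift_fst]
  · rw [cd, h₁, pullback.lift_snd]

/-- The generalized element of the total object of a composite with given components. -/
def tri (w : U ⟶ (P.comp Q).B) (d : U ⟶ Q.E) (e : U ⟶ P.E) (h : d ≫ Q.f = rr w)
    (h' : e ≫ P.f = ev w d h) : U ⟶ (P.comp Q).E := (exists_tri w d e h h').choose

section
variable (w : U ⟶ (P.comp Q).B) (d : U ⟶ Q.E) (e : U ⟶ P.E) (h : d ≫ Q.f = rr w)
    (h' : e ≫ P.f = ev w d h)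
@[simp] lemma tri_f : tri w d e h h' ≫ (P.comp Q).f = w := (exists_tri w d e h h').choose_spec.1
@[simp] lemma cd_tri : cd (tri w d e h h') = d := (exists_tri w d e h h').choose_spec.2.1
@[simp] lemma ce_tri : ce (tri w d e h h') = e := (exists_tri w d e h h').choose_spec.2.2
end

lemma E_ext {y y' : U ⟶ (P.comp Q).E} (hf : y ≫ (P.comp Q).f = y' ≫ (P.comp Q).f)
    (hd : cd y = cd y') (he : ce y = ce y') : y = y' := by
  apply p_ext _ he
  apply pullback.hom_ext _ hd
  rw [Category.assoc, Category.assoc]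
  exact hf
@[simp] lemma tri_eta (w : U ⟶ (P.comp Q).B) (y : U ⟶ (P.comp Q).E) (hw : y ≫ (P.comp Q).f = w)
    (h : cd y ≫ Q.f = rr w) (h' : ce y ≫ P.f = ev w (cd y) h) : tri w (cd y) (ce y) h h' = y :=
  E_ext (by simp [hw]) (by simp) (by simp)
@[simp] lemma comp_tri (k : V ⟶ U) (w : U ⟶ (P.comp Q).B) (d : U ⟶ Q.E) (e : U ⟶ P.E)
    (h : d ≫ Q.f = rr w) (h' : e ≫ P.f = ev w d h) : k ≫ tri w d e h h' =
      tri (k ≫ w) (k ≫ d) (k ≫ e) (by simp [h]) (by simp [h']) :=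
  E_ext (by simp) (by simp [← comp_cd]) (by simp [← comp_ce])
end
end CategoryTheory.Diag

end

noncomputable section

namespace CategoryTheory.Diag
variable {C : Type u} [Category.{v} C] [HasPullbacks C]
section
variable {X Y Z : C} {P P' : Diag X Y} {Q Q' : Diag Y Z} {U V : C}

/-- The action of a whisker on the base. -/
def wrW (α : P ⟶ P') (w : U ⟶ (P.comp Q).B) : WFam P' Q U where
  u := rr w
  g k d h := Hom.bs α (ev (k ≫ w) d (by simp [h]))
  nat _ _ _ _ := by simp
  g_t _ _ _ := by simp

@[simp] lemma wrW_u (α : P ⟶ P') (w : U ⟶ (P.comp Q).B) : (wrW α w).u = rr w := rfl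
@[simp] lemma wrW_g (α : P ⟶ P') (w : U ⟶ (P.comp Q).B) (k : V ⟶ U) (d : V ⟶ Q.E)
    (h : d ≫ Q.f = k ≫ (wrW α w).u) :
    (wrW α w).g k d h = Hom.bs α (ev (k ≫ w) d (h.trans (comp_rr k w))) := rfl

/-- Whiskering on the right. -/
def wr (α : P ⟶ P') (Q : Diag Y Z) : Fam (P.comp Q) (P'.comp Q) where
  b w := mkW (wrW α w)
  comp_b _ _ := W_ext (by simp) (by simp)
  b_t _ := by simp
  a x e h := tri x (cd e) (Hom.at' α (ev x (cd e) (by simp [h])) (ce e) (by simp [h]))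
    (by simp [h]) (by simp)
  comp_a _ _ _ _ := by simp
  a_f _ _ _ := by simp
  a_s _ _ _ := by simp

/-- The action of a whisker on the base. -/
def wlW (β : Q ⟶ Q') (w : U ⟶ (P.comp Q).B) : WFam P Q' U where
  u := Hom.bs β (rr w)
  g k d h := ev (k ≫ w) (Hom.at' β (rr (k ≫ w)) d (by simp [h])) (by simp)
  nat _ _ _ _ := by simp
  g_t _ _ _ := by simp

@[simp] lemma wlW_u (β : Q ⟶ Q') (w : U ⟶ (P.comp Q).B) : (wlW β w).u = Hom.bs β (rr w) := rfl
@[simp] lemma wlW_g (β : Q ⟶ Q') (w : U ⟶ (P.comp Q).B) (k : V ⟶ U) (d : V ⟶ Q'.E)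
    (h : d ≫ Q'.f = k ≫ (wlW β w).u) : (wlW β w).g k d h =
      ev (k ≫ w) (Hom.at' β (rr (k ≫ w)) d (by rw [h]; simp)) (by simp) := rfl

/-- Whiskering on the left. -/
def wl (P : Diag X Y) (β : Q ⟶ Q') : Fam (P.comp Q) (P.comp Q') where
  b w := mkW (wlW β w)
  comp_b _ _ := W_ext (by simp) (by simp)
  b_t _ := by simp
  a x e h := tri x (Hom.at' β (rr x) (cd e) (by simp [h])) (ce e) (by simp) (by simp [h])
  comp_a _ _ _ _ := by simp
  a_f _ _ _ := by simp
  a_s _ _ _ := by simp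

/-- The whiskers as 2-cells. -/
def wrH (α : P ⟶ P') (Q : Diag Y Z) : P.comp Q ⟶ P'.comp Q := (wr α Q).toHom
def wlH (P : Diag X Y) (β : Q ⟶ Q') : P.comp Q ⟶ P.comp Q' := (wl P β).toHom
@[simp] lemma wrH_bs (α : P ⟶ P') (x : U ⟶ (P.comp Q).B) :
    Hom.bs (wrH α Q) x = mkW (wrW α x) := (wr α Q).toHom_bs x
@[simp] lemma wlH_bs (β : Q ⟶ Q') (x : U ⟶ (P.comp Q).B) :
    Hom.bs (wlH P β) x = mkW (wlW β x) := (wl P β).toHom_bs x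
@[simp] lemma wrH_at (α : P ⟶ P') (x : U ⟶ (P.comp Q).B) (e : U ⟶ (P'.comp Q).E)
    (h : e ≫ (P'.comp Q).f = Hom.bs (wrH α Q) x) : Hom.at' (wrH α Q) x e h =
      tri x (cd e) (Hom.at' α (ev x (cd e) (by simp [h])) (ce e) (by simp [h])) (by simp [h])
        (by simp) := (wr α Q).toHom_at x e h
@[simp] lemma wlH_at (β : Q ⟶ Q') (x : U ⟶ (P.comp Q).B) (e : U ⟶ (P.comp Q').E)
    (h : e ≫ (P.comp Q').f = Hom.bs (wlH P β) x) : Hom.at' (wlH P β) x e h =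
      tri x (Hom.at' β (rr x) (cd e) (by simp [h])) (ce e) (by simp) (by simp [h]) :=
  (wl P β).toHom_at x e h
end

section
variable {W X Y Z : C} {P : Diag W X} {Q : Diag X Y} {R : Diag Y Z} {U V : C}

/-- The action of the associator on the base. -/
def asW (w : U ⟶ ((P.comp Q).comp R).B) : WFam Q R U where
  u := rr w
  g k c h := rr (ev (k ≫ w) c (by simp [h]))
  nat _ _ _ _ := by simp
  g_t k c h := by rw [← comp_t, ev_t]
@[simp] lemma asW_u (w : U ⟶ ((P.comp Q).comp R).B) : (asW w).u = rr w := rfl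
@[simp] lemma asW_g (w : U ⟶ ((P.comp Q).comp R).B) (k : V ⟶ U) (c : V ⟶ R.E)
    (h : c ≫ R.f = k ≫ (asW w).u) : (asW w).g k c h = rr (ev (k ≫ w) c (by simp [h])) := rfl
@[simp] lemma comp_asW (k : V ⟶ U) (w : U ⟶ ((P.comp Q).comp R).B) :
    k ≫ mkW (asW w) = mkW (asW (k ≫ w)) := W_ext (by simp) (by simp)

def asW' (w : U ⟶ ((P.comp Q).comp R).B) : WFam P (Q.comp R) U where
  u := mkW (asW w)
  g k e h := ev (ev (k ≫ w) (cd e) (by simp [h])) (ce e) (by simp [h])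
  nat _ _ _ _ := by simp
  g_t _ _ _ := by simp
@[simp] lemma asW'_u (w : U ⟶ ((P.comp Q).comp R).B) : (asW' w).u = mkW (asW w) := rfl
@[simp] lemma asW'_g (w : U ⟶ ((P.comp Q).comp R).B) (k : V ⟶ U) (e : V ⟶ (Q.comp R).E)
    (h : e ≫ (Q.comp R).f = k ≫ (asW' w).u) : (asW' w).g k e h =
      ev (ev (k ≫ w) (cd e) (by simp [h])) (ce e) (by simp [h]) := rfl

/-- The associator. -/
def as (P : Diag W X) (Q : Diag X Y) (R : Diag Y Z) :
    Fam ((P.comp Q).comp R) (P.comp (Q.comp R)) where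
  b w := mkW (asW' w)
  comp_b _ _ := W_ext (by simp) (by simp)
  b_t _ := by simp
  a x e h := tri x (cd (cd e)) (tri (ev x (cd (cd e)) (by simp [h])) (ce (cd e)) (ce e)
    (by simp [h]) (by simp [h])) (by simp [h]) (by simp)
  comp_a _ _ _ _ := by simp
  a_f _ _ _ := by simp
  a_s _ _ _ := by simp

/-- The action of the inverse of the associator on the base. -/
def saW (z : V ⟶ (P.comp (Q.comp R)).B) (c : V ⟶ R.E) (h : c ≫ R.f = rr (rr z)) :
    WFam P Q V where
  u := ev (rr z) c h
  g j d h' := ev (j ≫ z) (tri (rr (j ≫ z)) (j ≫ c) d (by simp [h]) (by simp [h'])) (by simp)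
  nat _ _ _ _ := by simp
  g_t _ _ _ := by simp
@[simp] lemma saW_u (z : V ⟶ (P.comp (Q.comp R)).B) (c : V ⟶ R.E) (h : c ≫ R.f = rr (rr z)) :
    (saW z c h).u = ev (rr z) c h := rfl
@[simp] lemma saW_g (z : V ⟶ (P.comp (Q.comp R)).B) (c : V ⟶ R.E) (h : c ≫ R.f = rr (rr z))
    (j : U ⟶ V) (d : U ⟶ Q.E) (h' : d ≫ Q.f = j ≫ (saW z c h).u) : (saW z c h).g j d h' =
      ev (j ≫ z) (tri (rr (j ≫ z)) (j ≫ c) d (by simp [h]) (by simp [h'])) (by simp) := rfl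
@[simp] lemma comp_saW (k : U ⟶ V) (z : V ⟶ (P.comp (Q.comp R)).B) (c : V ⟶ R.E)
    (h : c ≫ R.f = rr (rr z)) :
    k ≫ mkW (saW z c h) = mkW (saW (k ≫ z) (k ≫ c) (by simp [h])) := W_ext (by simp) (by simp)

def saW' (y : U ⟶ (P.comp (Q.comp R)).B) : WFam (P.comp Q) R U where
  u := rr (rr y)
  g k c h := mkW (saW (k ≫ y) c (by simp [h]))
  nat _ _ _ _ := by simp
  g_t _ _ _ := by simp
@[simp] lemma saW'_u (y : U ⟶ (P.comp (Q.comp R)).B) : (saW' y).u = rr (rr y) := rfl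
@[simp] lemma saW'_g (y : U ⟶ (P.comp (Q.comp R)).B) (k : V ⟶ U) (c : V ⟶ R.E)
    (h : c ≫ R.f = k ≫ (saW' y).u) :
    (saW' y).g k c h = mkW (saW (k ≫ y) c (by simp [h])) := rfl

/-- The inverse of the associator. -/
def sa (P : Diag W X) (Q : Diag X Y) (R : Diag Y Z) :
    Fam (P.comp (Q.comp R)) ((P.comp Q).comp R) where
  b y := mkW (saW' y)
  comp_b _ _ := W_ext (by simp) (by simp)
  b_t _ := by simp
  a x e h := tri x (tri (rr x) (cd e) (cd (ce e)) (by simp [h]) (by simp [h])) (ce (ce e))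
    (by simp) (by simp [h])
  comp_a _ _ _ _ := by simp
  a_f _ _ _ := by simp
  a_s _ _ _ := by simp

def asH (P : Diag W X) (Q : Diag X Y) (R : Diag Y Z) :
    (P.comp Q).comp R ⟶ P.comp (Q.comp R) := (as P Q R).toHom
def saH (P : Diag W X) (Q : Diag X Y) (R : Diag Y Z) :
    P.comp (Q.comp R) ⟶ (P.comp Q).comp R := (sa P Q R).toHom
@[simp] lemma asH_bs (x : U ⟶ ((P.comp Q).comp R).B) : Hom.bs (asH P Q R) x = mkW (asW' x) :=
  (as P Q R).toHom_bs x
@[simp] lemma saH_bs (x : U ⟶ (P.comp (Q.comp R)).B) : Hom.bs (saH P Q R) x = mkW (saW' x) :=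
  (sa P Q R).toHom_bs x
@[simp] lemma asH_at (x : U ⟶ ((P.comp Q).comp R).B) (e : U ⟶ (P.comp (Q.comp R)).E)
    (h : e ≫ (P.comp (Q.comp R)).f = Hom.bs (asH P Q R) x) : Hom.at' (asH P Q R) x e h =
      tri x (cd (cd e)) (tri (ev x (cd (cd e)) (by simp [h])) (ce (cd e)) (ce e)
        (by simp [h]) (by simp [h])) (by simp [h]) (by simp) := (as P Q R).toHom_at x e h
@[simp] lemma saH_at (x : U ⟶ (P.comp (Q.comp R)).B) (e : U ⟶ ((P.comp Q).comp R).E)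
    (h : e ≫ ((P.comp Q).comp R).f = Hom.bs (saH P Q R) x) : Hom.at' (saH P Q R) x e h =
      tri x (tri (rr x) (cd e) (cd (ce e)) (by simp [h]) (by simp [h])) (ce (ce e))
        (by simp) (by simp [h]) := (sa P Q R).toHom_at x e h

lemma as_sa : asH P Q R ≫ saH P Q R = 𝟙 _ := hom_ext
  (fun x => by simpa using W_ext (by simp) (fun k d h h' => W_ext (by simp) (by simp)))
  (fun x e h h' => by
    have h₂ : e ≫ ((P.comp Q).comp R).f = x := by simpa using h'
    simp [h₂])
@[simp] lemma asW_saW' (x : U ⟶ (P.comp (Q.comp R)).B) : mkW (asW (mkW (saW' x))) = rr x :=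
  W_ext (by simp) (by simp)
lemma sa_as : saH P Q R ≫ asH P Q R = 𝟙 _ := hom_ext
  (fun x => by
    refine (comp_bs _ _ _).trans (Eq.trans ?_ (id_bs _).symm)
    rw [saH_bs, asH_bs]
    refine W_ext (by simp) fun k d h h' => ?_
    have h₂ : d ≫ (Q.comp R).f = rr (k ≫ x) := by simpa using h'
    simp [h₂])
  (fun x e h h' => by
    have h₂ : e ≫ (P.comp (Q.comp R)).f = x := by simpa using h'
    simp [h₂])

@[simps] def asI (P : Diag W X) (Q : Diag X Y) (R : Diag Y Z) :
    (P.comp Q).comp R ≅ P.comp (Q.comp R) := ⟨asH P Q R, saH P Q R, as_sa, sa_as⟩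
end
end CategoryTheory.Diag

end

noncomputable section

namespace CategoryTheory.Diag
variable {C : Type u} [Category.{v} C] [HasPullbacks C]
section
variable {X Y U V : C} {P : Diag X Y}

/-- Generalized elements of the identity polynomial. -/
def oB (x : U ⟶ X) : U ⟶ (one X).B := x
def oE (x : U ⟶ X) : U ⟶ (one X).E := x
@[simp] lemma oE_f (x : U ⟶ X) : oE x ≫ (one X).f = oB x := Category.comp_id _
@[simp] lemma oE_s (x : U ⟶ X) : oE x ≫ (one X).s = x := Category.comp_id _
@[simp] lemma oB_t (x : U ⟶ X) : oB x ≫ (one X).t = x := Category.comp_id _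
@[simp] lemma comp_oE (k : V ⟶ U) (x : U ⟶ X) : k ≫ oE x = oE (k ≫ x) := rfl
@[simp] lemma comp_oB (k : V ⟶ U) (x : U ⟶ X) : k ≫ oB x = oB (k ≫ x) := rfl
@[simp] lemma oB_eta (b : U ⟶ (one X).B) : oB (b ≫ (one X).t) = b := Category.comp_id _
lemma one_eq {d : U ⟶ (one X).E} {b : U ⟶ (one X).B} (h : d ≫ (one X).f = b) :
    d = oE (b ≫ (one X).t) := by
  subst h
  exact ((Category.comp_id _).trans (Category.comp_id _)).symm

@[simp] lemma ev_one (w : U ⟶ ((one X).comp P).B) (d : U ⟶ P.E) (h : d ≫ P.f = rr w) :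
    ev w d h = oB (d ≫ P.s) := by rw [← ev_t w d h, oB_eta]
@[simp] lemma ce_one (y : U ⟶ ((one X).comp P).E) : ce y = oE (cd y ≫ P.s) := by
  rw [one_eq (ce_f y), ev_t]
@[simp] lemma cd_one (y : U ⟶ (P.comp (one Y)).E) :
    cd y = oE (rr (y ≫ (P.comp (one Y)).f) ≫ (one Y).t) := one_eq (cd_f y)

/-- The left unitor and its inverse. -/
def lu (P : Diag X Y) : Fam ((one X).comp P) P where
  b w := rr w
  comp_b _ _ := by simp
  b_t _ := by simp
  a x e h := tri x e (oE (e ≫ P.s)) h (by simp)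
  comp_a _ _ _ _ := by simp
  a_f _ _ _ := by simp
  a_s _ _ _ := by simp
def ulW (x : U ⟶ P.B) : WFam (one X) P U where
  u := x
  g k d h := oB (d ≫ P.s)
  nat _ _ _ _ := by simp
  g_t _ _ _ := by simp
@[simp] lemma ulW_u (x : U ⟶ P.B) : (ulW x).u = x := rfl
@[simp] lemma ulW_g (x : U ⟶ P.B) (k : V ⟶ U) (d : V ⟶ P.E) (h : d ≫ P.f = k ≫ (ulW x).u) :
    (ulW x).g k d h = oB (d ≫ P.s) := rfl
def ul (P : Diag X Y) : Fam P ((one X).comp P) where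
  b x := mkW (ulW x)
  comp_b _ _ := W_ext (by simp) (by simp)
  b_t _ := by simp
  a x e h := cd e
  comp_a _ _ _ _ := by simp
  a_f _ _ _ := by simp_all
  a_s _ _ _ := by simp

/-- The right unitor and its inverse. -/
def ru (P : Diag X Y) : Fam (P.comp (one Y)) P where
  b w := ev w (oE (rr w ≫ (one Y).t)) (by simp)
  comp_b _ _ := by simp [← Category.assoc]
  b_t _ := by simp
  a x e h := tri x (oE (rr x ≫ (one Y).t)) e (by simp) h
  comp_a _ _ _ _ := by simp [← Category.assoc]
  a_f _ _ _ := by simp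
  a_s _ _ _ := by simp
def urW (x : U ⟶ P.B) : WFam P (one Y) U where
  u := oB (x ≫ P.t)
  g k d h := k ≫ x
  nat _ _ _ _ := by simp
  g_t k d h := by rw [one_eq h]; simp
@[simp] lemma urW_u (x : U ⟶ P.B) : (urW x).u = oB (x ≫ P.t) := rfl
@[simp] lemma urW_g (x : U ⟶ P.B) (k : V ⟶ U) (d : V ⟶ (one Y).E)
    (h : d ≫ (one Y).f = k ≫ (urW x).u) : (urW x).g k d h = k ≫ x := rfl
def ur (P : Diag X Y) : Fam P (P.comp (one Y)) where
  b x := mkW (urW x)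
  comp_b _ _ := W_ext (by simp) (by simp)
  b_t _ := by simp
  a x e h := ce e
  comp_a _ _ _ _ := by simp
  a_f _ _ _ := by simp_all
  a_s _ _ _ := by simp

def luH (P : Diag X Y) : (one X).comp P ⟶ P := (lu P).toHom
def ulH (P : Diag X Y) : P ⟶ (one X).comp P := (ul P).toHom
def ruH (P : Diag X Y) : P.comp (one Y) ⟶ P := (ru P).toHom
def urH (P : Diag X Y) : P ⟶ P.comp (one Y) := (ur P).toHom
@[simp] lemma luH_bs (x : U ⟶ ((one X).comp P).B) : Hom.bs (luH P) x = rr x := (lu P).toHom_bs x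
@[simp] lemma ulH_bs (x : U ⟶ P.B) : Hom.bs (ulH P) x = mkW (ulW x) := (ul P).toHom_bs x
@[simp] lemma ruH_bs (x : U ⟶ (P.comp (one Y)).B) :
    Hom.bs (ruH P) x = ev x (oE (rr x ≫ (one Y).t)) (by simp) := (ru P).toHom_bs x
@[simp] lemma urH_bs (x : U ⟶ P.B) : Hom.bs (urH P) x = mkW (urW x) := (ur P).toHom_bs x
@[simp] lemma luH_at (x : U ⟶ ((one X).comp P).B) (e : U ⟶ P.E)
    (h : e ≫ P.f = Hom.bs (luH P) x) :
    Hom.at' (luH P) x e h = tri x e (oE (e ≫ P.s)) (by simp [h]) (by simp) :=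
  (lu P).toHom_at x e h
@[simp] lemma ulH_at (x : U ⟶ P.B) (e : U ⟶ ((one X).comp P).E)
    (h : e ≫ ((one X).comp P).f = Hom.bs (ulH P) x) : Hom.at' (ulH P) x e h = cd e :=
  (ul P).toHom_at x e h
@[simp] lemma ruH_at (x : U ⟶ (P.comp (one Y)).B) (e : U ⟶ P.E)
    (h : e ≫ P.f = Hom.bs (ruH P) x) : Hom.at' (ruH P) x e h =
      tri x (oE (rr x ≫ (one Y).t)) e (by simp) (by simp [h]) := (ru P).toHom_at x e h
@[simp] lemma urH_at (x : U ⟶ P.B) (e : U ⟶ (P.comp (one Y)).E)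
    (h : e ≫ (P.comp (one Y)).f = Hom.bs (urH P) x) : Hom.at' (urH P) x e h = ce e :=
  (ur P).toHom_at x e h

@[simps] def luI (P : Diag X Y) : (one X).comp P ≅ P where
  hom := luH P
  inv := ulH P
  hom_inv_id := hom_ext
    (fun x => by simpa using W_ext (by simp) (by simp))
    (fun x e h h' => by
      have h₂ : e ≫ ((one X).comp P).f = x := by simpa using h'
      exact E_ext (by simp [h₂]) (by simp) (by simp))
  inv_hom_id := hom_ext (by simp) (by simp)
@[simps] def ruI (P : Diag X Y) : P.comp (one Y) ≅ P where
  hom := ruH P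
  inv := urH P
  hom_inv_id := hom_ext
    (fun x => by
      simpa using W_ext (by simp) fun k d h h' => by
        obtain rfl := one_eq h'
        simp [← Category.assoc])
    (fun x e h h' => by
      have h₂ : e ≫ (P.comp (one Y)).f = x := by simpa using h'
      exact E_ext (by simp [h₂]) (by simp [h₂]) (by simp))
  inv_hom_id := hom_ext (by simp) (by simp)
end
end CategoryTheory.Diag

end

noncomputable section

namespace CategoryTheory
variable {C : Type u} [Category.{v} C] [HasPullbacks C]
namespace Diag
variable {A B X Y Z : C}

lemma wl_id (P : Diag X Y) (Q : Diag Y Z) : wlH P (𝟙 Q) = 𝟙 (P.comp Q) := hom_ext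
  (fun x => by simpa using W_ext (by simp) (by simp))
  (fun x e h h' => by
    have h₂ : e ≫ (P.comp Q).f = x := by simpa using h'
    simp [h₂])
lemma wl_comp (P : Diag X Y) {Q Q' Q'' : Diag Y Z} (β : Q ⟶ Q') (γ : Q' ⟶ Q'') :
    wlH P (β ≫ γ) = wlH P β ≫ wlH P γ := hom_ext
  (fun x => by simpa using W_ext (by simp) (by simp)) (fun x e h h' => by simp)
lemma id_wr (P : Diag X Y) (Q : Diag Y Z) : wrH (𝟙 P) Q = 𝟙 (P.comp Q) := hom_ext
  (fun x => by simpa using W_ext (by simp) (by simp))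
  (fun x e h h' => by
    have h₂ : e ≫ (P.comp Q).f = x := by simpa using h'
    simp [h₂])
lemma comp_wr {P P' P'' : Diag X Y} (α : P ⟶ P') (γ : P' ⟶ P'') (Q : Diag Y Z) :
    wrH (α ≫ γ) Q = wrH α Q ≫ wrH γ Q := hom_ext
  (fun x => by simpa using W_ext (by simp) (by simp)) (fun x e h h' => by simp)
lemma exch {P P' : Diag X Y} {Q Q' : Diag Y Z} (α : P ⟶ P') (β : Q ⟶ Q') :
    wlH P β ≫ wrH α Q' = wrH α Q ≫ wlH P' β := hom_ext
  (fun x => by simpa using W_ext (by simp) (by simp)) (fun x e h h' => by simp)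
lemma one_wl {P P' : Diag X Y} (α : P ⟶ P') :
    wlH (one X) α = luH P ≫ α ≫ ulH P' := hom_ext
  (fun x => by simpa using W_ext (by simp) (by simp)) (fun x e h h' => by simp)
lemma wr_one {P P' : Diag X Y} (α : P ⟶ P') :
    wrH α (one Y) = ruH P ≫ α ≫ urH P' := hom_ext
  (fun x => by
    refine (wrH_bs _ _).trans (W_ext (by simp) fun k d h h' => ?_)
    have h₂ : d ≫ (one Y).f = rr (k ≫ x) := by simpa using h
    obtain rfl := one_eq h₂
    simp [← Category.assoc])
  (fun x e h h' => by simp [h])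
lemma comp_wl (P : Diag A X) (Q : Diag X Y) {R R' : Diag Y Z} (α : R ⟶ R') :
    wlH (P.comp Q) α = asH P Q R ≫ wlH P (wlH Q α) ≫ saH P Q R' := hom_ext
  (fun x => by
    simpa using W_ext (by simp) fun k d h h' => by simpa using W_ext (by simp) (by simp))
  (fun x e h h' => by simp [h])
lemma wr_comp {P P' : Diag A X} (α : P ⟶ P') (Q : Diag X Y) (R : Diag Y Z) :
    wrH α (Q.comp R) = saH P Q R ≫ wrH (wrH α Q) R ≫ asH P' Q R := hom_ext
  (fun x => by
    have h₁ : rr x = mkW (asW (mkW (wrW (wrH α Q) (mkW (saW' (R := R) x))))) :=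
      W_ext (by simp) (by simp)
    refine (wrH_bs _ _).trans (Eq.trans (W_ext (by simpa using h₁) fun k d h h' => ?_)
      (by simp : mkW (asW' (mkW (wrW (wrH α Q) (mkW (saW' x))))) = _))
    have h₂ : d ≫ (Q.comp R).f = rr (k ≫ x) := by simpa using h
    simp [h₂])
  (fun x e h h' => by simp [h])
lemma wr_assoc (P : Diag A X) {Q Q' : Diag X Y} (α : Q ⟶ Q') (R : Diag Y Z) :
    wrH (wlH P α) R = asH P Q R ≫ wlH P (wrH α R) ≫ saH P Q' R := hom_ext
  (fun x => by
    simpa using W_ext (by simp) fun k d h h' => by simpa using W_ext (by simp) (by simp))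
  (fun x e h h' => by simp)
lemma pent (P : Diag A B) (Q : Diag B X) (R : Diag X Y) (S : Diag Y Z) :
    wrH (asH P Q R) S ≫ asH P (Q.comp R) S ≫ wlH P (asH Q R S) =
      asH (P.comp Q) R S ≫ asH P Q (R.comp S) := hom_ext
  (fun x => by
    have h₁ : mkW (asW' (mkW (asW (mkW (wrW (P.asH Q R) x))))) = mkW (asW (mkW (asW' x))) :=
      W_ext (W_ext (by simp) (by simp)) (by simp)
    simpa using W_ext (by simpa using h₁) (by simp))
  (fun x e h h' => by simp)
@[simp] lemma rr_ev_t (P : Diag A X) (Q : Diag X Y) (R : Diag Y Z) {U : C}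
    (x : U ⟶ ((P.comp Q).comp R).B) (d : U ⟶ R.E) (h : d ≫ R.f = rr x) :
    rr (ev x d h) ≫ Q.t = d ≫ R.s := by rw [← comp_t, ev_t]
lemma tria (P : Diag X Y) (Q : Diag Y Z) :
    asH P (one Y) Q ≫ wlH P (luH Q) = wrH (ruH P) Q := hom_ext
  (fun x => by simpa using W_ext (by simp) (by simp)) (fun x e h h' => by simp)
end Diag

/-- The bicategory of polynomials in `C`: 1-cells `X ⟶ Y` are polynomials `X ← E → B → Y`. -/
instance : Bicategory (CPoly C) where
  Hom X Y := Diag X.obj Y.obj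
  id X := Diag.one X.obj
  comp P Q := Diag.comp P Q
  whiskerLeft P _ _ β := Diag.wlH P β
  whiskerRight α Q := Diag.wrH α Q
  associator P Q R := Diag.asI P Q R
  leftUnitor P := Diag.luI P
  rightUnitor P := Diag.ruI P
  whiskerLeft_id := Diag.wl_id
  whiskerLeft_comp P _ _ _ β γ := Diag.wl_comp P β γ
  id_whiskerLeft α := Diag.one_wl α
  comp_whiskerLeft P Q _ _ α := Diag.comp_wl P Q α
  id_whiskerRight := Diag.id_wr
  comp_whiskerRight α γ Q := Diag.comp_wr α γ Q
  whiskerRight_id α := Diag.wr_one α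
  whiskerRight_comp α Q R := Diag.wr_comp α Q R
  whisker_assoc P _ _ α R := Diag.wr_assoc P α R
  whisker_exchange α β := Diag.exch α β
  pentagon P Q R S := Diag.pent P Q R S
  triangle P Q := Diag.tria P Q
end CategoryTheory

end

noncomputable section

namespace CategoryTheory
variable {C : Type u} [Category.{v} C] [HasPullbacks C]
namespace Diag
variable {X Y Z : C}

/-- A 2-cell of polynomials is cartesian when its map of fibres is invertible. -/
def Cart {P Q : Diag X Y} (α : P ⟶ Q) : Prop := IsIso (Hom.fib α)

/-- Being cartesian, on generalized elements. -/
structure Cart' {P Q : Diag X Y} (α : P ⟶ Q) : Prop where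
  surj : ∀ {U : C} (x : U ⟶ P.B) (e : U ⟶ P.E), e ≫ P.f = x →
    ∃ (d : U ⟶ Q.E) (h : d ≫ Q.f = Hom.bs α x), Hom.at' α x d h = e
  inj : ∀ {U : C} (x : U ⟶ P.B) (d d' : U ⟶ Q.E) (h : d ≫ Q.f = Hom.bs α x)
    (h' : d' ≫ Q.f = Hom.bs α x), Hom.at' α x d h = Hom.at' α x d' h' → d = d'

section
variable {P Q : Diag X Y} (α : P ⟶ Q) {U : C} (x : U ⟶ P.B) (d : U ⟶ Q.E)
  (h : d ≫ Q.f = Hom.bs α x)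

/-- The generalized element of the pullback along the map of bases with given components. -/
def lf : U ⟶ pullback (Hom.base α) Q.f :=
  pullback.lift x d (show x ≫ Hom.base α = d ≫ Q.f from h.symm)
lemma lf_fst : lf α x d h ≫ pullback.fst _ _ = x := pullback.lift_fst _ _ _
lemma lf_snd : lf α x d h ≫ pullback.snd _ _ = d := pullback.lift_snd _ _ _
lemma lf_fib : lf α x d h ≫ Hom.fib α = Hom.at' α x d h := rfl
end

lemma cart_iff {P Q : Diag X Y} (α : P ⟶ Q) : Cart α ↔ Cart' α := by
  constructor
  · intro hα
    have : IsIso (Hom.fib α) := hα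
    constructor
    · rintro U _ e rfl
      have h₁ : inv (Hom.fib α) ≫ pullback.fst (Hom.base α) Q.f = P.f := by
        rw [IsIso.inv_comp_eq, Hom.fib_f]
      have h₀ : (e ≫ inv (Hom.fib α) ≫ pullback.snd _ _) ≫ Q.f = Hom.bs α (e ≫ P.f) := by
        simp only [Category.assoc, Hom.bs, ← pullback.condition, reassoc_of% h₁]
      refine ⟨e ≫ inv (Hom.fib α) ≫ pullback.snd _ _, h₀, ?_⟩
      have : lf α _ _ h₀ = e ≫ inv (Hom.fib α) := by
        apply pullback.hom_ext
        · rw [lf_fst, Category.assoc, h₁]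
        · rw [lf_snd, Category.assoc]
      rw [← lf_fib, this, Category.assoc, IsIso.inv_hom_id, Category.comp_id]
    · intro U x d d' h h' H
      have H' : lf α x d h = lf α x d' h' := (cancel_mono (Hom.fib α)).1 H
      rw [← lf_snd α x d h, H', lf_snd]
  · intro hα
    obtain ⟨d, h, hd⟩ := hα.surj P.f (𝟙 _) (Category.id_comp _)
    refine ⟨lf α P.f d h, ?_, hd⟩
    apply pullback.hom_ext
    · rw [Category.assoc, lf_fst, Hom.fib_f, Category.id_comp]
    · rw [Category.assoc, lf_snd, Category.id_comp]
      have hc : pullback.snd (Hom.base α) Q.f ≫ Q.f = Hom.bs α (pullback.fst (Hom.base α) Q.f) :=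
        pullback.condition.symm
      have h₁ : (Hom.fib α ≫ d) ≫ Q.f = Hom.bs α (pullback.fst (Hom.base α) Q.f) := by
        rw [Category.assoc, h, Hom.comp_bs, Hom.fib_f]
      refine hα.inj _ _ _ h₁ hc ?_
      have e₁ : Hom.at' α (pullback.fst (Hom.base α) Q.f) (pullback.snd (Hom.base α) Q.f) hc =
          Hom.fib α := by
        have : lf α (pullback.fst (Hom.base α) Q.f) (pullback.snd _ _) hc = 𝟙 _ := by
          apply pullback.hom_ext
          · rw [lf_fst, Category.id_comp]
          · rw [lf_snd, Category.id_comp]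
        rw [← lf_fib, this, Category.id_comp]
      rw [e₁]
      have e₂ := congrArg (Hom.fib α ≫ ·) hd
      simp only [Hom.comp_at, Category.comp_id, Hom.fib_f] at e₂
      exact e₂

lemma Cart.comp {P Q R : Diag X Y} {α : P ⟶ Q} {β : Q ⟶ R} (hα : Cart α) (hβ : Cart β) :
    Cart (α ≫ β) := by
  rw [cart_iff] at hα hβ ⊢
  constructor
  · intro U x e he
    obtain ⟨d, h, rfl⟩ := hα.surj x e he
    obtain ⟨c, h', rfl⟩ := hβ.surj _ d h
    exact ⟨c, by simp [h'], by simp⟩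
  · intro U x d d' h h' H
    rw [comp_at, comp_at] at H
    exact hβ.inj _ _ _ _ _ (hα.inj _ _ _ _ _ H)

lemma Cart.of_iso {P Q : Diag X Y} (i : P ≅ Q) : Cart i.hom := by
  have hb : ∀ {U : C} (x : U ⟶ P.B), Hom.bs i.inv (Hom.bs i.hom x) = x := by
    intro U x
    rw [← comp_bs, i.hom_inv_id, id_bs]
  have key : ∀ {P : Diag X Y} {a b : P ⟶ P} (_ : a = b) {U : C} (x : U ⟶ P.B) (e : U ⟶ P.E) (h)
      (h'), Hom.at' a x e h = Hom.at' b x e h' := by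
    rintro P a _ rfl U x e h h'
    rfl
  rw [cart_iff]
  constructor
  · intro U x e he
    refine ⟨Hom.at' i.inv (Hom.bs i.hom x) e (by rw [he, hb]), by simp, ?_⟩
    have := key i.hom_inv_id x e (by rw [comp_bs, hb, he]) (by rw [id_bs, he])
    rwa [comp_at, id_at] at this
  · intro U x d d' h h' H
    have := fun d (h : d ≫ Q.f = Hom.bs i.hom x) => key i.inv_hom_id (Hom.bs i.hom x) d (by simp [hb, h]) (by simp [h])
    simp only [comp_at, id_at, hb] at this
    rw [← this d h, ← this d' h']
    congr 1

lemma Cart.wl (P : Diag X Y) {Q Q' : Diag Y Z} {β : Q ⟶ Q'} (hβ : Cart β) :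
    Cart (wlH P β) := by
  rw [cart_iff] at hβ ⊢
  constructor
  · intro U x e he
    obtain ⟨d, h, hd⟩ := hβ.surj (rr x) (cd e) (by simp [he])
    exact ⟨tri (mkW (wlW β x)) d (ce e) (by simp [h]) (by simp [hd, he]), by simp,
      by simp [hd, he]⟩
  · intro U x d d' h h' H
    rw [wlH_at, wlH_at] at H
    refine E_ext (h.trans h'.symm) (hβ.inj (rr x) _ _ (by simp [h]) (by simp [h']) ?_) ?_
    · simpa using congrArg cd H
    · simpa using congrArg ce H

lemma Cart.wr {P P' : Diag X Y} {α : P ⟶ P'} (Q : Diag Y Z) (hα : Cart α) :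
    Cart (wrH α Q) := by
  rw [cart_iff] at hα ⊢
  constructor
  · intro U x e he
    obtain ⟨d, h, hd⟩ := hα.surj (ev x (cd e) (by simp [he])) (ce e) (by simp [he])
    exact ⟨tri (mkW (wrW α x)) (cd e) d (by simp [he]) (by simp [h]), by simp,
      by simp [hd, he]⟩
  · intro U x d d' h h' H
    rw [wrH_at, wrH_at] at H
    have hd : cd d = cd d' := by simpa using congrArg cd H
    refine E_ext (h.trans h'.symm) hd (hα.inj (ev x (cd d) (by simp [h])) _ _ (by simp [h])
      (by simp [h', hd]) ?_)
    have := congrArg ce H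
    simp only [ce_tri] at this
    rw [this]
    congr 1
    simp [hd]
end Diag

/-- The class of cartesian 2-cells of polynomials. -/
def cart (C : Type u) [Category.{v} C] [HasPullbacks C] : CellClass (CPoly C) where
  prop α := Diag.Cart α
  comp hα hβ := Diag.Cart.comp hα hβ
  iso i := Diag.Cart.of_iso ⟨i.hom, i.inv, i.hom_inv_id, i.inv_hom_id⟩
  wl P _ _ _ hβ := Diag.Cart.wl P hβ
  wr Q hα := Diag.Cart.wr Q hα

/-- The sub-bicategory of cartesian 2-cells of polynomials. -/
abbrev CPolyCart (C : Type u) [Category.{v} C] [HasPullbacks C] := (cart C).Sub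
end CategoryTheory

end

/-! ### Biequivalences from local equivalences -/

noncomputable section

namespace CategoryTheory.Bicategory

/-! Read a span `K ← A → Z` as a family indexed by pairs `(k, z)`. Two computations identify the
notions of the statement in `Spn C`.

A span is a groupoid fibration exactly when its left leg is invertible, so that it is essentially a
morphism of `C` (`Spn.gf_iff`). The right lifting of `x : K ⟶ Z` through `n`, with legs `Y ← A → Z`,
should have as elements over `(k, y)` the functions sending each `a` in the fibre `A_y` to an
element of `x` over `(k, n.r a)`. Such an object is a dependent product along a pullback of `n.l`,
so it exists when `n.l` is powerful (`Spn.IsRightLifter.of_powerful`). Conversely, dependent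
products along `n.l` are cut out of right liftings as the functions that are sections
(`Spn.IsRightLifter.powerful`).

Take `p : S ⟶ Y` with invertible left leg and `n : T ⟶ Y` with legs `T ← A → Y`. An isomorphism `a ≫
n ≅ b ≫ p` determines `b` up to isomorphism from `a` and a map over `Y` from the apex of `a ≫ n` to
`S`. Such maps correspond to maps over `T` from the apex of `a` to the dependent product along `n.l`
of `A ×_Y S`. This dependent product is therefore the vertex of a bipullback
(`Spn.exists_isBipullback`), its projection to `T` is a morphism of `C`, and `Spn C` is polynomic.

Hence a polynomial in `Spn C` amounts to a diagram `X ← E → B → Y` with powerful middle map. To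
compare 2-cells, composites and coherence without unfolding chosen bipullbacks, polynomials are
studied through their effect on spans `x : K ⟶ X`: right lifting through the left leg, then
composition with the right leg. Effects are faithful on 2-cells, and every family natural in `x` and
compatible with change of `K` is the effect of a 2-cell. For a diagram, an element of the effect is
a point of `K`, an element `b` of `B`, and a function from the fibre `E_b` to `x` (`Diag.X_ext`,
`Diag.exists_mkX`). A 2-cell of diagrams acts by its map of bases on `b` and by precomposition with
its map of fibres on the function. Applying an arbitrary 2-cell to the generic element recovers such
a pair of maps, which gives fullness. The effect of a composite is the composite of the effects by
currying (`Diag.ph`), and each coherence law becomes a computation with elements.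

The comparison of hom-categories naturally runs from diagrams to polynomials in spans, against the
direction chosen for the biequivalence; `PseudoOver` turns it round by taking preimages. For the
second biequivalence, the left 2-cell of the polynomial morphism attached to a 2-cell of diagrams
has the map of fibres as its map of apices, so strong corresponds to cartesian
(`Diag.strong_mapPoly_iff`). -/

/-- Coherent local equivalences from the hom-categories of `B'` to those of `B`, along a map of
objects from `B` to `B'`. -/
structure PseudoOver (B B' : Type*) [Bicategory B] [Bicategory B'] where
  o : B → B'
  L : ∀ X Y : B, (o X ⟶ o Y) ⥤ (X ⟶ Y)
  equiv : ∀ X Y, (L X Y).IsEquivalence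
  mapId : ∀ X : B, (L X X).obj (𝟙 (o X)) ≅ 𝟙 X
  mapComp : ∀ {X Y Z : B} (f : o X ⟶ o Y) (g : o Y ⟶ o Z),
    (L X Z).obj (f ≫ g) ≅ (L X Y).obj f ≫ (L Y Z).obj g
  whiskerLeft : ∀ {X Y Z : B} (f : o X ⟶ o Y) {g g' : o Y ⟶ o Z} (β : g ⟶ g'),
    (L X Z).map (f ◁ β) ≫ (mapComp f g').hom = (mapComp f g).hom ≫ (L X Y).obj f ◁ (L Y Z).map β
  whiskerRight : ∀ {X Y Z : B} {f f' : o X ⟶ o Y} (α : f ⟶ f') (g : o Y ⟶ o Z),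
    (L X Z).map (α ▷ g) ≫ (mapComp f' g).hom = (mapComp f g).hom ≫ (L X Y).map α ▷ (L Y Z).obj g
  associator : ∀ {W X Y Z : B} (f : o W ⟶ o X) (g : o X ⟶ o Y) (k : o Y ⟶ o Z),
    (L W Z).map (α_ f g k).hom ≫ (mapComp f (g ≫ k)).hom ≫ (L W X).obj f ◁ (mapComp g k).hom =
      (mapComp (f ≫ g) k).hom ≫ (mapComp f g).hom ▷ (L Y Z).obj k ≫ (α_ _ _ _).hom
  leftUnitor : ∀ {X Y : B} (f : o X ⟶ o Y), (L X Y).map (λ_ f).hom =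
    (mapComp (𝟙 (o X)) f).hom ≫ (mapId X).hom ▷ (L X Y).obj f ≫ (λ_ _).hom
  rightUnitor : ∀ {X Y : B} (f : o X ⟶ o Y), (L X Y).map (ρ_ f).hom =
    (mapComp f (𝟙 (o Y))).hom ≫ (L X Y).obj f ◁ (mapId Y).hom ≫ (ρ_ _).hom

namespace PseudoOver
variable {B B' : Type*} [Bicategory B] [Bicategory B'] (G : PseudoOver B B')

attribute [instance] PseudoOver.equiv

/-- A preimage of a 1-cell. -/
def pre {X Y : B} (f : X ⟶ Y) : G.o X ⟶ G.o Y := (G.L X Y).objPreimage f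

def preIso {X Y : B} (f : X ⟶ Y) : (G.L X Y).obj (G.pre f) ≅ f := (G.L X Y).objObjPreimageIso f

def pre₂ {X Y : B} {f g : X ⟶ Y} (α : f ⟶ g) : G.pre f ⟶ G.pre g :=
  (G.L X Y).preimage ((G.preIso f).hom ≫ α ≫ (G.preIso g).inv)

@[simp] lemma map_pre₂ {X Y : B} {f g : X ⟶ Y} (α : f ⟶ g) :
    (G.L X Y).map (G.pre₂ α) = (G.preIso f).hom ≫ α ≫ (G.preIso g).inv := (G.L X Y).map_preimage _

def preId (X : B) : G.pre (𝟙 X) ≅ 𝟙 (G.o X) :=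
  (G.L X X).preimageIso (G.preIso (𝟙 X) ≪≫ (G.mapId X).symm)

/-- Reflected along the fully faithful `L` from the chain that replaces first `f`, then `g`, by the
image of its preimage. The order is a convention; the exchange law accounts for it in the coherence
proofs. -/
def preComp {X Y Z : B} (f : X ⟶ Y) (g : Y ⟶ Z) : G.pre (f ≫ g) ≅ G.pre f ≫ G.pre g :=
  (G.L X Z).preimageIso (G.preIso (f ≫ g) ≪≫ (whiskerRightIso (G.preIso f) g).symm ≪≫
    (whiskerLeftIso _ (G.preIso g)).symm ≪≫ (G.mapComp _ _).symm)

@[simp] lemma map_preId (X : B) : (G.L X X).map (G.preId X).hom =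
    (G.preIso (𝟙 X)).hom ≫ (G.mapId X).inv := by simp [preId]

@[simp] lemma map_preComp {X Y Z : B} (f : X ⟶ Y) (g : Y ⟶ Z) :
    (G.L X Z).map (G.preComp f g).hom = (G.preIso (f ≫ g)).hom ≫ (G.preIso f).inv ▷ g ≫
      (G.L X Y).obj (G.pre f) ◁ (G.preIso g).inv ≫ (G.mapComp _ _).inv := by simp [preComp]

@[simp] lemma map_preComp_inv {X Y Z : B} (f : X ⟶ Y) (g : Y ⟶ Z) :
    (G.L X Z).map (G.preComp f g).inv = (G.mapComp _ _).hom ≫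
      (G.L X Y).obj (G.pre f) ◁ (G.preIso g).hom ≫ (G.preIso f).hom ▷ g ≫ (G.preIso (f ≫ g)).inv := by
  simp [preComp]

/-- The axioms of `PseudoOver` solved for the values of `L`. Since `L` is faithful, each law of the
pseudofunctor can then be checked in `B`, where the cells `mapComp` cancel and only the `preIso`
remain. -/
lemma map_whiskerLeft {X Y Z : B} (f : G.o X ⟶ G.o Y) {g g' : G.o Y ⟶ G.o Z} (β : g ⟶ g') :
    (G.L X Z).map (f ◁ β) =
      (G.mapComp f g).hom ≫ (G.L X Y).obj f ◁ (G.L Y Z).map β ≫ (G.mapComp f g').inv := by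
  rw [← Category.assoc, ← G.whiskerLeft, Category.assoc, Iso.hom_inv_id, Category.comp_id]

lemma map_whiskerRight {X Y Z : B} {f f' : G.o X ⟶ G.o Y} (α : f ⟶ f') (g : G.o Y ⟶ G.o Z) :
    (G.L X Z).map (α ▷ g) =
      (G.mapComp f g).hom ≫ (G.L X Y).map α ▷ (G.L Y Z).obj g ≫ (G.mapComp f' g).inv := by
  rw [← Category.assoc, ← G.whiskerRight, Category.assoc, Iso.hom_inv_id, Category.comp_id]

lemma map_associator {W X Y Z : B} (f : G.o W ⟶ G.o X) (g : G.o X ⟶ G.o Y) (k : G.o Y ⟶ G.o Z) :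
    (G.L W Z).map (α_ f g k).hom = (G.mapComp (f ≫ g) k).hom ≫
      (G.mapComp f g).hom ▷ (G.L Y Z).obj k ≫ (α_ _ _ _).hom ≫
      (G.L W X).obj f ◁ (G.mapComp g k).inv ≫ (G.mapComp f (g ≫ k)).inv := by
  have := congrArg (· ≫ (G.L W X).obj f ◁ (G.mapComp g k).inv ≫ (G.mapComp f (g ≫ k)).inv)
    (G.associator f g k)
  simpa using this

/-- The pseudofunctor of preimages. -/
def toPseudofunctor : Pseudofunctor B B' where
  obj := G.o
  map f := G.pre f
  map₂ α := G.pre₂ α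
  map₂_id f := (G.L _ _).map_injective (by simp)
  map₂_comp f g := (G.L _ _).map_injective (by simp)
  mapId := G.preId
  mapComp f g := G.preComp f g
  map₂_whisker_left f _ _ β := (G.L _ _).map_injective (by
    simp [map_whiskerLeft, ← whisker_exchange_assoc])
  map₂_whisker_right α g := (G.L _ _).map_injective (by
    simp [map_whiskerRight, whisker_exchange_assoc])
  map₂_associator f g k := (G.L _ _).map_injective (by
    simp only [Functor.map_comp, map_whiskerRight, map_whiskerLeft, map_associator, map_preComp,
      map_preComp_inv, map_pre₂]
    simp only [Category.assoc, comp_whiskerRight, whiskerLeft_comp, Iso.inv_hom_id_assoc,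
      whiskerRight_comp, Bicategory.whisker_assoc]
    rw [whisker_exchange_assoc]
    -- The two sides replace `f`, `g`, `k` in different orders. The exchange law (`e₁`) and
    -- naturality of the associator in its first variable (`e₂`, `e₃`) bring them to a common order.
    have e₁ : (G.preIso g).inv ▷ _ ≫ _ ◁ (G.preIso k).hom ≫ (G.preIso g).hom ▷ k =
        g ◁ (G.preIso k).hom := by simp [← whisker_exchange_assoc]
    have e₂ : (α_ _ g k).inv ≫ (G.preIso f).hom ▷ g ▷ k ≫ (α_ f g k).hom =
        (G.preIso f).hom ▷ (g ≫ k) := by simp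
    have e₃ : (α_ f g _).inv ≫ (G.preIso f).inv ▷ g ▷ (G.L _ _).obj (G.pre k) ≫ (α_ _ g _).hom =
        (G.preIso f).inv ▷ (g ≫ (G.L _ _).obj (G.pre k)) := by simp
    simp only [inv_hom_whiskerRight_assoc, whiskerLeft_inv_hom_assoc, Iso.inv_hom_id_assoc,
      comp_whiskerLeft, Category.assoc]
    simp only [← whiskerLeft_comp_assoc, e₁]
    rw [reassoc_of% e₂, reassoc_of% e₃, ← whisker_exchange_assoc]
    simp only [← whiskerLeft_comp_assoc, inv_hom_whiskerRight_assoc, whiskerLeft_inv_hom,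
      whiskerLeft_id, Category.id_comp])
  map₂_left_unitor f := (G.L _ _).map_injective (by
    simp [map_whiskerRight, G.leftUnitor, whisker_exchange_assoc])
  map₂_right_unitor f := (G.L _ _).map_injective (by
    simp [map_whiskerLeft, G.rightUnitor])

lemma pre₂_surjective {X Y : B} {f g : X ⟶ Y} (β : G.pre f ⟶ G.pre g) : ∃ α, G.pre₂ α = β :=
  ⟨(G.preIso f).inv ≫ (G.L X Y).map β ≫ (G.preIso g).hom, (G.L X Y).map_injective (by simp)⟩

instance faithful_toPseudofunctor (X Y : B) : (G.toPseudofunctor.mapFunctor X Y).Faithful where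
  map_injective {f g α β} h := by
    have h' : (G.L X Y).map (G.pre₂ α) = (G.L X Y).map (G.pre₂ β) := congrArg (G.L X Y).map h
    simpa using h'

instance full_toPseudofunctor (X Y : B) : (G.toPseudofunctor.mapFunctor X Y).Full where
  map_surjective β := G.pre₂_surjective β

instance essSurj_toPseudofunctor (X Y : B) : (G.toPseudofunctor.mapFunctor X Y).EssSurj where
  mem_essImage f := ⟨(G.L X Y).obj f, ⟨(G.L X Y).preimageIso (G.preIso _)⟩⟩

lemma biequivalent (ho : ∀ Y : B', ∃ X : B, Nonempty (G.o X ≌ Y)) : Biequivalent B B' :=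
  -- The empty structure collects the three preceding instances: faithful, full, essentially
  -- surjective.
  ⟨G.toPseudofunctor, fun _ _ => {}, ho⟩

end PseudoOver

/-! ### Restriction to classes of 2-cells -/

section
variable {B B' : Type*} [Bicategory B] [Bicategory B'] (p : CellClass B) (p' : CellClass B')

/-- A class contains the invertible 2-cells and is closed under composition, so conjugating by
isomorphisms can be undone inside the class. -/
lemma CellClass.iso_comp_iff {X Y : B} {f f' g g' : X ⟶ Y} (i : f ≅ f') (α : f' ⟶ g')
    (j : g ≅ g') : p.prop (i.hom ≫ α ≫ j.inv) ↔ p.prop α := by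
  refine ⟨fun h => ?_, fun h => p.comp (p.iso i) (p.comp h (p.iso j.symm))⟩
  simpa using p.comp (p.iso i.symm) (p.comp h (p.iso j))

variable {p p'} (F : Pseudofunctor B B')

/-- The restriction of a pseudofunctor to classes of 2-cells. -/
def CellClass.restrict
    (h : ∀ {X Y : B} {f g : X ⟶ Y} (α : f ⟶ g), p'.prop (F.map₂ α) ↔ p.prop α) :
    Pseudofunctor p.Sub p'.Sub where
  obj X := ⟨F.obj X.obj⟩
  map f := ⟨F.map f.cell⟩
  map₂ α := Sub.mk₂ (F.map₂ (Sub.val α)) ((h _).2 (Sub.prop_val α))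
  map₂_id _ := Subtype.ext (F.map₂_id _)
  map₂_comp _ _ := Subtype.ext (F.map₂_comp _ _)
  mapId X := Sub.mkIso (F.mapId X.obj)
  mapComp f g := Sub.mkIso (F.mapComp f.cell g.cell)
  map₂_whisker_left _ _ _ _ := Subtype.ext (F.map₂_whisker_left _ _)
  map₂_whisker_right _ _ := Subtype.ext (F.map₂_whisker_right _ _)
  map₂_associator _ _ _ := Subtype.ext (F.map₂_associator _ _ _)
  map₂_left_unitor _ := Subtype.ext (F.map₂_left_unitor _)
  map₂_right_unitor _ := Subtype.ext (F.map₂_right_unitor _)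

/-- Preservation of the class makes the restriction well defined; reflection gives local fullness,
since a preimage of a 2-cell of `p'` must itself lie in `p`. Essential surjectivity on 1-cells
survives because invertible 2-cells belong to every class. -/
lemma CellClass.biequivalent_sub
    (h : ∀ {X Y : B} {f g : X ⟶ Y} (α : f ⟶ g), p'.prop (F.map₂ α) ↔ p.prop α)
    (hF : ∀ X Y : B, (F.mapFunctor X Y).IsEquivalence)
    (ho : ∀ Y : p'.Sub, ∃ X : p.Sub, Nonempty ((⟨F.obj X.obj⟩ : p'.Sub) ≌ Y)) :
    Biequivalent p.Sub p'.Sub := by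
  refine ⟨restrict F h, fun X Y => ?_, ho⟩
  have := hF X.obj Y.obj
  have h₁ : ((restrict F h).mapFunctor X Y).Faithful := ⟨fun {f g α β} e =>
    Subtype.ext ((F.mapFunctor X.obj Y.obj).map_injective (congrArg Subtype.val e))⟩
  have h₂ : ((restrict F h).mapFunctor X Y).Full := ⟨fun {f g} β => by
    obtain ⟨α, hα⟩ := (F.mapFunctor X.obj Y.obj).map_surjective (Sub.val β)
    have hα' : F.map₂ α = Sub.val β := hα
    exact ⟨Sub.mk₂ α ((h α).1 (hα' ▸ Sub.prop_val β)), Subtype.ext hα⟩⟩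
  have h₃ : ((restrict F h).mapFunctor X Y).EssSurj := ⟨fun g =>
    ⟨⟨(F.mapFunctor X.obj Y.obj).objPreimage g.cell⟩,
      ⟨Sub.mkIso ((F.mapFunctor X.obj Y.obj).objObjPreimageIso g.cell)⟩⟩⟩
  exact {}
end

end CategoryTheory.Bicategory

end

/-! ### Equivalences are groupoid fibrations -/

noncomputable section

namespace CategoryTheory.Bicategory

/-- Essential surjectivity provides the source of a lift, and full faithfulness the lift itself as
well as the unique fillers. -/
lemma IsGroupoidFibration.of_isEquivalence {E D : Type*} [Category E] [Category D] (F : E ⥤ D)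
    [F.IsEquivalence] : IsGroupoidFibration F where
  lift e b β := ⟨F.objPreimage b, F.preimage ((F.objObjPreimageIso b).hom ≫ β),
    (F.objObjPreimageIso b).symm, by simp⟩
  cartesian χ _ g b h := ⟨F.preimage b, ⟨F.map_injective (by simpa using h), by simp⟩,
    fun f hf => F.map_injective (by simp [hf.2])⟩

/-- Postcomposition with `e.inv` is quasi-inverse to postcomposition with `e.hom`, through the unit
and counit of `e`. -/
lemma GF.of_equivalence {M : Type u} [Bicategory.{w, v} M] {X Y : M} (e : X ≌ Y) : GF e.hom := by
  intro K
  have : (postcomp K e.hom).IsEquivalence := Functor.IsEquivalence.mk' (postcomp K e.inv)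
    (NatIso.ofComponents (fun f => (ρ_ f).symm ≪≫ whiskerLeftIso f e.unit ≪≫ (α_ _ _ _).symm)
      (fun {x y} f => by
        change f ≫ (ρ_ y).inv ≫ y ◁ e.unit.hom ≫ (α_ _ _ _).inv =
          ((ρ_ x).inv ≫ x ◁ e.unit.hom ≫ (α_ _ _ _).inv) ≫ f ▷ e.hom ▷ e.inv
        rw [Category.assoc, Category.assoc, ← associator_inv_naturality_left,
          whisker_exchange_assoc]
        simp))
    (NatIso.ofComponents (fun f => (α_ _ _ _) ≪≫ whiskerLeftIso f e.counit ≪≫ (ρ_ _))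
      (fun {x y} f => by
        change f ▷ e.inv ▷ e.hom ≫ (α_ _ _ _).hom ≫ y ◁ e.counit.hom ≫ (ρ_ y).hom =
          ((α_ _ _ _).hom ≫ x ◁ e.counit.hom ≫ (ρ_ x).hom) ≫ f
        rw [associator_naturality_left_assoc, ← whisker_exchange_assoc]
        simp))
  exact .of_isEquivalence _

end CategoryTheory.Bicategory

/-! ### Groupoid fibrations of spans -/

namespace Spn
variable {C : Type u} [Category.{v} C] [HasPullbacks C] {X Y Z : Spn C}

/-- A span from its legs. -/
abbrev of {A : C} (l : A ⟶ X.obj) (r : A ⟶ Y.obj) : X ⟶ Y := ⟨A, l, r, trivial, trivial⟩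

section
variable {A : C} (l : A ⟶ X.obj) (r : A ⟶ Y.obj)
end

section
variable {K W : Spn C} {P P' : X ⟶ Y} {Q Q' : Y ⟶ Z}
@[simp] lemma ap_wl (β : Q ⟶ Q') :
    ap (P ◁ β) = lift (π₁ P Q) (π₂ P Q ≫ ap β) (by simp [condition]) := rfl
@[simp] lemma ap_wr (α : P ⟶ P') :
    ap (α ▷ Q) = lift (π₁ P Q ≫ ap α) (π₂ P Q) (by simp [condition]) := rfl
@[simp] lemma ap_assoc (P : K ⟶ X) (Q : X ⟶ Y) (R : Y ⟶ Z) : ap (α_ P Q R).hom =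
    lift (π₁ _ _ ≫ π₁ _ _) (lift (π₁ _ _ ≫ π₂ _ _) (π₂ _ _)
      (by simpa using condition (P := P ≫ Q) (Q := R))) (by simp [condition]) := rfl
@[simp] lemma ap_assoc_inv (P : K ⟶ X) (Q : X ⟶ Y) (R : Y ⟶ Z) : ap (α_ P Q R).inv =
    lift (lift (π₁ _ _) (π₂ _ _ ≫ π₁ _ _)
      (by simpa using condition (P := P) (Q := Q ≫ R))) (π₂ _ _ ≫ π₂ _ _) (by simp [condition]) := rfl
@[simp] lemma ap_left_inv (P : X ⟶ Y) : ap (λ_ P).inv = unitL P := rfl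
end

/-- An isomorphism of spans from an isomorphism of apices. -/
@[simps] def mkIso {P Q : X ⟶ Y} (i : P.apex ≅ Q.apex) (hl : i.hom ≫ Q.l = P.l)
    (hr : i.hom ≫ Q.r = P.r) : P ≅ Q where
  hom := mk₂ i.hom hl hr
  inv := mk₂ i.inv (by simp [← hl]) (by simp [← hr])
  hom_inv_id := by ext; simp
  inv_hom_id := by ext; simp

@[simp] lemma ap_hom_inv {P Q : X ⟶ Y} (i : P ≅ Q) : ap i.hom ≫ ap i.inv = 𝟙 _ := by
  rw [← ap_comp, i.hom_inv_id, ap_id]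
@[simp] lemma ap_inv_hom {P Q : X ⟶ Y} (i : P ≅ Q) : ap i.inv ≫ ap i.hom = 𝟙 _ := by
  rw [← ap_comp, i.inv_hom_id, ap_id]

@[simp] lemma ap_hom_inv_assoc {P Q : X ⟶ Y} (i : P ≅ Q) {U : C} (f : P.apex ⟶ U) :
    ap i.hom ≫ ap i.inv ≫ f = f := by
  rw [← Category.assoc, ap_hom_inv, Category.id_comp]
@[simp] lemma ap_inv_hom_assoc {P Q : X ⟶ Y} (i : P ≅ Q) {U : C} (f : Q.apex ⟶ U) :
    ap i.inv ≫ ap i.hom ≫ f = f := by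
  rw [← Category.assoc, ap_inv_hom, Category.id_comp]

lemma isIso_iff {P Q : X ⟶ Y} (α : P ⟶ Q) : IsIso α ↔ IsIso (ap α) :=
  ⟨fun _ => ⟨ap (inv α), by rw [← ap_comp]; simp, by rw [← ap_comp]; simp⟩,
    fun _ => ⟨mk₂ (inv (ap α)) (by simp) (by simp), by ext; simp, by ext; simp⟩⟩

instance isIso_π₁ (P : X ⟶ Y) (Q : Y ⟶ Z) [IsIso Q.l] : IsIso (π₁ P Q) :=
  inferInstanceAs (IsIso (pullback.fst P.r Q.l))

lemma π₂_eq (P : X ⟶ Y) (Q : Y ⟶ Z) [IsIso Q.l] : π₂ P Q = π₁ P Q ≫ P.r ≫ inv Q.l := by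
  rw [condition_assoc]; simp


lemma of_id_condition (p : X ⟶ Y) :
    π₁ (of (𝟙 X.obj) (𝟙 X.obj)) p = π₂ (of (𝟙 X.obj) (𝟙 X.obj)) p ≫ p.l := by
  simpa using condition (P := of (X := X) (𝟙 X.obj) (𝟙 X.obj)) (Q := p)

/-- The groupoid fibrations are the spans with invertible left leg. -/
lemma gf_iff (p : X ⟶ Y) : GF p ↔ IsIso p.l := by
  constructor
  · intro hp
    -- The test arrow is `p.l`, viewed as a 2-cell from the span `(p.l, p.l)` to the identity span
    -- of `X`. After composition with `p` it is split by the diagonal of `p.apex`. Cartesianness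
    -- lifts this splitting to a section `f` of `p.l`.
    obtain ⟨f, h₁, h₂⟩ := hp.fill (e := of (X := X) (𝟙 X.obj) (𝟙 X.obj)) (e' := of p.l p.l)
      (mk₂ p.l (Category.comp_id _) (Category.comp_id _)) (𝟙 _)
      (mk₂ (lift (π₂ _ p) (π₂ _ p) rfl) (by simp [of_id_condition]) (by simp)) (by
        ext <;> simp [of_id_condition])
    refine ⟨ap f, ?_, congrArg ap h₁⟩
    -- Evaluating `f ▷ p`, which equals the diagonal, at the element `(p.l, 𝟙)` shows that `f` is
    -- also a retraction.
    have := congrArg (fun t => lift (P := of (𝟙 X.obj) (𝟙 X.obj)) p.l (𝟙 _) (by simp) ≫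
      ap t ≫ π₁ (of p.l p.l) p) h₂
    simpa using this
  · intro hp K
    refine ⟨fun e b (β : b ⟶ e ≫ p) => ?_, fun {e' e} χ k g (b : k ≫ p ⟶ e' ≫ p) hb => ?_⟩
    · obtain ⟨a, ha⟩ : ∃ a, ap β ≫ π₁ e p = a := ⟨_, rfl⟩
      have hl : a ≫ e.l = b.l := by simpa [ha.symm] using ap_l β
      have hr : (ap β ≫ π₂ e p) ≫ p.r = b.r := by simpa using ap_r β
      have hc : (a ≫ e.r) = (ap β ≫ π₂ e p) ≫ p.l := by simp [ha.symm, condition]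
      -- With `p.l` invertible, composing with `p` changes only the right leg of a span, up to
      -- isomorphism. The lift therefore keeps the apex and left leg of `b` and takes its right leg
      -- from `e` along `a`.
      refine ⟨of b.l (a ≫ e.r), mk₂ a hl rfl, mkIso (Q := of b.l (a ≫ e.r) ≫ p)
        ⟨lift (𝟙 b.apex) (ap β ≫ π₂ e p) (by simp [hc]), π₁ _ _, by simp, ?_⟩ (by simp)
        (by simpa using hr), ?_⟩
      · apply (cancel_mono (π₁ (of b.l (a ≫ e.r)) p)).1
        simp
      · change mk₂ _ _ _ ≫ _ ▷ p = β
        ext <;> simp [ha]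
    · have hb' : b ≫ χ ▷ p = g ▷ p := hb
      have h₁ : ap b ≫ π₁ e' p ≫ ap χ = π₁ k p ≫ ap g := by
        simpa using congrArg (fun t => ap t ≫ π₁ e p) hb'
      -- Since `π₁ k p` is invertible, the condition `f ▷ p = b` leaves this as the only possible
      -- map of apices.
      refine ⟨mk₂ (inv (π₁ k p) ≫ ap b ≫ π₁ e' p) ?_ ?_, ⟨?_, ?_⟩, fun f hf => ?_⟩
      · simpa using congrArg (· ≫ e.l) h₁
      · simpa using congrArg (· ≫ e.r) h₁
      · ext
        simp [h₁]
      · change _ ▷ p = b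
        ext
        · simp
        · simp [π₂_eq]
      · have h₂ : f ▷ p = b := hf.2
        ext
        simp [← h₂]

lemma GF.of_iso {p q : X ⟶ Y} (hp : GF p) (i : p ≅ q) : GF q := by
  rw [gf_iff] at hp ⊢
  rw [← ap_l i.inv]
  have : IsIso (ap i.inv) := (isIso_iff i.inv).1 inferInstance
  infer_instance

/-- The left leg of the composite is `π₁ q p ≫ q.l`, and `π₁ q p` is a pullback of the invertible
`p.l`. -/
lemma gf_comp_iff (q : X ⟶ Y) (p : Y ⟶ Z) (hp : GF p) : GF (q ≫ p) ↔ GF q := by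
  rw [gf_iff] at hp
  rw [gf_iff, gf_iff]
  change IsIso (π₁ q p ≫ q.l) ↔ _
  exact isIso_comp_left_iff _ _

end Spn
end

/-! ### Right lifters are the spans with powerful left leg -/

noncomputable section

namespace Spn
section
variable {C : Type u} [Category.{v} C] [HasPullbacks C] {X Y Z : Spn C}

attribute [local simp] pullback.lift_fst pullback.lift_snd pullback.lift_fst_assoc
  pullback.lift_snd_assoc prod.lift_fst prod.lift_snd

lemma lift_congr {P : X ⟶ Y} {Q : Y ⟶ Z} {U : C} {a a' : U ⟶ P.apex} {b b' : U ⟶ Q.apex}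
    (h : a ≫ P.r = b ≫ Q.l) (ha : a = a') (hb : b = b') :
    lift a b h = lift a' b' (by rw [← ha, ← hb, h]) := by
  subst ha hb
  rfl

/-- Reads a factorization through a right lifting on generalized elements: for `γ` the counit, the
transpose of `α` sends `(a, b)` to the value at `b` of the function `α a`. -/
lemma lift_ap_wr_comp {P P' : X ⟶ Y} {Q : Y ⟶ Z} {R : X ⟶ Z} (α : P ⟶ P') (γ : P' ≫ Q ⟶ R) {U : C}
    (a : U ⟶ P.apex) (b : U ⟶ Q.apex) (h : a ≫ P.r = b ≫ Q.l) :
    lift a b h ≫ ap (α ▷ Q ≫ γ) = lift (a ≫ ap α) b (by simp [h]) ≫ ap γ := by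
  have : lift a b h ≫ ap (α ▷ Q) = lift (a ≫ ap α) b (by simp [h]) := by ext <;> simp
  rw [← this, Category.assoc, ap_comp]

lemma comp_lift {P : X ⟶ Y} {Q : Y ⟶ Z} {U V : C} (k : V ⟶ U) (a : U ⟶ P.apex) (b : U ⟶ Q.apex)
    (h : a ≫ P.r = b ≫ Q.l) : k ≫ lift a b h = lift (k ≫ a) (k ≫ b) (by simp [h]) := by
  ext <;> simp

/-- The dependent product of `b : B ⟶ n.apex` is carved out of two right liftings. Over `(y, y')`,
elements of `l₁` are functions from the fibre of `n.l` over `y'` to `B`, compatible with the legs of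
`(b ≫ n.l, b ≫ n.r)`; elements of `l₂` are such functions to `n.apex`. The map `m` composes a
function with `b`, and `j` names the identity functions over the diagonal. The pullback of `m` and
`j` thus consists of the sections of `b` over the fibres of `n.l`. -/
lemma IsRightLifter.powerful {n : Y ⟶ Z} (hn : IsRightLifter n) : Powerful n.l := by
  rw [isRightLifter_iff] at hn
  rw [powerful_iff]
  intro B b
  obtain ⟨l₁, e₁, H₁⟩ := hn (of (b ≫ n.l) (b ≫ n.r))
  obtain ⟨l₂, e₂, H₂⟩ := hn n
  obtain ⟨m, hm, -⟩ := H₂ l₁ (e₁ ≫ mk₂ b rfl rfl)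
  obtain ⟨j, hj, -⟩ := H₂ (of (𝟙 Y.obj) (𝟙 Y.obj)) (mk₂ (π₂ _ n) (by simp [of_id_condition]) (by simp))
  obtain ⟨j', hj₀⟩ : ∃ j' : Y.obj ⟶ l₂.apex, j' = ap j := ⟨_, rfl⟩
  have hjl : j' ≫ l₂.l = 𝟙 _ := hj₀ ▸ ap_l j
  have hjr : j' ≫ l₂.r = 𝟙 _ := hj₀ ▸ ap_r j
  have hm' {U : C} (x : U ⟶ l₁.apex) (e : U ⟶ n.apex) (h : x ≫ l₁.r = e ≫ n.l) :
      lift x e h ≫ ap e₁ ≫ b = lift (x ≫ ap m) e (by simp [h]) ≫ ap e₂ := by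
    rw [← lift_ap_wr_comp m e₂ x e h, hm]
    simp
  have hj' {U : C} (x : U ⟶ Y.obj) (e : U ⟶ n.apex) (h : x = e ≫ n.l) :
      lift (x ≫ j') e (by simp [hjr, h]) ≫ ap e₂ = e := by
    subst hj₀
    refine (lift_ap_wr_comp j e₂ x e (by simp [h])).symm.trans ?_
    rw [hj]
    simp
  -- Matching an identity function forces both indices to agree, so the two legs of `l₁` coincide on
  -- the pullback.
  have hr : pullback.fst (ap m) j' ≫ l₁.r = pullback.snd (ap m) j' := by
    rw [← ap_r m, pullback.condition_assoc, hjr, Category.comp_id]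
  have hl : pullback.fst (ap m) j' ≫ l₁.l = pullback.snd (ap m) j' := by
    rw [← ap_l m, pullback.condition_assoc, hjl, Category.comp_id]
  let ev : pullback (pullback.snd (ap m) j') n.l ⟶ B :=
    lift (P := l₁) (Q := n) (pullback.fst _ _ ≫ pullback.fst _ _) (pullback.snd _ _)
      (by rw [Category.assoc, hr, pullback.condition]) ≫ ap e₁
  have hev {V : C} (w : V ⟶ pullback (ap m) j') (e : V ⟶ n.apex)
      (h : w ≫ pullback.snd _ _ = e ≫ n.l) : pt ev w e h = lift (w ≫ pullback.fst _ _) e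
        (by rw [Category.assoc, hr, h]) ≫ ap e₁ := by
    rw [pt, ← Category.assoc, comp_lift]
    congr 1
    exact lift_congr _ (by simp) (by simp)
  refine ⟨pullback (ap m) j', pullback.snd _ _, ev, ?_, fun {U} u g hg => ?_,
    fun {U} w w' hw H => ?_⟩
  · refine pt_ext fun w e h => ?_
    rw [← pt_comp, hev, Category.assoc, hm', pt_snd]
    refine Eq.trans ?_ (hj' _ _ h)
    congr 1
    exact lift_congr _ (by rw [Category.assoc, pullback.condition, Category.assoc]) rfl
  · have hc : π₁ (of u u) n ≫ u = π₂ (of u u) n ≫ n.l := condition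
    -- A family of sections over `u` is tested by the span `(u, u)` with apex `U`: the apex of its
    -- composite with `n` is `pullback u n.l`, so `g` is a 2-cell and has a transpose into `l₁`.
    obtain ⟨h, hh, -⟩ := H₁ (of u u) (mk₂ g (by
      change g ≫ b ≫ n.l = π₁ (of u u) n ≫ u
      rw [reassoc_of% hg, hc]
      rfl) (by
      change g ≫ b ≫ n.r = π₂ (of u u) n ≫ n.r
      rw [reassoc_of% hg]
      rfl))
    have hh' {V : C} (x : V ⟶ U) (e : V ⟶ n.apex) (h' : x ≫ u = e ≫ n.l) :
        lift (x ≫ ap h) e (by rw [Category.assoc, ap_r, ← h']) ≫ ap e₁ = pt g x e h' := by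
      refine (lift_ap_wr_comp h e₁ x e h').symm.trans ?_
      rw [hh]
      rfl
    -- The transpose lands in the pullback: both 2-cells into `l₂` correspond to the projection
    -- `π₂`, the left one because `g` is a map over `n.apex`.
    have key : h ≫ m = mk₂ u (Category.comp_id _) (Category.comp_id _) ≫ j := by
      refine (H₂ (of u u) (mk₂ (π₂ (of u u) n) hc.symm rfl)).unique ?_ ?_
      · simp only [comp_whiskerRight, Category.assoc, hm]
        rw [reassoc_of% hh]
        ext
        exact hg
      · simp only [comp_whiskerRight, Category.assoc, hj]
        ext
        simp
        rfl
    refine ⟨pullback.lift (ap h) u (by rw [hj₀]; exact congrArg ap key), by simp, fun {V} x e h' => ?_⟩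
    rw [hev, ← hh' x e h']
    congr 1
    exact lift_congr _ (by simp) rfl
  · have h₁ (w : U ⟶ pullback (ap m) j') :
        (w ≫ pullback.fst _ _) ≫ l₁.l = w ≫ pullback.snd _ _ := by rw [Category.assoc, hl]
    have h₂ (w : U ⟶ pullback (ap m) j') :
        (w ≫ pullback.fst _ _) ≫ l₁.r = w ≫ pullback.snd _ _ := by rw [Category.assoc, hr]
    obtain ⟨u, hu⟩ : ∃ u : U ⟶ Y.obj, w ≫ pullback.snd _ _ = u := ⟨_, rfl⟩
    have hu' : w' ≫ pullback.snd _ _ = u := hw.symm.trans hu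
    have hc : π₁ (of u u) n ≫ u = π₂ (of u u) n ≫ n.l := condition
    -- Two elements of the pullback over the same `u` are 2-cells into `l₁` out of `(u, u)`. Equal
    -- evaluations make them factor the same 2-cell.
    have := (H₁ (of u u) (mk₂ (w ≫ pullback.fst _ _) ((h₁ w).trans hu)
      ((h₂ w).trans hu) ▷ n ≫ e₁)).unique
      (y₂ := mk₂ (w' ≫ pullback.fst _ _) ((h₁ w').trans hu') ((h₂ w').trans hu')) rfl (by
      ext
      have := H (π₁ (of u u) n) (π₂ (of u u) n) (by simpa [hu] using hc) (by simpa [hu'] using hc)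
      rw [hev, hev] at this
      have e₀ : lift (π₁ (of u u) n) (π₂ (of u u) n) hc = 𝟙 _ := by ext <;> simp
      refine ((Category.id_comp _).symm.trans ?_).trans (Category.id_comp _)
      rw [← e₀, lift_ap_wr_comp, lift_ap_wr_comp]
      refine Eq.trans ?_ (this.symm.trans ?_)
      · congr 1
        exact lift_congr _ (by simp) rfl
      · congr 1
        exact lift_congr _ (by simp) rfl)
    apply pullback.hom_ext _ hw
    exact congrArg ap this

/-- With `A = n.apex`, the map `K × A ⟶ K × Y` is a pullback of `n.l`, hence powerful. The dependent
product along it of the family `(k, a) ↦ x(k, n.r a)` has as elements over `(k, y)` exactly the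
functions required of a right lifting. The product `K × Y` lets a span be treated as a single map.
-/
lemma IsRightLifter.of_powerful [HasBinaryProducts C] {n : Y ⟶ Z} (hn : Powerful n.l) :
    IsRightLifter n := by
  rw [isRightLifter_iff]
  intro K x
  have hf := hn.pullback_fst (prod.snd : K.obj ⨯ Y.obj ⟶ Y.obj)
  rw [powerful_iff] at hf
  -- The source is the model of `K × A` used here, and `q` is the map `(k, a) ↦ (k, n.r a)`.
  let q : pullback (prod.snd : K.obj ⨯ Y.obj ⟶ Y.obj) n.l ⟶ K.obj ⨯ Z.obj :=
    prod.lift (pullback.fst _ _ ≫ prod.fst) (pullback.snd _ _ ≫ n.r)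
  obtain ⟨W, r, ev, h⟩ := hf (pullback.snd (prod.lift x.l x.r) q)
  have hq₁ : pullback.fst (prod.lift x.l x.r) q ≫ x.l =
      pullback.snd _ _ ≫ pullback.fst _ _ ≫ prod.fst := by
    have := congrArg (· ≫ prod.fst) (pullback.condition (f := prod.lift x.l x.r) (g := q))
    simpa only [q, Category.assoc, prod.lift_fst] using this
  have hq₂ : pullback.fst (prod.lift x.l x.r) q ≫ x.r =
      pullback.snd _ _ ≫ pullback.snd _ _ ≫ n.r := by
    have := congrArg (· ≫ prod.snd) (pullback.condition (f := prod.lift x.l x.r) (g := q))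
    simpa only [q, Category.assoc, prod.lift_snd] using this
  have hev {V : C} (w : V ⟶ W) (e) (he : w ≫ r = e ≫ pullback.fst _ _) :
      pt ev w e he ≫ pullback.snd _ _ = e := by rw [pt_comp, h.w, pt_snd]
  -- A function over `(k, y)` and an element `d` of the fibre `A_y` determine the point `(k, d)` of
  -- `K × A` at which the function is evaluated.
  have hc {V : C} (w : V ⟶ W) (d : V ⟶ n.apex) (hd : w ≫ r ≫ prod.snd = d ≫ n.l) :
      w ≫ r = pullback.lift (f := prod.snd) (g := n.l) (w ≫ r) d (by rw [Category.assoc, hd]) ≫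
        pullback.fst _ _ := by simp
  let L : K ⟶ Y := of (r ≫ prod.fst) (r ≫ prod.snd)
  have hL : π₁ L n ≫ r ≫ prod.snd = π₂ L n ≫ n.l := condition
  let e₀ : L ≫ n ⟶ x := mk₂ (pt ev _ _ (hc (π₁ L n) (π₂ L n) hL) ≫ pullback.fst _ _)
    (by
      rw [Category.assoc, hq₁, reassoc_of% hev]
      simp [L]) (by
      rw [Category.assoc, hq₂, reassoc_of% hev]
      simp)
  have he₀ {V : C} (w : V ⟶ W) (d : V ⟶ n.apex) (hd : w ≫ r ≫ prod.snd = d ≫ n.l) :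
      lift (P := L) w d hd ≫ ap e₀ = pt ev _ _ (hc w d hd) ≫ pullback.fst _ _ := by
    change _ ≫ pt ev _ _ _ ≫ _ = _
    rw [← Category.assoc, comp_pt]
    congr 1
    refine pt_congr _ _ (lift_π₁ (P := L) w d hd) ?_
    apply pullback.hom_ext
    · simp
    · simp
  have he₁ (k : K ⟶ Y) (f : k ⟶ L) (w : k.apex ⟶ W) (hw : w = ap f) {V : C} (a : V ⟶ k.apex)
      (d : V ⟶ n.apex) (hd : a ≫ k.r = d ≫ n.l) : lift a d hd ≫ ap (f ▷ n ≫ e₀) =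
        pt ev _ _ (hc (a ≫ w) d (by
          rw [← hd, ← ap_r f, ← hw, Category.assoc])) ≫ pullback.fst _ _ := by
    subst hw
    rw [lift_ap_wr_comp]
    exact he₀ _ _ _
  have inj (k : K ⟶ Y) (f f' : k ⟶ L) (hf : f ▷ n ≫ e₀ = f' ▷ n ≫ e₀) : f = f' := by
    obtain ⟨w, hw⟩ : ∃ w : k.apex ⟶ W, w = ap f := ⟨_, rfl⟩
    obtain ⟨w', hw'⟩ : ∃ w : k.apex ⟶ W, w = ap f' := ⟨_, rfl⟩
    have hl : w ≫ r ≫ prod.fst = k.l := by rw [hw]; exact ap_l f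
    have hr : w ≫ r ≫ prod.snd = k.r := by rw [hw]; exact ap_r f
    have hl' : w' ≫ r ≫ prod.fst = k.l := by rw [hw']; exact ap_l f'
    have hr' : w' ≫ r ≫ prod.snd = k.r := by rw [hw']; exact ap_r f'
    ext
    rw [← hw, ← hw']
    refine h.ext _ _ (Limits.prod.hom_ext (by simp [hl, hl']) (by simp [hr, hr']))
      fun a e h₁ h₂ => ?_
    -- An evaluation has a component in `x` and one in `K × A`. The second is forced by `hev`, so
    -- only the first has to be read off from `hf`.
    apply pullback.hom_ext
    · have hd : a ≫ k.r = (e ≫ pullback.snd _ _) ≫ n.l := by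
        rw [← hr, Category.assoc, ← pullback.condition, reassoc_of% h₁.symm]
      have := congrArg (fun t => lift a _ hd ≫ ap t) hf
      rw [he₁ k f w hw, he₁ k f' w' hw'] at this
      refine Eq.trans ?_ (this.trans ?_)
      · congr 1
        refine pt_congr _ _ rfl ?_
        apply pullback.hom_ext <;> simp [← h₁]
      · congr 1
        refine pt_congr _ _ rfl ?_
        apply pullback.hom_ext <;> simp [← h₂]
    · rw [hev, hev]
  refine ⟨L, e₀, fun k μ => ?_⟩
  let u := prod.lift k.l k.r
  have hu {V : C} (a : V ⟶ k.apex) (d : V ⟶ pullback prod.snd n.l)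
      (hd : a ≫ u = d ≫ pullback.fst _ _) : a ≫ k.r = (d ≫ pullback.snd _ _) ≫ n.l := by
    have := congrArg (· ≫ prod.snd) hd
    simpa [u, pullback.condition] using this
  -- Curries `μ`: an element of `k` and a point of `K × A` over its image give an element of `k ≫
  -- n`. Its image under `μ` is paired with that point.
  let g : pullback u (pullback.fst prod.snd n.l) ⟶ pullback (prod.lift x.l x.r) q :=
    pullback.lift (lift (P := k) (Q := n) (pullback.fst _ _) _ (hu _ _ pullback.condition) ≫ ap μ)
      (pullback.snd _ _) (by
        have hc := congrArg (· ≫ prod.fst)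
          (pullback.condition (f := u) (g := pullback.fst prod.snd n.l))
        simp only [u, Category.assoc, prod.lift_fst] at hc
        apply Limits.prod.hom_ext
        · simpa [q, u] using hc
        · simp [q])
  obtain ⟨w, hw, H⟩ := h.lift u g (pullback.lift_snd _ _ _)
  let f : k ⟶ L := mk₂ w (by simpa [L, u] using congrArg (· ≫ prod.fst) hw)
    (by simpa [L, u] using congrArg (· ≫ prod.snd) hw)
  have hf : f ▷ n ≫ e₀ = μ := by
    ext
    refine (Category.id_comp _).symm.trans (Eq.trans ?_ (Category.id_comp _))
    have e₀ : lift (π₁ k n) (π₂ k n) condition = 𝟙 _ := by ext <;> simp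
    rw [← e₀, he₁ k f w rfl]
    have hh : π₁ k n ≫ u = pullback.lift (f := prod.snd) (g := n.l) ((π₁ k n ≫ w) ≫ r) (π₂ k n)
      (by simp [hw, u, condition]) ≫ pullback.fst _ _ := by simp [hw]
    refine (congrArg (· ≫ _) (H (π₁ k n) _ hh)).trans ?_
    rw [pt_comp, pullback.lift_fst, pt, ← Category.assoc, comp_lift]
    congr 1
    exact lift_congr _ (by simp) (by simp)
  exact ⟨f, hf, fun f' hf' => inj _ _ _ (hf'.trans hf.symm)⟩
end
end Spn
end

/-! ### Bipullbacks in the bicategory of spans -/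

noncomputable section

namespace CategoryTheory.Bicategory
variable {M : Type u} [Bicategory.{w, v} M]

/-- The three hypotheses are essential surjectivity, fullness and faithfulness of the comparison
functor, stated in the language of the bicategory. -/
lemma IsBipullback.of_exists {P A B D : M} {n : A ⟶ D} {p : B ⟶ D} {d : P ⟶ A} {c : P ⟶ B}
    {θ : d ≫ n ≅ c ≫ p}
    (hl : ∀ {K : M} (a : K ⟶ A) (b : K ⟶ B) (γ : a ≫ n ≅ b ≫ p),
      ∃ (x : K ⟶ P) (τ : x ≫ d ≅ a) (σ : x ≫ c ≅ b),
        (α_ x d n).hom ≫ x ◁ θ.hom ≫ (α_ x c p).inv ≫ σ.hom ▷ p = τ.hom ▷ n ≫ γ.hom)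
    (hh : ∀ {K : M} {x x' : K ⟶ P} (τ : x ≫ d ⟶ x' ≫ d) (σ : x ≫ c ⟶ x' ≫ c),
      (α_ x d n).hom ≫ x ◁ θ.hom ≫ (α_ x c p).inv ≫ σ ▷ p =
        τ ▷ n ≫ (α_ x' d n).hom ≫ x' ◁ θ.hom ≫ (α_ x' c p).inv →
      ∃ ω : x ⟶ x', ω ▷ d = τ ∧ ω ▷ c = σ)
    (he : ∀ {K : M} {x x' : K ⟶ P} {ω ω' : x ⟶ x'}, ω ▷ d = ω' ▷ d → ω ▷ c = ω' ▷ c → ω = ω') :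
    IsBipullback θ := by
  intro K
  refine { faithful := ⟨fun {x x' ω ω'} h => ?_⟩, full := ⟨fun {x x'} f => ?_⟩, essSurj := ⟨fun y => ?_⟩ }
  · exact he (congrArg CategoricalPullback.Hom.fst h) (congrArg CategoricalPullback.Hom.snd h)
  · let τ : x ≫ d ⟶ x' ≫ d := f.fst
    let σ : x ≫ c ⟶ x' ≫ c := f.snd
    have w : τ ▷ n ≫ (α_ x' d n).hom ≫ x' ◁ θ.hom ≫ (α_ x' c p).inv =
      ((α_ x d n).hom ≫ x ◁ θ.hom ≫ (α_ x c p).inv) ≫ σ ▷ p := f.w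
    obtain ⟨ω, h₁, h₂⟩ := hh τ σ (by simpa using w.symm)
    exact ⟨ω, CategoricalPullback.hom_ext h₁ h₂⟩
  · let γ : y.fst ≫ n ≅ y.snd ≫ p := y.iso
    obtain ⟨x, τ, σ, h⟩ := hl y.fst y.snd γ
    refine ⟨x, ⟨CategoricalPullback.mkIso τ σ ?_⟩⟩
    change τ.hom ▷ n ≫ γ.hom = ((α_ x d n).hom ≫ x ◁ θ.hom ≫ (α_ x c p).inv) ≫ σ.hom ▷ p
    simpa using h.symm
end CategoryTheory.Bicategory

namespace Spn
section
variable {C : Type u} [Category.{v} C] [HasPullbacks C] {X Y Z : Spn C}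

attribute [local simp] pullback.lift_fst pullback.lift_snd pullback.lift_fst_assoc
  pullback.lift_snd_assoc

lemma comp_lift_assoc {P : X ⟶ Y} {Q : Y ⟶ Z} {U V D : C} (k : V ⟶ U) (a : U ⟶ P.apex)
    (b : U ⟶ Q.apex) (h : a ≫ P.r = b ≫ Q.l) (g : (P ≫ Q).apex ⟶ D) :
    k ≫ lift a b h ≫ g = lift (k ≫ a) (k ≫ b) (by simp [h]) ≫ g := by
  rw [← Category.assoc, comp_lift]

/-- The assumptions say that `d`, in essence a morphism to `T`, is the dependent product along `n.l`
of `n.apex ×_Y S`, with evaluation `e`. In a square `a ≫ n ≅ b ≫ p` the span `b` has, up to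
isomorphism, the apex of `a ≫ n`, so the square reduces to `a` and a map over `Y` from that apex to
`S`. By the universal property this is a map from the apex of `a` to the dependent product over `T`,
that is, a 1-cell into `B`. -/
lemma exists_isBipullback {S T Y B : Spn C} (p : S ⟶ Y) (n : T ⟶ Y) [IsIso p.l] (d : B ⟶ T)
    [IsIso d.l] (e : (d ≫ n).apex ⟶ S.obj) (he : e ≫ inv p.l ≫ p.r = π₂ d n ≫ n.r)
    (hlift : ∀ {U : C} (u : U ⟶ T.obj) (g : pullback u n.l ⟶ S.obj),
      g ≫ inv p.l ≫ p.r = pullback.snd u n.l ≫ n.r → ∃ (w : U ⟶ d.apex) (hw : w ≫ d.r = u),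
      ∀ {V : C} (k : V ⟶ U) (a : V ⟶ n.apex) (hk : k ≫ u = a ≫ n.l),
        lift (P := d) (k ≫ w) a (by simp [hw, hk]) ≫ e = pt g k a hk)
    (hext : ∀ {U : C} (w w' : U ⟶ d.apex), w ≫ d.r = w' ≫ d.r →
      (∀ {V : C} (k : V ⟶ U) (a : V ⟶ n.apex) (hk : (k ≫ w) ≫ d.r = a ≫ n.l)
        (hk' : (k ≫ w') ≫ d.r = a ≫ n.l), lift (P := d) (k ≫ w) a hk ≫ e =
          lift (P := d) (k ≫ w') a hk' ≫ e) → w = w') :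
    ∃ (c : B ⟶ S) (θ : d ≫ n ≅ c ≫ p), IsBipullback θ := by
  -- The projection `c` is the evaluation span: its apex is that of `d ≫ n`, its left leg goes to
  -- `B`, its right leg is `e`. Here `i` is an identity; the existential hides this and keeps the
  -- legs of `c` opaque.
  obtain ⟨c, i, hic, hir⟩ : ∃ (c : B ⟶ S) (i : (d ≫ n).apex ≅ c.apex), i.hom ≫ c.l = π₁ d n ≫ d.l ∧
    i.hom ≫ c.r = e := ⟨of (π₁ d n ≫ d.l) e, Iso.refl _, Category.id_comp _, Category.id_comp _⟩
  have hir' : i.inv ≫ e = c.r := by simp [← hir]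
  have hic' : i.inv ≫ π₁ d n ≫ d.l = c.l := by simp [← hic]
  obtain ⟨θ, hθ⟩ : ∃ θ : d ≫ n ≅ c ≫ p, ap θ.hom ≫ π₁ c p = i.hom :=
    ⟨mkIso (i ≪≫ (asIso (π₁ c p)).symm) (by simp [hic])
      (by simp [π₂_eq, reassoc_of% hir, he]), by simp⟩
  have hπ {K : Spn C} (x : K ⟶ B) : π₂ x d = π₁ x d ≫ x.r ≫ inv d.l := π₂_eq x d
  -- On elements, the comparison 2-cell of the square regroups `((a, b), z)` as `(a, (b, z))`.
  have hα {K : Spn C} (x : K ⟶ B) {V : C} (a : V ⟶ x.apex) (b : V ⟶ d.apex) (z : V ⟶ n.apex)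
      (h₁ : a ≫ x.r = b ≫ d.l) (h₃ : b ≫ d.r = z ≫ n.l) :
      lift (P := x ≫ d) (lift a b h₁) z (by simp [h₃]) ≫
        ap ((α_ x d n).hom ≫ x ◁ θ.hom ≫ (α_ x c p).inv) ≫
        π₁ (x ≫ c) p = lift (P := x) (Q := c) a (lift (P := d) b z h₃ ≫ i.hom) (by simp [hic, h₁]) := by
    ext
    · simp
    · simp [hθ, comp_lift, comp_lift_assoc]
  -- In an element of `x ≫ c`, the point of the dependent product is already determined by the
  -- component in `x`.
  have hz {K : Spn C} (x : K ⟶ B) : π₂ x c ≫ i.inv ≫ π₁ d n = π₁ x c ≫ x.r ≫ inv d.l ∧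
      (π₁ x c ≫ x.r ≫ inv d.l) ≫ d.r = (π₂ x c ≫ i.inv ≫ π₂ d n) ≫ n.l := by
    have : π₂ x c ≫ i.inv ≫ π₁ d n = π₁ x c ≫ x.r ≫ inv d.l := by
      rw [condition_assoc, ← hic']
      simp
    exact ⟨this, by rw [← this]; simp [condition]⟩
  refine ⟨c, θ, .of_exists (fun {K} a b γ => ?_) (fun {K x x'} τ σ w => ?_)
    (fun {K x x' ω ω'} h₁ _ => ?_)⟩
  · have hb : (ap γ.hom ≫ π₁ b p ≫ b.r) ≫ inv p.l ≫ p.r = π₂ a n ≫ n.r := by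
      have := ap_r γ.hom
      rw [comp_r, comp_r, π₂_eq] at this
      simpa using this
    -- Essential surjectivity: `γ` supplies the map from the apex of `a ≫ n` to `S`, and its
    -- transpose `w`, followed by `d.l`, is the right leg of the required 1-cell `x`.
    obtain ⟨w, hw, H⟩ := hlift a.r (ap γ.hom ≫ π₁ b p ≫ b.r) hb
    let x : K ⟶ B := of a.l (w ≫ d.l)
    have hxr : x.r ≫ inv d.l = w := by simp [x]
    obtain ⟨τ, hτ⟩ : ∃ τ : x ≫ d ≅ a, ap τ.hom = π₁ x d := ⟨mkIso (asIso (π₁ x d)) rfl (by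
      rw [comp_r, hπ, hxr, Category.assoc, hw]
      rfl), rfl⟩
    have h₁ : π₁ x c ≫ a.r = (π₂ x c ≫ i.inv ≫ π₂ d n) ≫ n.l := by
      rw [← hw, ← hxr]
      simpa using (hz x).2
    have h₂ : (π₁ a n ≫ w) ≫ d.r = π₂ a n ≫ n.l := by simp [hw, condition]
    have h₃ : π₁ a n ≫ x.r = (lift (P := d) (π₁ a n ≫ w) (π₂ a n) h₂ ≫ i.hom) ≫ c.l := by
      simp [hic, x]
    have hγl : ap γ.hom ≫ π₁ b p ≫ b.l = π₁ a n ≫ a.l := by simpa using ap_l γ.hom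
    have H' {V : C} (k : V ⟶ a.apex) (z : V ⟶ n.apex) (hk : k ≫ a.r = z ≫ n.l) :
        lift (P := a) k z hk ≫ ap γ.hom ≫ π₁ b p ≫ b.r =
          lift (P := d) (k ≫ w) z (by simp [hw, hk]) ≫ e := (H k z hk).symm
    obtain ⟨σ, hσ⟩ : ∃ σ : x ≫ c ≅ b, ap σ.hom =
        lift (P := a) (Q := n) (π₁ x c) (π₂ x c ≫ i.inv ≫ π₂ d n) h₁ ≫ ap γ.hom ≫ π₁ b p := by
      refine ⟨mkIso ⟨_, inv (π₁ b p) ≫ ap γ.inv ≫ lift (P := x) (Q := c) (π₁ a n) _ h₃,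
        ?_, ?_⟩ ?_ ?_, rfl⟩
      · ext
        · simp
        · simp only [Category.assoc, IsIso.hom_inv_id_assoc, ap_hom_inv_assoc, lift_π₂,
            Category.id_comp]
          rw [← Category.assoc, ← Iso.eq_comp_inv]
          ext
          · simp [(hz x).1, hxr]
          · simp
      · have : lift (P := a) (Q := n) (inv (π₁ b p) ≫ ap γ.inv ≫ π₁ a n)
            (inv (π₁ b p) ≫ ap γ.inv ≫ π₂ a n) (by simp [condition]) = inv (π₁ b p) ≫ ap γ.inv := by
          ext <;> simp
        simp [comp_lift_assoc, this]
      · simp [hγl, x]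
      · have : lift (P := d) (Q := n) (π₁ x c ≫ w) (π₂ x c ≫ i.inv ≫ π₂ d n) (by simpa [hw] using h₁) =
            π₂ x c ≫ i.inv := by
          ext <;> simp [(hz x).1, hxr]
        rw [comp_r, Category.assoc, Category.assoc, H', this, Category.assoc, hir']
    refine ⟨x, τ, σ, ?_⟩
    have h₄ : lift (P := d) (Q := n) (π₁ (x ≫ d) n ≫ π₂ x d) (π₂ (x ≫ d) n)
      (by simpa using condition (P := x ≫ d) (Q := n)) = lift (P := d) (π₁ (x ≫ d) n ≫ π₁ x d ≫ w)
      (π₂ (x ≫ d) n) (by simpa [hπ, hxr] using condition (P := x ≫ d) (Q := n)) :=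
        lift_congr _ (by rw [hπ, hxr]) rfl
    ext
    · simp [comp_lift, comp_lift_assoc, hσ, hτ, reassoc_of% hθ]
    · simp [comp_lift, comp_lift_assoc, hτ, π₂_eq _ p, reassoc_of% hθ, reassoc_of% hir, reassoc_of% H', h₄]
  -- Fullness: `π₁ x d` is invertible, so `τ` alone fixes the map of apices. The work lies in its
  -- compatibility with the right legs, where `σ` enters.
  · let f : x.apex ⟶ x'.apex := inv (π₁ x d) ≫ ap τ ≫ π₁ x' d
    have hfl : f ≫ x'.l = x.l := by
      have := ap_l τ
      rw [comp_l, comp_l] at this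
      simp [f, this]
    have hfr : (f ≫ x'.r ≫ inv d.l) ≫ d.r = (x.r ≫ inv d.l) ≫ d.r := by
      have := ap_r τ
      rw [comp_r, comp_r, hπ, hπ] at this
      rw [← cancel_epi (π₁ x d)]
      simpa [f] using this
    -- The compatibility `w`, evaluated on elements, says that `σ` acts as `f` on the first
    -- component and keeps `z`, so `σ` is determined by `τ`.
    have hσ {V : C} (a : V ⟶ x.apex) (z : V ⟶ n.apex) (h₁ h₂ h₃ h₄) :
        lift (P := x) (Q := c) a (lift (P := d) (a ≫ x.r ≫ inv d.l) z h₁ ≫ i.hom) h₂ ≫ ap σ =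
        lift (P := x') (Q := c) (a ≫ f) (lift (P := d) (a ≫ f ≫ x'.r ≫ inv d.l) z h₃ ≫ i.hom) h₄ := by
      have h₅ : a ≫ x.r = (a ≫ x.r ≫ inv d.l) ≫ d.l := by simp
      have h₆ : (a ≫ f) ≫ x'.r = (a ≫ f ≫ x'.r ≫ inv d.l) ≫ d.l := by simp
      have e₁ : lift (P := x ≫ d) (Q := n) (lift a _ h₅) z (by simpa using h₁) ≫ ap (τ ▷ n) =
          lift (P := x' ≫ d) (lift (a ≫ f) _ h₆) z (by simpa using h₃) := by
        have e₂ : lift a _ h₅ = a ≫ inv (π₁ x d) := (IsIso.eq_comp_inv _).2 (by simp)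
        ext
        · simp [f, e₂]
        · simp [f, e₂, hπ]
        · simp
      have := congrArg (fun t => lift (P := x ≫ d) (lift a _ h₅) z (by simpa using h₁) ≫
        ap t ≫ π₁ (x' ≫ c) p) w
      rw [← hα _ _ _ _ h₆ h₃, ← hα _ _ _ _ h₅ h₁, ← e₁]
      simpa using this
    -- Both maps go to the dependent product, so it suffices to compare evaluations. These are the
    -- right legs of elements of `x ≫ c` and `x' ≫ c`, which `σ` preserves.
    have hr : f ≫ x'.r ≫ inv d.l = x.r ≫ inv d.l := by
      refine hext _ _ hfr fun k a hk hk' => ?_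
      have h₁ : (k ≫ x.r ≫ inv d.l) ≫ d.r = a ≫ n.l := hk'
      have h₂ : ((k ≫ f) ≫ x'.r ≫ inv d.l) ≫ d.r = a ≫ n.l := by simpa using hk
      have := hσ k a h₁ (by simp [hic]) (by simpa using hk) (by simp [hic]) =≫ (x' ≫ c).r
      rw [Category.assoc, ap_r] at this
      simpa [hir] using this.symm
    refine ⟨mk₂ f hfl (by simpa using hr =≫ d.l), ?_, ?_⟩
    · ext
      · simp [f]
      · simp [f, hπ]
    -- Writes the universal element of `x ≫ c` in the form to which `hσ` applies.
    · have hid : lift (P := x) (Q := c) (π₁ x c) (lift (P := d) (π₁ x c ≫ x.r ≫ inv d.l)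
        (π₂ x c ≫ i.inv ≫ π₂ d n) (hz x).2 ≫ i.hom) (by simp [hic]) = 𝟙 _ := by
        ext
        · simp
        · rw [lift_π₂, Category.id_comp, ← Iso.eq_comp_inv]
          ext <;> simp [(hz x).1]
      ext1
      refine (Category.id_comp _).symm.trans (Eq.trans ?_ (Category.id_comp _))
      rw [← hid, hσ _ _ _ _ (by simpa [reassoc_of% hr] using (hz x).2) (by simp [hic])]
      ext
      · simp
      · simp [hr]
  · have := congrArg (fun t => inv (π₁ x d) ≫ ap t ≫ π₁ x' d) h₁
    ext
    simpa using this

/-- Bipullback of a span with invertible left leg against one with powerful left leg: the vertex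
is a dependent product. -/
lemma exists_bipullback {S T Y : Spn C} (p : S ⟶ Y) (n : T ⟶ Y) [IsIso p.l] (hn : Powerful n.l) :
    ∃ (B : Spn C) (d : B ⟶ T) (c : B ⟶ S) (θ : d ≫ n ≅ c ≫ p), IsBipullback θ ∧ IsIso d.l := by
  -- The family multiplied along `n.l` is `n.apex ×_Y S ⟶ n.apex`, where `S` maps to `Y` by `inv p.l
  -- ≫ p.r`.
  obtain ⟨W, ρ, ev, h⟩ := (powerful_iff n.l).1 hn (pullback.snd (inv p.l ≫ p.r) n.r)
  let B : Spn C := ⟨W⟩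
  let d : B ⟶ T := of (X := B) (𝟙 W) ρ
  have hdl : IsIso d.l := inferInstanceAs (IsIso (𝟙 W))
  let e : (d ≫ n).apex ⟶ S.obj := ev ≫ pullback.fst _ _
  obtain ⟨c, θ, hθ⟩ := exists_isBipullback p n d e (by
      have h₁ : ev ≫ pullback.snd _ _ = π₂ d n := h.w
      exact (Category.assoc _ _ _).trans ((congrArg (ev ≫ ·) pullback.condition).trans
        ((Category.assoc _ _ _).symm.trans (congrArg (· ≫ n.r) h₁))))
    (fun {U} u g hg => by
      obtain ⟨w, hw, H⟩ := h.lift u (pullback.lift g (pullback.snd _ _) hg) (pullback.lift_snd _ _ _)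
      refine ⟨w, hw, fun k a hk => ?_⟩
      have := congrArg (· ≫ pullback.fst _ _) (H k a hk)
      simp only [pt_comp, pullback.lift_fst] at this
      exact this)
    (fun {U} w w' hw H => by
      refine h.ext w w' hw fun k a hk hk' => pullback.hom_ext ?_ ?_
      · rw [pt_comp, pt_comp]
        exact H k a hk hk'
      · rw [pt_comp, pt_comp, h.w, pt_snd, pt_snd])
  exact ⟨B, d, c, θ, hθ, hdl⟩

variable (C) in
/-- The bicategory of spans is polynomic. -/
lemma isPolynomic : IsPolynomic (Spn C) where
  equivalence := GF.of_equivalence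
  iso := GF.of_iso
  comp_iff := gf_comp_iff
  gf _ := id
  bipullback p n hp hn := by
    have := (gf_iff p).1 hp
    obtain ⟨B, d, c, θ, h, hd⟩ := exists_bipullback p n (IsRightLifter.powerful hn)
    exact ⟨B, d, c, θ, h, (gf_iff d).2 hd⟩
end
end Spn
end

/-! ### Generalized elements of spans -/

noncomputable section

namespace Spn
open CategoryTheory.Bicategory.PolySpan
section
variable {C : Type u} [Category.{v} C] [HasPullbacks C] {X Y Z : Spn C} {P Q R : X ⟶ Y} {U V : C}

/-- The action of a 2-cell of spans on generalized elements of the apices. -/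
def on (α : P ⟶ Q) (a : U ⟶ P.apex) : U ⟶ Q.apex := a ≫ ap α

/-- The images of a generalized element of the apex of a span. -/
def lg (a : U ⟶ P.apex) : U ⟶ X.obj := a ≫ P.l
def rg (a : U ⟶ P.apex) : U ⟶ Y.obj := a ≫ P.r

@[simp] lemma comp_on (k : V ⟶ U) (α : P ⟶ Q) (a : U ⟶ P.apex) : k ≫ on α a = on α (k ≫ a) :=
  (Category.assoc _ _ _).symm
@[simp] lemma comp_lg (k : V ⟶ U) (a : U ⟶ P.apex) : k ≫ lg a = lg (k ≫ a) :=
  (Category.assoc _ _ _).symm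
@[simp] lemma comp_rg (k : V ⟶ U) (a : U ⟶ P.apex) : k ≫ rg a = rg (k ≫ a) :=
  (Category.assoc _ _ _).symm
@[simp] lemma on_comp (α : P ⟶ Q) (β : Q ⟶ R) (a : U ⟶ P.apex) : on (α ≫ β) a = on β (on α a) := by
  simp [on]
@[simp] lemma on_id (a : U ⟶ P.apex) : on (𝟙 P) a = a := by simp [on]
@[simp] lemma lg_on (α : P ⟶ Q) (a : U ⟶ P.apex) : lg (on α a) = lg a := by simp [on, lg]
@[simp] lemma rg_on (α : P ⟶ Q) (a : U ⟶ P.apex) : rg (on α a) = rg a := by simp [on, rg]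

lemma on_ext {α β : P ⟶ Q} (h : ∀ {U : C} (a : U ⟶ P.apex), on α a = on β a) : α = β := by
  ext
  simpa [on] using h (𝟙 _)

/-- The 2-cell of spans with a given natural action on generalized elements. -/
def ofOn (F : ∀ {U : C}, (U ⟶ P.apex) → (U ⟶ Q.apex)) (_hF : ∀ {U V : C} (k : V ⟶ U) (a : U ⟶ P.apex),
    k ≫ F a = F (k ≫ a)) (hl : ∀ {U : C} (a : U ⟶ P.apex), lg (F a) = lg a)
    (hr : ∀ {U : C} (a : U ⟶ P.apex), rg (F a) = rg a) : P ⟶ Q :=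
  mk₂ (F (𝟙 _)) (by simpa [lg] using hl (𝟙 P.apex)) (by simpa [rg] using hr (𝟙 P.apex))

lemma on_ofOn (F : ∀ {U : C}, (U ⟶ P.apex) → (U ⟶ Q.apex)) (hF : ∀ {U V : C} (k : V ⟶ U)
    (a : U ⟶ P.apex), k ≫ F a = F (k ≫ a)) (hl : ∀ {U : C} (a : U ⟶ P.apex), lg (F a) = lg a)
    (hr : ∀ {U : C} (a : U ⟶ P.apex), rg (F a) = rg a) (a : U ⟶ P.apex) :
    on (ofOn F hF hl hr) a = F a := by
  simp [on, ofOn, hF]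

section
variable {S : Y ⟶ Z}

/-- The components of a generalized element of the apex of a composite. -/
def fs (a : U ⟶ (P ≫ S).apex) : U ⟶ P.apex := a ≫ π₁ P S
def sn (a : U ⟶ (P ≫ S).apex) : U ⟶ S.apex := a ≫ π₂ P S
def pr (a : U ⟶ P.apex) (b : U ⟶ S.apex) (h : rg a = lg b) : U ⟶ (P ≫ S).apex := lift a b h

@[simp] lemma comp_fs (k : V ⟶ U) (a : U ⟶ (P ≫ S).apex) : k ≫ fs a = fs (k ≫ a) :=
  (Category.assoc _ _ _).symm
@[simp] lemma comp_sn (k : V ⟶ U) (a : U ⟶ (P ≫ S).apex) : k ≫ sn a = sn (k ≫ a) :=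
  (Category.assoc _ _ _).symm
@[simp] lemma comp_pr (k : V ⟶ U) (a : U ⟶ P.apex) (b : U ⟶ S.apex) (h : rg a = lg b) :
    k ≫ pr a b h = pr (k ≫ a) (k ≫ b) (by rw [← comp_rg, ← comp_lg, h]) := comp_lift ..
@[simp] lemma fs_pr (a : U ⟶ P.apex) (b : U ⟶ S.apex) (h : rg a = lg b) : fs (pr a b h) = a :=
  lift_π₁ _ _ _
@[simp] lemma sn_pr (a : U ⟶ P.apex) (b : U ⟶ S.apex) (h : rg a = lg b) : sn (pr a b h) = b :=
  lift_π₂ _ _ _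
@[simp] lemma rg_fs (a : U ⟶ (P ≫ S).apex) : rg (fs a) = lg (sn a) := by
  simp [rg, fs, lg, sn, condition]
@[simp] lemma lg_fs (a : U ⟶ (P ≫ S).apex) : lg (fs a) = lg a := by simp [lg, fs]
@[simp] lemma rg_sn (a : U ⟶ (P ≫ S).apex) : rg (sn a) = rg a := by simp [rg, sn]
@[simp] lemma lg_pr (a : U ⟶ P.apex) (b : U ⟶ S.apex) (h : rg a = lg b) : lg (pr a b h) = lg a := by
  rw [← lg_fs, fs_pr]
@[simp] lemma rg_pr (a : U ⟶ P.apex) (b : U ⟶ S.apex) (h : rg a = lg b) : rg (pr a b h) = rg b := by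
  rw [← rg_sn, sn_pr]
lemma pr_ext {a b : U ⟶ (P ≫ S).apex} (h₁ : fs a = fs b) (h₂ : sn a = sn b) : a = b :=
  apex_ext h₁ h₂

variable {P' : X ⟶ Y} {S' : Y ⟶ Z}
@[simp] lemma on_wr (α : P ⟶ P') (a : U ⟶ (P ≫ S).apex) :
    on (α ▷ S) a = pr (on α (fs a)) (sn a) (by simp) :=
  pr_ext (by simp [on, fs, sn, pr, comp_lift]) (by simp [on, fs, sn, pr, comp_lift])
@[simp] lemma on_wl (β : S ⟶ S') (a : U ⟶ (P ≫ S).apex) :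
    on (P ◁ β) a = pr (fs a) (on β (sn a)) (by simp) :=
  pr_ext (by simp [on, fs, sn, pr, comp_lift]) (by simp [on, fs, sn, pr, comp_lift])
@[simp] lemma on_assoc {W : Spn C} {T : Z ⟶ W} (a : U ⟶ ((P ≫ S) ≫ T).apex) :
    on (α_ P S T).hom a = pr (fs (fs a)) (pr (sn (fs a)) (sn a) (by rw [rg_sn, rg_fs])) (by simp) :=
  pr_ext (by simp [on, fs, sn, pr, comp_lift]) (pr_ext (by simp [on, fs, sn, pr, comp_lift]) (by simp [on, fs, sn, pr, comp_lift]))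
@[simp] lemma on_assoc_inv {W : Spn C} {T : Z ⟶ W} (a : U ⟶ (P ≫ S ≫ T).apex) :
    on (α_ P S T).inv a = pr (pr (fs a) (fs (sn a)) (by simp)) (sn (sn a)) (by simp) :=
  pr_ext (pr_ext (by simp [on, fs, sn, pr, comp_lift]) (by simp [on, fs, sn, pr, comp_lift])) (by simp [on, fs, sn, pr, comp_lift])

@[simp] lemma on_left (a : U ⟶ (𝟙 X ≫ P).apex) : on (λ_ P).hom a = sn a := rfl
@[simp] lemma sn_on_left_inv (a : U ⟶ P.apex) : sn (on (λ_ P).inv a) = a := by simp [on, sn]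
end

end
end Spn
end

/-! ### Elements of the effect of a polynomial -/

noncomputable section

namespace CategoryTheory.Diag
open Spn CategoryTheory.Bicategory.PolySpan
section
variable {C : Type u} [Category.{v} C] [HasFiniteLimits C] {X Y Z K L : Spn C} {U V : C}

/-- The polynomial in the bicategory of spans given by a polynomial in the base category. -/
def toPoly (D : Diag X.obj Y.obj) : PolySpan (M := Spn C) GF X Y where
  apex := ⟨D.B⟩
  l := of (X := ⟨D.B⟩) D.f D.s
  r := of (X := ⟨D.B⟩) (𝟙 D.B) D.t
  lifter := Spn.IsRightLifter.of_powerful D.powerful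
  neat_r := (gf_iff _).2 (inferInstanceAs (IsIso (𝟙 D.B)))

section
variable {D : Diag X.obj Y.obj}

/-- Generalized elements of the base and of the total object, as elements of the apices of the legs
of the polynomial. -/
def br (b : U ⟶ D.B) : U ⟶ D.toPoly.r.apex := b
def rb (b : U ⟶ D.toPoly.r.apex) : U ⟶ D.B := b
def le (e : U ⟶ D.E) : U ⟶ D.toPoly.l.apex := e
def ob (b : U ⟶ D.toPoly.apex.obj) : U ⟶ D.B := b

@[simp] lemma comp_br (k : V ⟶ U) (b : U ⟶ D.B) : k ≫ br b = br (k ≫ b) := rfl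
@[simp] lemma comp_rb (k : V ⟶ U) (b : U ⟶ D.toPoly.r.apex) : k ≫ rb b = rb (k ≫ b) := rfl
@[simp] lemma comp_le (k : V ⟶ U) (e : U ⟶ D.E) : k ≫ le e = le (k ≫ e) := rfl
@[simp] lemma rb_br (b : U ⟶ D.B) : rb (br b) = b := rfl
lemma ob_injective {b b' : U ⟶ D.toPoly.apex.obj} (h : ob b = ob b') : b = b' := h
@[simp] lemma ob_lg_le (e : U ⟶ D.E) : ob (lg (le e)) = e ≫ D.f := rfl
@[simp] lemma rg_le (e : U ⟶ D.E) : rg (le e) = e ≫ D.s := rfl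
@[simp] lemma ob_lg_r (b : U ⟶ D.toPoly.r.apex) : ob (lg b) = rb b := Category.comp_id (X := U) (Y := D.B) b
@[simp] lemma rg_r (b : U ⟶ D.toPoly.r.apex) : rg b = rb b ≫ D.t := rfl

variable {x x' : K ⟶ X} {y : K ⟶ Y}

/-- The components of a generalized element of the effect of a polynomial on a span. -/
def xs (a : U ⟶ (D.toPoly.ext x).apex) : U ⟶ (D.toPoly.lifter.rif x).apex :=
  fs (on (D.toPoly.extIso x).inv a)
def xb (a : U ⟶ (D.toPoly.ext x).apex) : U ⟶ D.B := rb (sn (on (D.toPoly.extIso x).inv a))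
lemma ob_rg_xs (a : U ⟶ (D.toPoly.ext x).apex) : ob (rg (xs a)) = xb a := by simp [xs, xb]
-- With `lg` and `xb` this completes the description of an element: a point of `K`, an element `b`
-- of the base, and a function from the fibre over `b` to `x`. The function is evaluated through the
-- counit of the right lifting.
def xv (a : U ⟶ (D.toPoly.ext x).apex) (e : U ⟶ D.E) (h : e ≫ D.f = xb a) : U ⟶ x.apex :=
  on (D.toPoly.lifter.ev x) (pr (xs a) (le e) (ob_injective (by simp [ob_rg_xs, h])))

@[simp] lemma comp_xs (k : V ⟶ U) (a : U ⟶ (D.toPoly.ext x).apex) : k ≫ xs a = xs (k ≫ a) := by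
  simp [xs]
@[simp] lemma comp_xb (k : V ⟶ U) (a : U ⟶ (D.toPoly.ext x).apex) : k ≫ xb a = xb (k ≫ a) := by
  simp [xb]
@[simp] lemma comp_xv (k : V ⟶ U) (a : U ⟶ (D.toPoly.ext x).apex) (e : U ⟶ D.E)
    (h : e ≫ D.f = xb a) : k ≫ xv a e h = xv (k ≫ a) (k ≫ e) (by simp [h]) := by simp [xv]
@[simp] lemma xb_t (a : U ⟶ (D.toPoly.ext x).apex) : xb a ≫ D.t = rg a := by
  rw [xb, ← rg_r, rg_sn, rg_on]
@[simp] lemma lg_xv (a : U ⟶ (D.toPoly.ext x).apex) (e : U ⟶ D.E) (h : e ≫ D.f = xb a) :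
    lg (xv a e h) = lg a := by simp [xv, xs]
@[simp] lemma rg_xv (a : U ⟶ (D.toPoly.ext x).apex) (e : U ⟶ D.E) (h : e ≫ D.f = xb a) :
    rg (xv a e h) = e ≫ D.s := by simp [xv]

@[simp] lemma xb_el (s : K ⟶ D.toPoly.apex) (i : y ⟶ s ≫ D.toPoly.r) (m : s ≫ D.toPoly.l ⟶ x)
    (a : U ⟶ y.apex) : xb (on (D.toPoly.el s i m) a) = rb (sn (on i a)) := by
  rw [xb, ← on_comp, el_extIso_inv]
  simp
lemma xs_el (s : K ⟶ D.toPoly.apex) (i : y ⟶ s ≫ D.toPoly.r) (m : s ≫ D.toPoly.l ⟶ x)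
    (a : U ⟶ y.apex) : xs (on (D.toPoly.el s i m) a) = on (D.toPoly.lifter.desc m) (fs (on i a)) := by
  rw [xs, ← on_comp, el_extIso_inv]
  simp
-- The triangle identity of the right lifting: evaluating the transpose of `m` gives back `m`.
lemma xv_el (s : K ⟶ D.toPoly.apex) (i : y ⟶ s ≫ D.toPoly.r) (m : s ≫ D.toPoly.l ⟶ x)
    (a : U ⟶ y.apex) (e : U ⟶ D.E) (h) (h' : rg (fs (on i a)) = lg (le e)) :
    xv (on (D.toPoly.el s i m) a) e h = on m (pr (fs (on i a)) (le e) h') := by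
  have := congrArg (fun t => on t (pr (fs (on i a)) (le e) h')) (D.toPoly.lifter.desc_ev m)
  simp only [on_comp, on_wr, fs_pr, sn_pr] at this
  simpa only [xv, xs_el] using this

lemma xv_congr {a a' : U ⟶ (D.toPoly.ext x).apex} {e e' : U ⟶ D.E} (h : e ≫ D.f = xb a)
    (ha : a = a') (he : e = e') : xv a e h = xv a' e' (by rw [← ha, ← he, h]) := by
  subst ha he
  rfl

/-- Uniqueness of transposes, applied to generalized elements: a `U`-element of the right lifting is
a 2-cell into it from a span with apex `U`, and such 2-cells agree when their evaluations do. -/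
lemma X_ext {a b : U ⟶ (D.toPoly.ext x).apex} (hl : lg a = lg b) (hb : xb a = xb b)
    (hv : ∀ {V : C} (k : V ⟶ U) (e : V ⟶ D.E) (h : e ≫ D.f = xb (k ≫ a)) (h' : e ≫ D.f = xb (k ≫ b)),
      xv (k ≫ a) e h = xv (k ≫ b) e h') : a = b := by
  -- The hypotheses on `lg` and `xb` make this one span a common source for the 2-cells given by `xs
  -- a` and `xs b`.
  let k : K ⟶ D.toPoly.apex := of (lg (xs a)) (rg (xs a))
  have hs : xs a = xs b := by
    let f : k ⟶ D.toPoly.lifter.rif x := mk₂ (xs a) rfl rfl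
    let g : k ⟶ D.toPoly.lifter.rif x := mk₂ (xs b)
      (show lg (xs b) = lg (xs a) by simp [xs, hl])
      (show rg (xs b) = rg (xs a) from ob_injective (by rw [ob_rg_xs, ob_rg_xs, hb]))
    have hf {V : C} (c : V ⟶ U) : on f c = xs (c ≫ a) := comp_xs c a
    have hg {V : C} (c : V ⟶ U) : on g c = xs (c ≫ b) := comp_xs c b
    suffices f = g from congrArg ap this
    refine D.toPoly.lifter.hom_ext (on_ext fun {V} c => ?_)
    obtain ⟨e, he⟩ : ∃ e : V ⟶ D.E, le e = sn c := ⟨sn c, rfl⟩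
    have h : e ≫ D.f = xb (fs c ≫ a) := by
      rw [← comp_xb, ← ob_rg_xs, ← ob_lg_le, he, ← rg_fs]
      rfl
    have := hv (fs c) e h (by rw [h, ← comp_xb, ← comp_xb, hb])
    rw [on_comp, on_comp, on_wr, on_wr]
    simp only [← he, hf, hg]
    exact this
  rw [← on_id a, ← on_id b, ← (D.toPoly.extIso x).inv_hom_id, on_comp, on_comp]
  congr 1
  exact pr_ext hs hb

variable (U D x) in
/-- The data that determine a generalized element of the effect of a polynomial on a span. -/
structure XFam where
  p : U ⟶ K.obj
  b : U ⟶ D.B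
  g : ∀ {V : C} (k : V ⟶ U) (e : V ⟶ D.E), e ≫ D.f = k ≫ b → (V ⟶ x.apex)
  nat : ∀ {V V' : C} (j : V' ⟶ V) (k : V ⟶ U) (e : V ⟶ D.E) (h : e ≫ D.f = k ≫ b),
    j ≫ g k e h = g (j ≫ k) (j ≫ e) (by rw [Category.assoc, h, Category.assoc])
  lg_g : ∀ {V : C} (k : V ⟶ U) (e : V ⟶ D.E) (h : e ≫ D.f = k ≫ b), lg (g k e h) = k ≫ p
  rg_g : ∀ {V : C} (k : V ⟶ U) (e : V ⟶ D.E) (h : e ≫ D.f = k ≫ b), rg (g k e h) = e ≫ D.s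

lemma XFam.g_congr (F : XFam U D x) {k k' : V ⟶ U} {e e' : V ⟶ D.E} (h : e ≫ D.f = k ≫ F.b)
    (hk : k = k') (he : e = e') : F.g k e h = F.g k' e' (by rw [← hk, ← he, h]) := by
  subst hk he
  rfl

/-- Existence of transposes: the family `F.g` is a 2-cell out of the composite of the span `(F.p,
F.b)` with the left leg. The corresponding element of the effect, evaluated at `𝟙 U`, has the
prescribed components. -/
lemma exists_mkX (F : XFam U D x) : ∃ (a : U ⟶ (D.toPoly.ext x).apex) (_ : lg a = F.p)
    (hb : xb a = F.b), ∀ {V : C} (k : V ⟶ U) (e : V ⟶ D.E) (h : e ≫ D.f = xb (k ≫ a)),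
      xv (k ≫ a) e h = F.g k e (by rw [h, ← comp_xb, hb]) := by
  let k : K ⟶ D.toPoly.apex := of (Y := D.toPoly.apex) F.p F.b
  have hk {V : C} (c : V ⟶ (k ≫ D.toPoly.l).apex) :
      (show V ⟶ D.E from sn c) ≫ D.f = (show V ⟶ U from fs c) ≫ F.b := (rg_fs c).symm
  let μ : k ≫ D.toPoly.l ⟶ x := mk₂ (F.g (π₁ k D.toPoly.l) (π₂ k D.toPoly.l)
    (by simpa [fs, sn] using hk (𝟙 _))) (F.lg_g _ _ _) (F.rg_g _ _ _)
  have hμ {V : C} (c : V ⟶ (k ≫ D.toPoly.l).apex) : on μ c = F.g (fs c) (sn c) (hk c) := F.nat _ _ _ _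
  let y : K ⟶ Y := of F.p (F.b ≫ D.t)
  have hr {V : C} (c : V ⟶ k.apex) : rg c = lg (P := D.toPoly.r) (br (c ≫ F.b)) :=
    (Category.comp_id (c ≫ F.b)).symm
  let i : y ⟶ k ≫ D.toPoly.r := mk₂ (pr (P := k) (S := D.toPoly.r) (𝟙 U) (br (𝟙 U ≫ F.b)) (hr _))
    ((lg_pr ..).trans (Category.id_comp _)) ((rg_pr ..).trans (by simp [y]))
  have hi {V : C} (c : V ⟶ U) : on i c = pr (P := k) (S := D.toPoly.r) c (br (c ≫ F.b)) (hr c) :=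
    (comp_pr _ _ _ _).trans (pr_ext ((fs_pr ..).trans ((Category.comp_id c).trans
        (fs_pr (P := k) (S := D.toPoly.r) c (br (c ≫ F.b)) (hr c)).symm))
      ((sn_pr ..).trans ((congrArg (fun t => br (c ≫ t)) (Category.id_comp F.b)).trans
        (sn_pr (P := k) (S := D.toPoly.r) c (br (c ≫ F.b)) (hr c)).symm)))
  have hc {V : C} (c : V ⟶ U) : c ≫ on (P := y) (D.toPoly.el k i μ) (𝟙 U) =
      on (P := y) (D.toPoly.el k i μ) c :=
    (comp_on _ _ _).trans (congrArg _ (Category.comp_id c))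
  refine ⟨on (P := y) (D.toPoly.el k i μ) (𝟙 U), ?_, ?_, fun c e h => ?_⟩
  · rw [lg_on]
    exact Category.id_comp _
  · rw [xb_el, hi]
    simp
  · have h₁ : rg (P := k) c = lg (le e) := ob_injective (by
      rw [ob_lg_le, h, hc, xb_el, hi]
      simp [k, rg]
      rfl)
    refine (xv_congr h (hc c) rfl).trans ((xv_el k i μ c e _ (by rwa [hi, fs_pr])).trans ?_)
    rw [hμ]
    refine F.g_congr _ ?_ ?_
    · rw [fs_pr, hi, fs_pr]
    · rw [sn_pr]
      rfl

def mkX (F : XFam U D x) : U ⟶ (D.toPoly.ext x).apex := (exists_mkX F).choose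
@[simp] lemma lg_mkX (F : XFam U D x) : lg (mkX F) = F.p := (exists_mkX F).choose_spec.choose
@[simp] lemma xb_mkX (F : XFam U D x) : xb (mkX F) = F.b :=
  (exists_mkX F).choose_spec.choose_spec.choose
@[simp] lemma rg_mkX (F : XFam U D x) : rg (mkX F) = F.b ≫ D.t := by rw [← xb_t, xb_mkX]
@[simp] lemma lg_comp_mkX (F : XFam U D x) (k : V ⟶ U) : lg (k ≫ mkX F) = k ≫ F.p := by
  rw [← comp_lg, lg_mkX]
@[simp] lemma xb_comp_mkX (F : XFam U D x) (k : V ⟶ U) : xb (k ≫ mkX F) = k ≫ F.b := by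
  rw [← comp_xb, xb_mkX]
@[simp] lemma xv_comp_mkX (F : XFam U D x) (k : V ⟶ U) (e : V ⟶ D.E)
    (h : e ≫ D.f = xb (k ≫ mkX F)) : xv (k ≫ mkX F) e h = F.g k e (by rw [h]; simp) :=
  (exists_mkX F).choose_spec.choose_spec.choose_spec k e h
@[simp] lemma xv_mkX (F : XFam U D x) (e : U ⟶ D.E) (h : e ≫ D.f = xb (mkX F)) :
    xv (mkX F) e h = F.g (𝟙 U) e (by rw [h]; simp) :=
  (xv_congr h (Category.id_comp _).symm rfl).trans (xv_comp_mkX F (𝟙 U) e (by simp [h]))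
@[simp] lemma xb_comp_comp_mkX {V' : C} (F : XFam U D x) (j : V' ⟶ V) (k : V ⟶ U) :
    xb (j ≫ k ≫ mkX F) = j ≫ k ≫ F.b := by rw [← comp_xb, xb_comp_mkX]
@[simp] lemma xv_comp_comp_mkX {V' : C} (F : XFam U D x) (j : V' ⟶ V) (k : V ⟶ U) (e : V' ⟶ D.E)
    (h : e ≫ D.f = xb (j ≫ k ≫ mkX F)) :
    xv (j ≫ k ≫ mkX F) e h = F.g (j ≫ k) e (by rw [h]; simp) :=
  (xv_congr h (Category.assoc _ _ _).symm rfl).trans (xv_comp_mkX F (j ≫ k) e (by simp [h]))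

@[simp] lemma xb_extMap (g : x ⟶ x') (a : U ⟶ (D.toPoly.ext x).apex) :
    xb (on (D.toPoly.extMap g) a) = xb a := xb_el _ _ _ _
@[simp] lemma xv_extMap (g : x ⟶ x') (a : U ⟶ (D.toPoly.ext x).apex) (e : U ⟶ D.E)
    (h : e ≫ D.f = xb (on (D.toPoly.extMap g) a)) :
    xv (on (D.toPoly.extMap g) a) e h = on g (xv a e (by simp [h])) := by
  refine (xv_el _ _ _ _ e h (ob_injective (by rw [ob_lg_le, h, xb_extMap]; simp [xb]))).trans ?_
  rw [on_comp]
  rfl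
@[simp] lemma xb_reindex (k : L ⟶ K) (a : U ⟶ (k ≫ D.toPoly.ext x).apex) :
    xb (on (D.toPoly.reindex k x) a) = xb (sn a) := by
  refine (xb_el _ _ _ _).trans ?_
  simp [xb]
@[simp] lemma xv_reindex (k : L ⟶ K) (a : U ⟶ (k ≫ D.toPoly.ext x).apex) (e : U ⟶ D.E)
    (h : e ≫ D.f = xb (on (D.toPoly.reindex k x) a)) :
    xv (on (D.toPoly.reindex k x) a) e h = pr (fs a) (xv (sn a) e (by simp [h])) (by simp) := by
  refine (xv_el _ _ _ _ e h (ob_injective (by rw [ob_lg_le, h, xb_reindex]; simp [xb]))).trans ?_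
  simp [xv, xs]
end

end
end CategoryTheory.Diag
end

/-! ### Morphisms of polynomials as polynomial morphisms in spans -/

noncomputable section

namespace CategoryTheory.Diag
open Spn CategoryTheory.Bicategory.PolySpan
section
variable {C : Type u} [Category.{v} C] [HasPullbacks C] {A B : C} (φ : A ⟶ B)

/-- The graph of a morphism. -/
def graphIso : A ≅ pullback φ (𝟙 B) := (asIso (pullback.fst φ (𝟙 B))).symm

lemma graphIso_fst : (graphIso φ).hom ≫ pullback.fst φ (𝟙 B) = 𝟙 A := by simp [graphIso]
lemma graphIso_snd : (graphIso φ).hom ≫ pullback.snd φ (𝟙 B) = φ := by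
  rw [graphIso, Iso.symm_hom, asIso_inv, IsIso.inv_comp_eq, pullback.condition, Category.comp_id]
end

section
variable {C : Type u} [Category.{v} C] [HasFiniteLimits C] {X Y Z K L : Spn C} {U V : C}
  {D D' D'' : Diag X.obj Y.obj}

/-- The polynomial morphism in spans given by a morphism of polynomials. -/
def toMor (α : D ⟶ D') : Mor D.toPoly D'.toPoly where
  h := of (X := ⟨D.B⟩) (Y := ⟨D'.B⟩) (𝟙 D.B) (Hom.base α)
  lam := mk₂ (Hom.fib α) ((Hom.fib_f α).trans (Category.comp_id _).symm) (Hom.fib_s α)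
  rho := mkIso (graphIso (Hom.base α))
    ((Category.assoc _ _ _).symm.trans ((congrArg (· ≫ 𝟙 D.B) (graphIso_fst _)).trans
      (Category.comp_id (𝟙 D.B))))
    ((Category.assoc _ _ _).symm.trans ((congrArg (· ≫ D'.t) (graphIso_snd _)).trans
      (Hom.base_t α)))

/-- A generalized element of the base, as an element of the apex of the underlying 1-cell. -/
def hb (α : D ⟶ D') (b : U ⟶ D.B) : U ⟶ (toMor α).h.apex := b

/-- The right-hand 2-cell identifies the base with the graph of the map of bases, so it sends `b` to
`b` paired with its image. -/
lemma on_rho (α : D ⟶ D') (b : U ⟶ D.B) : on (toMor α).rho.hom (br b) =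
    pr (hb α b) (br (Hom.bs α b)) (ob_injective (by rw [ob_lg_r, rb_br]; rfl)) := by
  apply pr_ext
  · rw [fs_pr]
    exact (Category.assoc _ _ _).trans
      ((congrArg (b ≫ ·) (graphIso_fst _)).trans (Category.comp_id b))
  · rw [sn_pr]
    exact (Category.assoc _ _ _).trans (congrArg (b ≫ ·) (graphIso_snd _))

lemma on_lam (α : D ⟶ D') (b : U ⟶ D.B) (e : U ⟶ D'.E) (h : e ≫ D'.f = Hom.bs α b)
    (h' : rg (hb α b) = lg (le e)) :
    on (toMor α).lam (pr (hb α b) (le e) h') = le (Hom.at' α b e h) := rfl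

/-- The 2-cell of polynomials in spans given by a morphism of polynomials. -/
def mapPoly (α : D ⟶ D') : D.toPoly ⟶ D'.toPoly := (toMor α).cls

variable {x : K ⟶ X}

@[simp] lemma xb_cext (α : D ⟶ D') (a : U ⟶ (D.toPoly.ext x).apex) :
    xb (on (cext (mapPoly α) x) a) = Hom.bs α (xb a) := by
  refine (xb_el _ _ _ _).trans ?_
  have : sn (on (D.toPoly.extIso x).inv a) = br (xb a) := rfl
  simp [this, on_rho]
@[simp] lemma xv_cext (α : D ⟶ D') (a : U ⟶ (D.toPoly.ext x).apex) (e : U ⟶ D'.E)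
    (h : e ≫ D'.f = xb (on (cext (mapPoly α) x) a)) :
    xv (on (cext (mapPoly α) x) a) e h = xv a (Hom.at' α (xb a) e (by simp [h])) (by simp) := by
  refine (xv_el _ _ _ _ e h (ob_injective
    (by rw [rg_fs, ob_lg_r, ob_lg_le, h]; exact (xb_el _ _ _ _).symm))).trans ?_
  have h₁ : sn (on (D.toPoly.extIso x).inv a) = br (xb a) := rfl
  have h₂ : e ≫ D'.f = Hom.bs α (xb a) := by simp [h]
  simp [h₁, on_rho, on_lam _ _ _ h₂]
  rfl

/-- Effects are faithful, and on components the effect of `mapPoly α` is `Hom.bs α` on the base and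
precomposition with `Hom.at' α` on functions. Functoriality is thus that of these two actions. -/
lemma mapPoly_id (D : Diag X.obj Y.obj) : mapPoly (𝟙 D) = 𝟙 D.toPoly :=
  cext_injective D.toPoly.neat_r (on_ext fun a => X_ext (by simp) (by simp) (by simp))

lemma mapPoly_comp (α : D ⟶ D') (β : D' ⟶ D'') : mapPoly (α ≫ β) = mapPoly α ≫ mapPoly β :=
  cext_injective D''.toPoly.neat_r (on_ext fun a => X_ext (by simp) (by simp) (by simp))

end
end CategoryTheory.Diag
end

/-! ### The equivalence of hom-categories -/

noncomputable section

namespace CategoryTheory.Bicategory.PolySpan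
variable {M : Type u} [Bicategory.{w, v} M] {neat : ∀ {X Y : M}, (X ⟶ Y) → Prop} {X Y : M}

/-- A Yoneda argument: a polynomial morphism sends the generic element to the element presented by
its own three components. When two presentations give equal elements, the groupoid fibration `Q.r`
supplies a connecting 2-cell. -/
lemma hom_ext_gen {P Q : PolySpan neat X Y} (hq : GF Q.r) {f g : P ⟶ Q}
    (h : P.gen ≫ cext f P.l = P.gen ≫ cext g P.l) : f = g := by
  induction f using ind with | h f => ?_
  induction g using ind with | h g => ?_
  simp only [Mor.cext_cls, gen_ext] at h
  obtain ⟨σ, h1, h2⟩ := exists_of_el_eq hq h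
  exact Quot.sound ⟨σ, h2, h1⟩

/-- Polynomials with the same left leg and isomorphic right legs are isomorphic. -/
def isoOfRight {A : M} {l : A ⟶ X} {r r' : A ⟶ Y} (hl : IsRightLifter l) (hr : neat r)
    (hr' : neat r') (i : r ≅ r') : (⟨A, l, r, hl, hr⟩ : PolySpan neat X Y) ≅ ⟨A, l, r', hl, hr'⟩ where
  hom := Mor.cls ⟨𝟙 A, (λ_ l).hom, i ≪≫ (λ_ r').symm⟩
  inv := Mor.cls ⟨𝟙 A, (λ_ l).hom, i.symm ≪≫ (λ_ r).symm⟩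
  hom_inv_id := Quot.sound ⟨(λ_ (𝟙 A)).hom, by
    simp [Mor.comp, Mor.id, unitors_equal, ← triangle_assoc],
    by simp [Mor.comp, Mor.id]⟩
  inv_hom_id := Quot.sound ⟨(λ_ (𝟙 A)).hom, by
    simp [Mor.comp, Mor.id, unitors_equal, ← triangle_assoc],
    by simp [Mor.comp, Mor.id]⟩

end CategoryTheory.Bicategory.PolySpan

namespace CategoryTheory.Diag
open Spn CategoryTheory.Bicategory.PolySpan
section
variable {C : Type u} [Category.{v} C] [HasFiniteLimits C] {X Y Z K L : Spn C} {U V : C}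
  {D D' D'' : Diag X.obj Y.obj}

/-- Elements of the apex of the left leg, as generalized elements of the total object. -/
def ue (c : U ⟶ D.toPoly.l.apex) : U ⟶ D.E := c
@[simp] lemma comp_ue (k : V ⟶ U) (c : U ⟶ D.toPoly.l.apex) : k ≫ ue c = ue (k ≫ c) := rfl
@[simp] lemma ue_le (e : U ⟶ D.E) : ue (le e) = e := rfl
@[simp] lemma le_ue (c : U ⟶ D.toPoly.l.apex) : le (ue c) = c := rfl
@[simp] lemma ue_f (c : U ⟶ D.toPoly.l.apex) : ue c ≫ D.f = ob (lg c) := rfl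
@[simp] lemma ue_s (c : U ⟶ D.toPoly.l.apex) : ue c ≫ D.s = rg c := rfl

/-- The generic element at a generalized element of the base. -/
def gn (b : U ⟶ D.B) : U ⟶ (D.toPoly.ext D.toPoly.l).apex := on D.toPoly.gen (br b)

@[simp] lemma comp_gn (k : V ⟶ U) (b : U ⟶ D.B) : k ≫ gn b = gn (k ≫ b) := by simp [gn]
@[simp] lemma xb_gn (b : U ⟶ D.B) : xb (gn b) = b := (xb_el _ _ _ _).trans (by simp)
-- The generic element over `b` carries the identity function of the fibre over `b`.
@[simp] lemma xv_gn (b : U ⟶ D.B) (e : U ⟶ D.E) (h : e ≫ D.f = xb (gn b)) :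
    xv (gn b) e h = le e := by
  refine (xv_el _ _ _ _ e h (ob_injective (by
    rw [rg_fs, ob_lg_r, sn_on_left_inv, ob_lg_le, h, xb_gn, rb_br]))).trans ?_
  simp
@[simp] lemma ob_lg_gn (b : U ⟶ D.B) : ob (lg (gn b)) = b := by simp [gn]
@[simp] lemma rg_gn (b : U ⟶ D.B) : rg (gn b) = b ≫ D.t := by simp [gn]

/-- The morphism of polynomials underlying a 2-cell of polynomials in spans. -/
def unmap (f : D.toPoly ⟶ D'.toPoly) : Fam D D' where
  b b := xb (on (cext f D.toPoly.l) (gn b))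
  comp_b _ _ := by simp
  b_t _ := by simp
  a b e h := ue (xv (on (cext f D.toPoly.l) (gn b)) e h)
  comp_a _ _ _ _ := by simp
  a_f b e h := by simp
  a_s b e h := by simp

/-- Images of the generic elements determine a 2-cell. Their components are the map of bases and,
since the function starts as the identity, the map of fibres; `unmap` reads off precisely these. -/
lemma mapPoly_unmap (f : D.toPoly ⟶ D'.toPoly) : mapPoly (unmap f).toHom = f := by
  refine hom_ext_gen D'.toPoly.neat_r (on_ext fun a => ?_)
  obtain ⟨b, rfl⟩ : ∃ b, br b = a := ⟨rb a, rfl⟩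
  rw [on_comp, on_comp]
  change on _ (gn b) = on _ (gn b)
  refine X_ext (by simp) (by simp [Fam.toHom_bs, unmap]) fun k e h₁ h₂ => ?_
  simp [Fam.toHom_at, unmap]

variable (X Y) in
/-- The comparison functor between categories of polynomials. -/
def polyFunctor : Diag X.obj Y.obj ⥤ PolySpan (M := Spn C) GF X Y where
  obj D := D.toPoly
  map α := mapPoly α
  map_id := mapPoly_id
  map_comp := mapPoly_comp

instance : (polyFunctor X Y).Faithful where
  map_injective {D D' α β} h := by
    have h : mapPoly α = mapPoly β := h
    have hp {U : C} (b : U ⟶ D.B) : on (cext (mapPoly α) D.toPoly.l) (gn b) =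
      on (cext (mapPoly β) D.toPoly.l) (gn b) := by rw [h]
    -- The image of the generic element shows the action on bases as `xb` and the action on fibres
    -- as `xv`.
    refine hom_ext (fun b => by simpa using congrArg xb (hp b)) fun b e h₁ h₂ => ?_
    have := xv_congr (e := e) (by simpa using h₁) (hp b) rfl
    simpa using congrArg ue this

instance : (polyFunctor X Y).Full where
  map_surjective f := ⟨(unmap f).toHom, mapPoly_unmap f⟩

instance : (polyFunctor X Y).EssSurj where
  mem_essImage P := by
    have := (gf_iff P.r).1 P.neat_r
    -- The left leg `P.r.l` is invertible because `P.r` is a groupoid fibration. Transporting the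
    -- apex of `P.r` along it turns `P.r` into a morphism of `C`.
    let D : Diag X.obj Y.obj := ⟨P.l.apex, P.apex.obj, P.l.r, P.l.l, inv P.r.l ≫ P.r.r, Spn.IsRightLifter.powerful P.lifter⟩
    exact ⟨D, ⟨isoOfRight _ _ _ (mkIso (asIso P.r.l).symm (by simp) (by simp [D]))⟩⟩

instance : (polyFunctor X Y).IsEquivalence where

end
end CategoryTheory.Diag
end

/-! ### Composition of polynomials and of effects -/

noncomputable section

namespace CategoryTheory.Diag
open Spn CategoryTheory.Bicategory.PolySpan
section
variable {C : Type u} [Category.{v} C] [HasFiniteLimits C] {X Y Z K L : Spn C} {U V V' : C}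
  {P : Diag X.obj Y.obj} {Q : Diag Y.obj Z.obj} {x x' : K ⟶ X}

/-- The data comparing the effect of a composite with the composite of effects. -/
def phX (a : U ⟶ ((P.comp Q).toPoly (X := X) (Y := Z).ext x).apex) (d : U ⟶ Q.E)
    (h : d ≫ Q.f = rr (xb a)) : XFam U P x where
  p := lg a
  b := ev (xb a) d h
  g k e h' := xv (k ≫ a) (tri (xb (k ≫ a)) (k ≫ d) e (by simp [h]) (by simp [h'])) (by simp)
  nat _ _ _ _ := by simp
  lg_g _ _ _ := by simp
  rg_g _ _ _ := by simp
@[simp] lemma phX_p (a : U ⟶ ((P.comp Q).toPoly (X := X) (Y := Z).ext x).apex) (d : U ⟶ Q.E)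
    (h : d ≫ Q.f = rr (xb a)) : (phX a d h).p = lg a := rfl
@[simp] lemma phX_b (a : U ⟶ ((P.comp Q).toPoly (X := X) (Y := Z).ext x).apex) (d : U ⟶ Q.E)
    (h : d ≫ Q.f = rr (xb a)) : (phX a d h).b = ev (xb a) d h := rfl
@[simp] lemma phX_g (a : U ⟶ ((P.comp Q).toPoly (X := X) (Y := Z).ext x).apex) (d : U ⟶ Q.E)
    (h : d ≫ Q.f = rr (xb a)) (k : V ⟶ U) (e : V ⟶ P.E) (h' : e ≫ P.f = k ≫ (phX a d h).b) :
    (phX a d h).g k e h' =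
      xv (k ≫ a) (tri (xb (k ≫ a)) (k ≫ d) e (by simp [h]) (by simp [h'])) (by simp) := rfl
@[simp] lemma comp_phX (a : U ⟶ ((P.comp Q).toPoly (X := X) (Y := Z).ext x).apex) (d : U ⟶ Q.E)
    (h : d ≫ Q.f = rr (xb a)) (k : V ⟶ U) :
    k ≫ mkX (phX a d h) = mkX (phX (k ≫ a) (k ≫ d) (by simp [h])) :=
  X_ext (by simp) (by simp) (by simp)

/-- Currying: a function on pairs `(d, e)` becomes a function of `d` with values in elements of the
effect of `P`, whose base component is `ev (xb a) d`. -/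
def phY (a : U ⟶ ((P.comp Q).toPoly (X := X) (Y := Z).ext x).apex) : XFam U Q (P.toPoly.ext x) where
  p := lg a
  b := rr (xb a)
  g k d h := mkX (phX (k ≫ a) d (by simp [h]))
  nat _ _ _ _ := by simp
  lg_g _ _ _ := by simp
  rg_g _ _ _ := by simp
@[simp] lemma phY_p (a : U ⟶ ((P.comp Q).toPoly (X := X) (Y := Z).ext x).apex) :
    (phY a).p = lg a := rfl
@[simp] lemma phY_b (a : U ⟶ ((P.comp Q).toPoly (X := X) (Y := Z).ext x).apex) :
    (phY a).b = rr (xb a) := rfl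
@[simp] lemma phY_g (a : U ⟶ ((P.comp Q).toPoly (X := X) (Y := Z).ext x).apex) (k : V ⟶ U)
    (d : V ⟶ Q.E) (h : d ≫ Q.f = k ≫ (phY a).b) :
    (phY a).g k d h = mkX (phX (k ≫ a) d (by simp [h])) := rfl

/-- First half of uncurrying: forgetting the inner functions leaves the base component of `P` as a
function of `d`, which is an element of the dependent product underlying `P.comp Q`. The inner
functions are put back in `psX`. -/
def psW (a : U ⟶ (Q.toPoly.ext (P.toPoly.ext x)).apex) : WFam P Q U where
  u := xb a
  g k d h := xb (xv (k ≫ a) d (by simp [h]))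
  nat _ _ _ _ := by simp
  g_t _ _ _ := by simp
@[simp] lemma psW_u (a : U ⟶ (Q.toPoly.ext (P.toPoly.ext x)).apex) : (psW a).u = xb a := rfl
@[simp] lemma psW_g (a : U ⟶ (Q.toPoly.ext (P.toPoly.ext x)).apex) (k : V ⟶ U)
    (d : V ⟶ Q.E) (h : d ≫ Q.f = k ≫ (psW a).u) :
    (psW a).g k d h = xb (xv (k ≫ a) d (by simp [h])) := rfl
def psX (a : U ⟶ (Q.toPoly.ext (P.toPoly.ext x)).apex) :
    XFam (X := X) (Y := Z) U (P.comp Q) x where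
  p := lg a
  b := mkW (psW a)
  g k c h := xv (xv (k ≫ a) (cd c) (by simp [h])) (ce c) (by simp [h])
  nat _ _ _ _ := by simp
  lg_g _ _ _ := by simp
  rg_g _ _ _ := by simp
@[simp] lemma psX_p (a : U ⟶ (Q.toPoly.ext (P.toPoly.ext x)).apex) : (psX a).p = lg a := rfl
@[simp] lemma psX_b (a : U ⟶ (Q.toPoly.ext (P.toPoly.ext x)).apex) : (psX a).b = mkW (psW a) := rfl
@[simp] lemma psX_g (a : U ⟶ (Q.toPoly.ext (P.toPoly.ext x)).apex) (k : V ⟶ U)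
    (c : V ⟶ (P.comp Q).E) (h : c ≫ (P.comp Q).f = k ≫ (psX a).b) :
    (psX a).g k c h = xv (xv (k ≫ a) (cd c) (by simp [h])) (ce c) (by simp [h]) := rfl

@[simp] lemma comp_phY (k : V ⟶ U) (a : U ⟶ ((P.comp Q).toPoly (X := X) (Y := Z).ext x).apex) :
    k ≫ mkX (phY a) = mkX (phY (k ≫ a)) := X_ext (by simp) (by simp) (by simp)
@[simp] lemma comp_psX (k : V ⟶ U) (a : U ⟶ (Q.toPoly.ext (P.toPoly.ext x)).apex) :
    k ≫ mkX (psX a) = mkX (psX (k ≫ a)) :=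
  X_ext (by simp) (by simpa using W_ext (by simp) (by simp)) (by simp)
lemma rg_phY (a : U ⟶ ((P.comp Q).toPoly (X := X) (Y := Z).ext x).apex) : rg (mkX (phY a)) = rg a := by
  rw [rg_mkX, phY_b, ← comp_t, xb_t]

variable (P Q x) in
/-- The comparison between the effect of a composite and the composite of effects. -/
def ph : (P.comp Q).toPoly (X := X) (Y := Z).ext x ⟶ Q.toPoly.ext (P.toPoly.ext x) :=
  ofOn (fun a => mkX (phY a)) comp_phY (by simp) rg_phY

variable (P Q x) in
def ps : Q.toPoly.ext (P.toPoly.ext x) ⟶ (P.comp Q).toPoly (X := X) (Y := Z).ext x :=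
  ofOn (fun a => mkX (psX a)) comp_psX (by simp) (by simp)

@[simp] lemma on_ph (a : U ⟶ ((P.comp Q).toPoly (X := X) (Y := Z).ext x).apex) :
    on (ph P Q x) a = mkX (phY a) := on_ofOn _ comp_phY (by simp) rg_phY a
@[simp] lemma on_ps (a : U ⟶ (Q.toPoly.ext (P.toPoly.ext x)).apex) :
    on (ps P Q x) a = mkX (psX a) := on_ofOn _ comp_psX (by simp) (by simp) a

/-- Currying and uncurrying are inverse; in either order all components agree. -/
lemma ph_ps : ph P Q x ≫ ps P Q x = 𝟙 _ := on_ext fun a =>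
  X_ext (by simp) (by simpa using W_ext (by simp) (by simp)) fun k e h h' => by
    have h₂ : e ≫ (P.comp Q).f = xb (k ≫ a) := by simpa using h'
    simp [h₂]
lemma ps_ph : ps P Q x ≫ ph P Q x = 𝟙 _ := on_ext fun a =>
  X_ext (by simp) (by simp) fun k d h h' =>
    X_ext (by simp) (by simp) (by simp)

instance : IsIso (ph P Q x) := ⟨ps P Q x, ph_ps, ps_ph⟩

lemma ph_naturality (g : x ⟶ x') : (P.comp Q).toPoly (X := X) (Y := Z).extMap g ≫ ph P Q x' =
    ph P Q x ≫ Q.toPoly.extMap (P.toPoly.extMap g) := on_ext fun a =>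
  X_ext (by simp) (by simp) fun k d h h' => X_ext (by simp) (by simp) (by simp)

/-- Currying does not touch the component in `K`, so it commutes with change of parameter. This
makes `ph` eligible to come from a 2-cell of polynomials. -/
lemma ph_reindex (k : L ⟶ K) (x : K ⟶ X) :
    k ◁ ph P Q x ≫ Q.toPoly.reindex k _ ≫ Q.toPoly.extMap (P.toPoly.reindex k x) =
      (P.comp Q).toPoly (X := X) (Y := Z).reindex k x ≫ ph P Q (k ≫ x) := on_ext fun a =>
  X_ext (by simp) (by simp) fun k d h h' => X_ext (by simp) (by simp) (by simp)

end
end CategoryTheory.Diag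
end

/-! ### Identity polynomials and structure cells on elements -/

noncomputable section

namespace CategoryTheory.Diag
open Spn CategoryTheory.Bicategory.PolySpan
section
variable {C : Type u} [Category.{v} C] [HasFiniteLimits C] {W X Y Z K L : Spn C} {U V : C}

section
variable {x x' : K ⟶ X}

lemma oE_rg_f (a : U ⟶ ((one X.obj).toPoly.ext x).apex) : oE (rg a) ≫ (one X.obj).f = xb a := by
  rw [oE_f, ← xb_t, oB_eta]
@[simp] lemma oB_rg (a : U ⟶ ((one X.obj).toPoly.ext x).apex) : oB (rg a) = xb a := by
  rw [← xb_t, oB_eta]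

/-- The data comparing the effect of the identity polynomial with the identity. -/
def uX (c : U ⟶ x.apex) : XFam (X := X) (Y := X) U (one X.obj) x where
  p := lg c
  b := oB (rg c)
  g k _ _ := k ≫ c
  nat _ _ _ _ := by simp
  lg_g _ _ _ := by simp
  rg_g k e h := by rw [one_eq h]; simp
@[simp] lemma uX_p (c : U ⟶ x.apex) : (uX c).p = lg c := rfl
@[simp] lemma uX_b (c : U ⟶ x.apex) : (uX c).b = oB (rg c) := rfl
@[simp] lemma uX_g (c : U ⟶ x.apex) (k : V ⟶ U) (e : V ⟶ (one X.obj).E)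
    (h : e ≫ (one X.obj).f = k ≫ (uX c).b) : (uX c).g k e h = k ≫ c := rfl
@[simp] lemma comp_uX (k : V ⟶ U) (c : U ⟶ x.apex) : k ≫ mkX (uX c) = mkX (uX (k ≫ c)) :=
  X_ext (by simp) (by simp) (by simp)

variable (x) in
/-- The comparison between the effect of the identity polynomial and the identity. -/
def un : (one X.obj).toPoly.ext x ⟶ x :=
  ofOn (fun a => xv a (oE (rg a)) (oE_rg_f a)) (by simp) (by simp) (by simp)
@[simp] lemma on_un (a : U ⟶ ((one X.obj).toPoly.ext x).apex) :
    on (un x) a = xv a (oE (rg a)) (oE_rg_f a) := on_ofOn _ (by simp) (by simp) (by simp) a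

variable (x) in
/-- The inverse of the comparison `un`. -/
def nu : x ⟶ (one X.obj).toPoly.ext x := ofOn (fun c => mkX (uX c)) comp_uX (by simp) (by simp)
@[simp] lemma on_nu (c : U ⟶ x.apex) : on (nu x) c = mkX (uX c) :=
  on_ofOn _ comp_uX (by simp) (by simp) c

instance : IsIso (un x) :=
  ⟨nu x, on_ext fun a => by
    rw [on_comp, on_nu, on_id]
    -- A fibre of the identity polynomial has a single element, so a function on it is its value
    -- there.
    exact X_ext (by simp) (by simp) fun k e h h' => by
      obtain rfl := one_eq h'
      simp, on_ext fun c => by simp⟩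

lemma un_naturality (g : x ⟶ x') : (one X.obj).toPoly.extMap g ≫ un x' = un x ≫ g :=
  on_ext fun a => by simp

lemma un_reindex (k : L ⟶ K) (x : K ⟶ X) :
    k ◁ un x = (one X.obj).toPoly.reindex k x ≫ un (k ≫ x) :=
  on_ext fun a => by simp
end

section
variable {P P' : Diag X.obj Y.obj} {Q Q' : Diag Y.obj Z.obj} (x : K ⟶ X)

/-- This and the next four identities are the element forms of the coherence conditions in
`PseudoOver`. In each, the structure cell of diagrams becomes the evident rearrangement of nested
functions. -/
lemma wl_ph (P : Diag X.obj Y.obj) (β : Q ⟶ Q') :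
    cext (mapPoly (X := X) (Y := Z) (wlH P β)) x ≫ ph P Q' x =
      ph P Q x ≫ cext (mapPoly β) (P.toPoly.ext x) := on_ext fun a =>
  X_ext (by simp) (by simp) fun k d h h' => X_ext (by simp) (by simp) (by simp)

lemma wr_ph (α : P ⟶ P') (Q : Diag Y.obj Z.obj) :
    cext (mapPoly (X := X) (Y := Z) (wrH α Q)) x ≫ ph P' Q x =
      ph P Q x ≫ Q.toPoly.extMap (cext (mapPoly α) x) := on_ext fun a =>
  X_ext (by simp) (by simp) fun k d h h' => X_ext (by simp) (by simp) (by simp)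

lemma as_ph (P : Diag X.obj Y.obj) (Q : Diag Y.obj Z.obj) (R : Diag Z.obj W.obj) :
    cext (mapPoly (X := X) (Y := W) (asH P Q R)) x ≫ ph (Y := Y) P (Q.comp R) x ≫
      ph Q R (P.toPoly.ext x) =
    ph (Y := Z) (P.comp Q) R x ≫ R.toPoly.extMap (ph P Q x) := on_ext fun a =>
  -- One extensionality step for each of the three polynomials applied in succession.
  X_ext (by simp) (by simp) fun k d h h' => X_ext (by simp) (by simp) fun k d h h' =>
    X_ext (by simp) (by simp) (by simp)

lemma lu_ph (P : Diag X.obj Y.obj) : cext (mapPoly (X := X) (Y := Y) (luH P)) x =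
    ph (Y := X) (one X.obj) P x ≫ P.toPoly.extMap (un x) := on_ext fun a =>
  X_ext (by simp) (by simp) fun k d h h' => by simp

lemma ru_ph (P : Diag X.obj Y.obj) : cext (mapPoly (X := X) (Y := Y) (ruH P)) x =
    ph (Y := Y) P (one Y.obj) x ≫ un (P.toPoly.ext x) := on_ext fun a =>
  X_ext (by simp) (by simp) fun k d h h' => by simp [← Category.assoc]
end
end
end CategoryTheory.Diag

/-! ### Composites and identities recognized by their effects -/

namespace CategoryTheory.Bicategory.PolySpan
variable {M : Type u} [Bicategory.{w, v} M] {neat : ∀ {X Y : M}, (X ⟶ Y) → Prop} {X Y Z : M}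
  (h : IsCalibration neat)

/-- The canonical comparison `φ` is invertible, natural and compatible with reindexing, so `n`
followed by its inverse is a family of the kind that comes from an isomorphism of polynomials. No
chosen bipullback has to be unfolded. -/
lemma exists_iso_comp {R : PolySpan neat X Z} {P : PolySpan neat X Y} {Q : PolySpan neat Y Z}
    (n : ∀ (K : M) (x : K ⟶ X), R.ext x ⟶ Q.ext (P.ext x)) [∀ (K : M) (x : K ⟶ X), IsIso (n K x)]
    (nat : ∀ (K : M) {x x' : K ⟶ X} (g : x ⟶ x'),
      R.extMap g ≫ n K x' = n K x ≫ Q.extMap (P.extMap g))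
    (re : ∀ (K L : M) (k : L ⟶ K) (x : K ⟶ X), k ◁ n K x ≫ Q.reindex k _ ≫
      Q.extMap (P.reindex k x) = R.reindex k x ≫ n L (k ≫ x)) :
    ∃ f : R ≅ PolySpan.comp h P Q, ∀ (K : M) (x : K ⟶ X), cext f.hom x ≫ φ h P Q x = n K x := by
  obtain ⟨f, hf⟩ := exists_iso h (Q := PolySpan.comp h P Q) (fun K x => n K x ≫ inv (φ h P Q x))
    (fun K x x' g => by
      rw [← cancel_mono (φ h P Q x')]
      simp [φ_naturality, nat])
    (fun K L k x => by
      rw [← cancel_mono (φ h P Q _)]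
      rw [Category.assoc, ← φ_reindex]
      simp [← whiskerLeft_comp_assoc, re])
  exact ⟨f, fun K x => by simp [hf]⟩

lemma exists_iso_one {R : PolySpan neat X X}
    (n : ∀ (K : M) (x : K ⟶ X), R.ext x ⟶ x) [∀ (K : M) (x : K ⟶ X), IsIso (n K x)]
    (nat : ∀ (K : M) {x x' : K ⟶ X} (g : x ⟶ x'), R.extMap g ≫ n K x' = n K x ≫ g)
    (re : ∀ (K L : M) (k : L ⟶ K) (x : K ⟶ X), k ◁ n K x = R.reindex k x ≫ n L (k ≫ x)) :
    ∃ f : R ≅ one h X, ∀ (K : M) (x : K ⟶ X), cext f.hom x ≫ υ h x = n K x := by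
  obtain ⟨f, hf⟩ := exists_iso h (Q := one h X) (fun K x => n K x ≫ inv (υ h x))
    (fun K x x' g => by
      rw [← cancel_mono (υ h x')]
      simp [υ_naturality, nat])
    (fun K L k x => by
      rw [← cancel_mono (υ h _), Category.assoc, ← υ_reindex]
      simp [← whiskerLeft_comp, re])
  exact ⟨f, fun K x => by simp [hf]⟩

/-- Effects are faithful and `φ` is invertible, so 2-cells into a composite may be compared after
passing to iterated effects. -/
lemma hom_ext_comp {R : PolySpan neat X Z} {P : PolySpan neat X Y} {Q : PolySpan neat Y Z}
    {f g : R ⟶ PolySpan.comp h P Q}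
    (H : ∀ {K : M} (x : K ⟶ X), cext f x ≫ φ h P Q x = cext g x ≫ φ h P Q x) : f = g :=
  cext_injective (gf h _) ((cancel_mono (φ h P Q _)).1 (H _))

end CategoryTheory.Bicategory.PolySpan
end

/-! ### The two biequivalences -/

noncomputable section

namespace CategoryTheory.Diag
open Spn CategoryTheory.Bicategory.PolySpan
section
variable {C : Type u} [Category.{v} C] [HasFiniteLimits C] (h : IsPolynomic (Spn C))
  {W X Y Z : Spn C}

lemma exists_toPoly_comp (P : Diag X.obj Y.obj) (Q : Diag Y.obj Z.obj) :
    ∃ f : (P.comp Q).toPoly (X := X) (Y := Z) ≅ PolySpan.comp h P.toPoly Q.toPoly,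
      ∀ (K : Spn C) (x : K ⟶ X), cext f.hom x ≫ φ h P.toPoly Q.toPoly x = ph P Q x :=
  exists_iso_comp h (fun _ _ => ph P Q _) (fun _ _ _ g => ph_naturality g)
    (fun _ _ k x => ph_reindex k x)

variable (X) in
lemma exists_toPoly_one : ∃ f : (one X.obj).toPoly (X := X) (Y := X) ≅ PolySpan.one h X,
    ∀ (K : Spn C) (x : K ⟶ X), cext f.hom x ≫ υ h x = un x :=
  exists_iso_one h (fun _ x => un x) (fun _ _ _ g => un_naturality g)
    (fun _ _ k x => un_reindex k x)

/-- The comparison of the two compositions of polynomials. -/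
def toPolyComp (P : Diag X.obj Y.obj) (Q : Diag Y.obj Z.obj) :
    (P.comp Q).toPoly (X := X) (Y := Z) ≅ PolySpan.comp h P.toPoly Q.toPoly :=
  (exists_toPoly_comp h P Q).choose

lemma toPolyComp_spec (P : Diag X.obj Y.obj) (Q : Diag Y.obj Z.obj) {K : Spn C} (x : K ⟶ X) :
    cext (toPolyComp h P Q).hom x ≫ φ h P.toPoly Q.toPoly x = ph P Q x :=
  (exists_toPoly_comp h P Q).choose_spec K x

variable (X) in
/-- The comparison of the two identity polynomials. -/
def toPolyOne : (one X.obj).toPoly (X := X) (Y := X) ≅ PolySpan.one h X :=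
  (exists_toPoly_one h X).choose

lemma toPolyOne_spec {K : Spn C} (x : K ⟶ X) : cext (toPolyOne h X).hom x ≫ υ h x = un x :=
  (exists_toPoly_one h X).choose_spec K x

/-- After passing to effects and composing with `φ`, the comparison isomorphisms become `ph` and the
whiskering becomes the effect of `mapPoly β`, which leaves `wl_ph`. The other coherence lemmas
follow the same pattern. -/
lemma mapPoly_wlH (P : Diag X.obj Y.obj) {Q Q' : Diag Y.obj Z.obj} (β : Q ⟶ Q') :
    mapPoly (X := X) (Y := Z) (wlH P β) ≫ (toPolyComp h P Q').hom =
      (toPolyComp h P Q).hom ≫ hcomp h (𝟙 P.toPoly) (mapPoly β) :=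
  hom_ext_comp h fun x => by
    rw [cext_comp, cext_comp, Category.assoc, Category.assoc, hcomp_id_left_spec, toPolyComp_spec,
      ← Category.assoc, toPolyComp_spec, wl_ph]

lemma mapPoly_wrH {P P' : Diag X.obj Y.obj} (α : P ⟶ P') (Q : Diag Y.obj Z.obj) :
    mapPoly (X := X) (Y := Z) (wrH α Q) ≫ (toPolyComp h P' Q).hom =
      (toPolyComp h P Q).hom ≫ hcomp h (mapPoly α) (𝟙 Q.toPoly) :=
  hom_ext_comp h fun x => by
    rw [cext_comp, cext_comp, Category.assoc, Category.assoc, hcomp_id_right_spec, toPolyComp_spec,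
      ← Category.assoc, toPolyComp_spec, wr_ph]

lemma mapPoly_asH (P : Diag W.obj X.obj) (Q : Diag X.obj Y.obj) (R : Diag Y.obj Z.obj) :
    mapPoly (X := W) (Y := Z) (asH P Q R) ≫ (toPolyComp (Y := X) h P (Q.comp R)).hom ≫
        hcomp h (𝟙 P.toPoly) (toPolyComp h Q R).hom =
      (toPolyComp (Y := Y) h (P.comp Q) R).hom ≫ hcomp h (toPolyComp h P Q).hom (𝟙 R.toPoly) ≫
        (exists_assoc h P.toPoly Q.toPoly R.toPoly).choose.hom :=
  hom_ext_comp h fun x => by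
    -- The target is a nested composite: `hom_ext_comp` has removed the outer comparison, and this
    -- removes the inner one. The associator is known only through its effect, so both are needed.
    rw [← cancel_mono (φ h Q.toPoly R.toPoly _)]
    simp only [cext_comp, Category.assoc]
    rw [(exists_assoc h P.toPoly Q.toPoly R.toPoly).choose_spec, ← Category.assoc (cext (hcomp _ _ _) _),
      ← Category.assoc (cext (hcomp _ _ _) _), hcomp_id_left_spec, hcomp_id_right_spec,
      Category.assoc, Category.assoc, toPolyComp_spec, ← extMap_comp, toPolyComp_spec,
      ← Category.assoc (cext (toPolyComp _ _ _).hom _), ← Category.assoc (cext (toPolyComp _ _ _).hom _),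
      toPolyComp_spec, toPolyComp_spec, as_ph]

lemma mapPoly_luH (P : Diag X.obj Y.obj) :
    mapPoly (X := X) (Y := Y) (luH P) = (toPolyComp (Y := X) h (one X.obj) P).hom ≫
      hcomp h (toPolyOne h X).hom (𝟙 P.toPoly) ≫ (exists_left h P.toPoly).choose.hom :=
  cext_injective (gf h _) (by
    rw [cext_comp, cext_comp, (exists_left h P.toPoly).choose_spec,
      ← Category.assoc (cext (hcomp _ _ _) _), hcomp_id_right_spec, Category.assoc, ← extMap_comp,
      toPolyOne_spec, ← Category.assoc, toPolyComp_spec, lu_ph])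

lemma mapPoly_ruH (P : Diag X.obj Y.obj) :
    mapPoly (X := X) (Y := Y) (ruH P) = (toPolyComp (Y := Y) h P (one Y.obj)).hom ≫
      hcomp h (𝟙 P.toPoly) (toPolyOne h Y).hom ≫ (exists_right h P.toPoly).choose.hom :=
  cext_injective (gf h _) (by
    rw [cext_comp, cext_comp, (exists_right h P.toPoly).choose_spec,
      ← Category.assoc (cext (hcomp _ _ _) _), hcomp_id_left_spec, Category.assoc,
      toPolyOne_spec, ← Category.assoc, toPolyComp_spec, ru_ph])

/-- The comparison of polynomials in spans and polynomials. -/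
def pseudoOver : PseudoOver (Poly h) (CPoly C) where
  o X := ⟨X.obj.obj⟩
  L X Y := polyFunctor X.obj Y.obj
  equiv X Y := inferInstanceAs (polyFunctor X.obj Y.obj).IsEquivalence
  -- The isomorphism is rebuilt from its components because it has to live in the hom-category of
  -- `Poly h`, which is that of `PolySpan` by definition.
  mapId X := ⟨(toPolyOne h X.obj).hom, (toPolyOne h X.obj).inv, (toPolyOne h X.obj).hom_inv_id,
    (toPolyOne h X.obj).inv_hom_id⟩
  mapComp {X Y Z} P Q := ⟨(toPolyComp (X := X.obj) (Y := Y.obj) (Z := Z.obj) h P Q).hom,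
    (toPolyComp (X := X.obj) (Y := Y.obj) (Z := Z.obj) h P Q).inv,
    (toPolyComp (X := X.obj) (Y := Y.obj) (Z := Z.obj) h P Q).hom_inv_id,
    (toPolyComp (X := X.obj) (Y := Y.obj) (Z := Z.obj) h P Q).inv_hom_id⟩
  whiskerLeft {X Y Z} P _ _ β := mapPoly_wlH (X := X.obj) (Y := Y.obj) (Z := Z.obj) h P β
  whiskerRight {X Y Z} _ _ α Q := mapPoly_wrH (X := X.obj) (Y := Y.obj) (Z := Z.obj) h α Q
  associator {W X Y Z} P Q R :=
    mapPoly_asH (W := W.obj) (X := X.obj) (Y := Y.obj) (Z := Z.obj) h P Q R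
  leftUnitor {X Y} P := mapPoly_luH (X := X.obj) (Y := Y.obj) h P
  rightUnitor {X Y} P := mapPoly_ruH (X := X.obj) (Y := Y.obj) h P

lemma exists_equivalence (Y : CPoly C) :
    ∃ X : Poly h, Nonempty ((pseudoOver h).o X ≌ Y) :=
  ⟨⟨⟨Y.obj⟩⟩, ⟨Bicategory.Equivalence.id Y⟩⟩

/-- Strength may be tested on any representative because the right leg is a groupoid fibration. For
`toMor α` the left 2-cell is the map of fibres, and a 2-cell of spans is invertible when its map of
apices is. -/
lemma strong_mapPoly_iff {D D' : Diag X.obj Y.obj} (α : D ⟶ D') :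
    Strong (mapPoly α) ↔ Cart α :=
  (strong_cls_iff D'.toPoly.neat_r (toMor α)).trans (Spn.isIso_iff _)

/-- The value of `L` on the preimage of `α` is `α` conjugated by isomorphisms, which does not affect
being strong. -/
lemma cart_pre₂_iff {X Y : Poly h} {P Q : X ⟶ Y} (α : P ⟶ Q) :
    (cart C).prop ((pseudoOver h).toPseudofunctor.map₂ α) ↔ (Poly.strong h).prop α := by
  rw [← (Poly.strong h).iso_comp_iff ((pseudoOver h).preIso P) α ((pseudoOver h).preIso Q),
    ← PseudoOver.map_pre₂]
  exact (strong_mapPoly_iff (X := X.obj) (Y := Y.obj) _).symm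

end
end CategoryTheory.Diag

end

theorem mainTheorem10 {C : Type u} [Category.{v} C] [HasFiniteLimits C] :
    ∃ h : IsPolynomic (Spn C),
      Biequivalent (Poly h) (CPoly C) ∧ Biequivalent (PolyStrong h) (CPolyCart C) := by
  refine ⟨Spn.isPolynomic C, (Diag.pseudoOver _).biequivalent (Diag.exists_equivalence _), ?_⟩
  exact CellClass.biequivalent_sub (Diag.pseudoOver _).toPseudofunctor (Diag.cart_pre₂_iff _)
    (fun _ _ => {}) fun Y => ⟨⟨⟨⟨Y.obj.obj⟩⟩⟩, ⟨Bicategory.Equivalence.id Y⟩⟩
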